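/- Let $M$ be a smooth (Hausdorff, finite-dimensional) manifold, let $\Lambda$ be a smooth bivector field and $\Gamma$ a smooth vector field on $M$, and let $X=\Lambda+I\wedge\Gamma$ be a Jacobi structure on $M$, i.e. the first-order bidifferential operator $\{f,g\}=\Lambda(df,dg)+f\,\Gamma(g)-g\,\Gamma(f)$ is a Lie bracket on $C^\infty(M)$. Consider the Lie algebroid $TM\oplus\mathbb R$ over $M$ with anchor the projection to $TM$ and bracket $[(Y,f),(Z,g)]=([Y,Z],Y(g)-Z(f))$, and its 1-cocycle $\Phi(Y,f)=f$; view $X$ as a section of $\bigwedge^2(TM\oplus\mathbb R)$, where $I$ is the section $(0,1)$. For a Lie algebroid $L\to M$ with projection $\tau:L\to M$, anchor $a$ and Lie derivative $\mathcal L$, write $\iota_\mu$ for the fibrewise linear function on $L$ defined by a section $\mu$ of $L^*$, $Y\mapsto Y^v$ for the vertical lift of sections of $\bigwedge L$ to multivector fields on $L$ (with $f^v=f\circ\tau$), and $Y\mapsto Y^c$ for the complete lift: it is the additive map from sections of $\bigwedge L$ to multivector fields on $L$ characterized by $f^c=\iota_{df}$ for functions $f$ on $M$, by $Y^c(\iota_\mu)=\iota_{\mathcal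 L_Y\mu}$ and $Y^c(f\circ\tau)=a(Y)(f)\circ\tau$ for sections $Y$ of $L$ and $\mu$ of $L^*$, and by $(Y\wedge Z)^c=Y^c\wedge Z^v+Y^v\wedge Z^c$ (including the case where $Y$ is a function). The Jacobi lift of $X$ is the first-order bidifferential operator on the total space of $TM\oplus\mathbb R$ $$\hat X_\Phi=X^c-\iota_\Phi X^v+I\wedge(i_\Phi X)^v,\qquad i_\Phi X=X(\Phi,\cdot),$$ where in the last term $I$ is the identity operator on functions. Then complete lifts of sections and bisections exist for the Lie algebroids $TM$ and $TM\oplus\mathbb R$, and the Jacobi lift $\hat X_\Phi$ is a homogeneous Jacobi structure on the manifold $TM\oplus\mathbb R$: it is a Jacobi structure, and for the Liouville vector field $\nabla$ of the vector bundle $TM\oplus\mathbb R\to M$ and all smooth functions $f,g$ on $TM\oplus\mathbb R$ its bracket satisfies $\nabla\{f,g\}-\{\nabla f,g\}-\{f,\nabla g\}=-\{f,g\}$. Moreover, $$\hat X_\Phi=\Lambda^c+\partial_t\wedge\Gamma^c-t\,(\Lambda^v+\partial_t\wedge\Gamma^v)+I\wedge\Gamma^v,$$ where $\Lambda^c,\Lambda^v,\Gamma^c,\Gamma^v$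 are the complete and vertical lifts to $TM$ (extended to $TM\oplus\mathbb R\cong TM\times\mathbb R$ as multivector fields tangent to the levels of $t$ and independent of $t$) and $t$ is the canonical linear coordinate on $\mathbb R$. -/

import Mathlib

open Bundle Manifold
open scoped ContDiff

noncomputable section

namespace JacobiLift

/-! ### Sections of a vector bundle, of its dual and of its second exterior power -/

section Bundles

variable {E H M : Type*} [NormedAddCommGroup E] [NormedSpace ℝ E] [TopologicalSpace H]
  (I : ModelWithCorners ℝ E H) [TopologicalSpace M] [ChartedSpace H M]
  (F : Type*) [NormedAddCommGroup F] [NormedSpace ℝ F]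
  {V : M → Type*} [TopologicalSpace (TotalSpace F V)]
  [∀ p, TopologicalSpace (V p)] [∀ p, AddCommGroup (V p)] [∀ p, Module ℝ (V p)]

/-- The differential at `p` of a real function on a manifold, as a covector. -/
def diff (f : M → ℝ) (p : M) : TangentSpace I p →L[ℝ] ℝ :=
  mfderiv I 𝓘(ℝ, ℝ) f p

/-- A family of bilinear forms on the dual fibres. The alternating ones are the sections of the
second exterior power of a bundle of finite rank. -/
abbrev Bitensor (V : M → Type*)
    [∀ p, TopologicalSpace (V p)] [∀ p, AddCommGroup (V p)] [∀ p, Module ℝ (V p)] :=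
  ∀ p, (V p →L[ℝ] ℝ) →ₗ[ℝ] (V p →L[ℝ] ℝ) →ₗ[ℝ] ℝ

/-- `x ∧ y`, with the convention `(x ∧ y)(μ, ν) = μ(x) ν(y) - ν(x) μ(y)`. -/
def wedge {W : Type*} [TopologicalSpace W] [AddCommGroup W] [Module ℝ W] (x y : W) :
    (W →L[ℝ] ℝ) →ₗ[ℝ] (W →L[ℝ] ℝ) →ₗ[ℝ] ℝ :=
  LinearMap.mk₂ ℝ (fun μ ν => μ x * ν y - ν x * μ y)
    (fun _ _ _ => by simp; ring) (fun _ _ _ => by simp; ring)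
    (fun _ _ _ => by simp; ring) (fun _ _ _ => by simp; ring)

/-- The image of a bivector under a linear map. -/
def pushBi {W W' : Type*} [TopologicalSpace W] [AddCommGroup W] [Module ℝ W]
    [TopologicalSpace W'] [AddCommGroup W'] [Module ℝ W'] (φ : W →L[ℝ] W')
    (P : (W →L[ℝ] ℝ) →ₗ[ℝ] (W →L[ℝ] ℝ) →ₗ[ℝ] ℝ) :
    (W' →L[ℝ] ℝ) →ₗ[ℝ] (W' →L[ℝ] ℝ) →ₗ[ℝ] ℝ :=
  LinearMap.mk₂ ℝ (fun μ ν => P (μ.comp φ) (ν.comp φ))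
    (fun _ _ _ => by simp [ContinuousLinearMap.add_comp])
    (fun _ _ _ => by simp [ContinuousLinearMap.smul_comp])
    (fun _ _ _ => by simp [ContinuousLinearMap.add_comp])
    (fun _ _ _ => by simp [ContinuousLinearMap.smul_comp])

/-- The fibrewise linear function `ι_μ` on the total space defined by a section of the dual. -/
def linFun (μ : ∀ p, V p →L[ℝ] ℝ) (e : TotalSpace F V) : ℝ := μ e.proj e.2

variable [FiberBundle F V]

/-- Smooth sections. -/
def SmoothSection (X : ∀ p, V p) : Prop :=
  ContMDiff I (I.prod 𝓘(ℝ, F)) ∞ (fun p => TotalSpace.mk' F p (X p))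

/-- Smooth sections of the dual bundle. -/
def SmoothDual (μ : ∀ p, V p →L[ℝ] ℝ) : Prop :=
  ContMDiff (I.prod 𝓘(ℝ, F)) 𝓘(ℝ, ℝ) ∞ (linFun F μ)

/-- Smooth sections of the second exterior power. -/
def SmoothBisection (P : Bitensor V) : Prop :=
  (∀ p μ, P p μ μ = 0) ∧
    ∀ μ ν : ∀ p, V p →L[ℝ] ℝ, SmoothDual I F μ → SmoothDual I F ν →
      ContMDiff I 𝓘(ℝ, ℝ) ∞ (fun p => P p (μ p) (ν p))

variable [VectorBundle ℝ F V]

/-- The canonical isomorphism of the fibre through `e` with the vertical tangent space at `e`,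
that is, the derivative at `0` of `w ↦ e + w`, where `w` is in the fibre through `e`. -/
def vert (e : TotalSpace F V) : V e.proj →L[ℝ] TangentSpace (I.prod 𝓘(ℝ, F)) e :=
  let t := trivializationAt F V e.proj
  let δ : F →L[ℝ] TangentSpace (I.prod 𝓘(ℝ, F)) e :=
    mfderiv 𝓘(ℝ, F) (I.prod 𝓘(ℝ, F))
      (fun y : F => TotalSpace.mk' F e.proj (e.2 + t.symmL ℝ e.proj y)) 0
  δ.comp (t.continuousLinearMapAt ℝ e.proj)

/-- The vertical lift of a section. -/
def vLift (X : ∀ p, V p) (e : TotalSpace F V) : TangentSpace (I.prod 𝓘(ℝ, F)) e :=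
  vert I F e (X e.proj)

/-- The vertical lift of a section of the second exterior power. -/
def vLiftBi (P : Bitensor V) :
    Bitensor (fun e : TotalSpace F V => TangentSpace (I.prod 𝓘(ℝ, F)) e) :=
  fun e => pushBi (vert I F e) (P e.proj)

/-- The Liouville vector field. -/
def liouville (e : TotalSpace F V) : TangentSpace (I.prod 𝓘(ℝ, F)) e :=
  vert I F e e.2

end Bundles

/-! ### Jacobi structures -/

section Jacobi

variable {E H M : Type*} [NormedAddCommGroup E] [NormedSpace ℝ E] [TopologicalSpace H]
  (I : ModelWithCorners ℝ E H) [TopologicalSpace M] [ChartedSpace H M]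

/-- The data `Λ`, `Γ` of the skew bidifferential operator of first order `Λ + I ∧ Γ`, where `Λ` is
a bivector field, `Γ` a vector field and `I` the identity operator on functions. -/
@[ext]
structure BiOp (M : Type*) [TopologicalSpace M] [ChartedSpace H M] where
  biv : Bitensor (fun p : M => TangentSpace I p)
  vec : ∀ p : M, TangentSpace I p

variable {I}

/-- The value of the operator `Λ + I ∧ Γ`:
`{f, g} = Λ(df, dg) + f Γ(g) - g Γ(f)`. -/
def BiOp.bracket (X : BiOp I M) (f g : M → ℝ) (p : M) : ℝ :=
  X.biv p (diff I f p) (diff I g p)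
    + f p * diff I g p (X.vec p) - g p * diff I f p (X.vec p)

/-- `Λ + I ∧ Γ` is a Jacobi structure: `Λ` is a smooth bivector field, `Γ` a smooth vector field,
and the first order bidifferential operator `Λ + I ∧ Γ` is a Lie bracket on smooth functions. -/
structure BiOp.IsJacobi [IsManifold I 1 M] (X : BiOp I M) : Prop where
  smooth_biv : SmoothBisection I E X.biv
  smooth_vec : SmoothSection I E X.vec
  jacobi : ∀ f g h : M → ℝ, ContMDiff I 𝓘(ℝ, ℝ) ∞ f → ContMDiff I 𝓘(ℝ, ℝ) ∞ g →
    ContMDiff I 𝓘(ℝ, ℝ) ∞ h → ∀ p,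
      X.bracket (X.bracket f g) h p + X.bracket (X.bracket g h) f p
        + X.bracket (X.bracket h f) g p = 0

end Jacobi

/-! ### Lie algebroids, complete lifts and Jacobi lifts -/

section Lifts

variable {E H M : Type*} [NormedAddCommGroup E] [NormedSpace ℝ E] [TopologicalSpace H]
  (I : ModelWithCorners ℝ E H) [TopologicalSpace M] [ChartedSpace H M]

/-- The anchor and the bracket (of sections) of a Lie algebroid. Below there are just two of them,
the tangent algebroid and its extension by functions, with their canonical operations. -/
structure AlgebroidOps (V : M → Type*)
    [∀ p, TopologicalSpace (V p)] [∀ p, AddCommGroup (V p)] [∀ p, Module ℝ (V p)] where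
  anchor : ∀ p, V p →L[ℝ] TangentSpace I p
  bracket : (∀ p, V p) → (∀ p, V p) → ∀ p, V p

variable {I}
variable (F : Type*) [NormedAddCommGroup F] [NormedSpace ℝ F]
  {V : M → Type*} [TopologicalSpace (TotalSpace F V)]
  [∀ p, TopologicalSpace (V p)] [∀ p, AddCommGroup (V p)] [∀ p, Module ℝ (V p)]

/-- The section `df` of the dual bundle. -/
def AlgebroidOps.d (A : AlgebroidOps I V) (f : M → ℝ) (p : M) : V p →L[ℝ] ℝ :=
  (diff I f p).comp (A.anchor p)

/-- The value at the section `Y` of the Lie derivative along `X` of the section `μ` of the dual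
bundle: `(£_X μ)(Y) = a(X)(μ(Y)) - μ([X, Y])`. -/
def AlgebroidOps.lieDeriv (A : AlgebroidOps I V) (X : ∀ p, V p) (μ : ∀ p, V p →L[ℝ] ℝ)
    (Y : ∀ p, V p) (p : M) : ℝ :=
  diff I (fun q => μ q (Y q)) p (A.anchor p (X p)) - μ p (A.bracket X Y p)

variable [FiberBundle F V] [VectorBundle ℝ F V]

/-- A pair of maps, from sections of a bundle to vector fields on its total space, and from sections
of its second exterior power to bivector fields on its total space. -/
structure LiftMaps (I : ModelWithCorners ℝ E H) (V : M → Type*) [TopologicalSpace (TotalSpace F V)]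
    [∀ p, TopologicalSpace (V p)] [∀ p, AddCommGroup (V p)] [∀ p, Module ℝ (V p)]
    [FiberBundle F V] where
  onVec : (∀ p, V p) → ∀ e : TotalSpace F V, TangentSpace (I.prod 𝓘(ℝ, F)) e
  onBi : Bitensor V → Bitensor (fun e : TotalSpace F V => TangentSpace (I.prod 𝓘(ℝ, F)) e)

/-- The properties that characterize the complete lift `X ↦ X^c` of a Lie algebroid in degrees up to
two, the complete lift of a function `f` being the linear function `f^c = ι_{df}` and its vertical
lift being its pull-back. Only the values at smooth sections are restricted. -/
structure IsCompleteLift [IsManifold I ∞ M] [ContMDiffVectorBundle ∞ F V I]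
    (A : AlgebroidOps I V) (c : LiftMaps F I V) : Prop where
  smooth_vec : ∀ X, SmoothSection I F X →
    SmoothSection (I.prod 𝓘(ℝ, F)) (E × F) (c.onVec X)
  smooth_bi : ∀ P, SmoothBisection I F P →
    SmoothBisection (I.prod 𝓘(ℝ, F)) (E × F) (c.onBi P)
  /-- `X^c(f ∘ τ) = a(X)(f) ∘ τ`. -/
  pullback : ∀ X, SmoothSection I F X → ∀ f : M → ℝ, ContMDiff I 𝓘(ℝ, ℝ) ∞ f →
    ∀ e : TotalSpace F V,
      diff (I.prod 𝓘(ℝ, F)) (fun e' : TotalSpace F V => f e'.proj) e (c.onVec X e)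
        = A.d f e.proj (X e.proj)
  /-- `X^c(ι_μ) = ι_{£_X μ}`, at the point `Y(p)` of the total space. -/
  linear : ∀ X, SmoothSection I F X → ∀ μ, SmoothDual I F μ → ∀ Y, SmoothSection I F Y → ∀ p : M,
    diff (I.prod 𝓘(ℝ, F)) (linFun F μ) ⟨p, Y p⟩ (c.onVec X ⟨p, Y p⟩) = A.lieDeriv X μ Y p
  add : ∀ P Q, SmoothBisection I F P → SmoothBisection I F Q → c.onBi (P + Q) = c.onBi P + c.onBi Q
  /-- `(f P)^c = f^c P^v + f^v P^c`. -/
  smul : ∀ f : M → ℝ, ContMDiff I 𝓘(ℝ, ℝ) ∞ f → ∀ P, SmoothBisection I F P →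
    ∀ e : TotalSpace F V, c.onBi (fun p => f p • P p) e
      = linFun F (A.d f) e • vLiftBi I F P e + f e.proj • c.onBi P e
  /-- `(X ∧ Y)^c = X^c ∧ Y^v + X^v ∧ Y^c`. -/
  wedge : ∀ X Y, SmoothSection I F X → SmoothSection I F Y →
    ∀ e : TotalSpace F V, c.onBi (fun p => wedge (X p) (Y p)) e
      = wedge (c.onVec X e) (vLift I F Y e) + wedge (vLift I F X e) (c.onVec Y e)

/-- The complete lift of a Lie algebroid. -/
def completeLift [IsManifold I ∞ M] [ContMDiffVectorBundle ∞ F V I]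
    (A : AlgebroidOps I V) : LiftMaps F I V :=
  letI : Nonempty (LiftMaps F I V) := ⟨⟨fun _ _ => 0, fun _ _ => 0⟩⟩
  Classical.epsilon (IsCompleteLift F A)

/-- The contraction `i_μ P = P(μ, ·)`, an element of the fibre: the vector `v` with
`ν(v) = P(μ, ν)` for all covectors `ν`. -/
def contract {W : Type*} [TopologicalSpace W] [AddCommGroup W] [Module ℝ W] (μ : W →L[ℝ] ℝ)
    (P : (W →L[ℝ] ℝ) →ₗ[ℝ] (W →L[ℝ] ℝ) →ₗ[ℝ] ℝ) : W :=
  Classical.epsilon (fun v => ∀ ν : W →L[ℝ] ℝ, ν v = P μ ν)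

/-- The Jacobi lift `X^c - ι_Φ X^v + I ∧ (i_Φ X)^v` of a section `X` of the second exterior power
(which has Lie algebra degree one) of a Lie algebroid with a `1`-cocycle `Φ`. -/
def jacobiLift [IsManifold I ∞ M] [ContMDiffVectorBundle ∞ F V I]
    (A : AlgebroidOps I V) (Φ : ∀ p, V p →L[ℝ] ℝ) (P : Bitensor V) :
    BiOp (I.prod 𝓘(ℝ, F)) (TotalSpace F V) where
  biv := fun e => (completeLift F A).onBi P e - linFun F Φ e • vLiftBi I F P e
  vec := vLift I F (fun p => contract (Φ p) (P p))

/-- A first order bidifferential operator on the total space of a vector bundle is homogeneous if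
its bracket with the Liouville vector field `∇` is its opposite:
`∇{f, g} - {∇f, g} - {f, ∇g} = -{f, g}`. -/
def IsHomogeneous (X : BiOp (I.prod 𝓘(ℝ, F)) (TotalSpace F V)) : Prop :=
  let nabla : (TotalSpace F V → ℝ) → TotalSpace F V → ℝ :=
    fun f e => diff (I.prod 𝓘(ℝ, F)) f e (liouville I F e)
  ∀ f g : TotalSpace F V → ℝ, ContMDiff (I.prod 𝓘(ℝ, F)) 𝓘(ℝ, ℝ) ∞ f →
    ContMDiff (I.prod 𝓘(ℝ, F)) 𝓘(ℝ, ℝ) ∞ g → ∀ e,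
      nabla (X.bracket f g) e - X.bracket (nabla f) g e - X.bracket f (nabla g) e
        = - X.bracket f g e

end Lifts

/-! ### The bundles `TM` and `TM ⊕ ℝ` -/

section Tangent

variable {E H : Type*} [NormedAddCommGroup E] [NormedSpace ℝ E] [TopologicalSpace H]
  (I : ModelWithCorners ℝ E H) (M : Type*) [TopologicalSpace M] [ChartedSpace H M]

/-- The canonical Lie algebroid `TM`. -/
def tangentOps : AlgebroidOps I (fun p : M => TangentSpace I p) where
  anchor := fun p => ContinuousLinearMap.id ℝ (TangentSpace I p)
  bracket := fun X Y => VectorField.mlieBracket I X Y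

/-- The fibres of `TM ⊕ ℝ`. -/
abbrev ExtFibre (p : M) : Type _ :=
  ((fun p : M => TangentSpace I p) ×ᵇ (Bundle.Trivial M ℝ)) p

/-- The total space of `TM ⊕ ℝ`. -/
abbrev ExtSpace : Type _ := TotalSpace (E × ℝ) (ExtFibre I M)

/-- The model with corners of the manifold `TM`. -/
abbrev tangentModel : ModelWithCorners ℝ (E × E) (ModelProd H E) := I.prod 𝓘(ℝ, E)

/-- The model with corners of the manifold `TM ⊕ ℝ`. -/
abbrev extModel : ModelWithCorners ℝ (E × (E × ℝ)) (ModelProd H (E × ℝ)) := I.prod 𝓘(ℝ, E × ℝ)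

variable {M}

/-- The element `(v, s)` of the fibre of `TM ⊕ ℝ` at `p`. -/
def extMk (p : M) (v : TangentSpace I p) (s : ℝ) : ExtFibre I M p := (v, s)

/-- The inclusion `v ↦ (v, 0)` of the fibres of `TM` in those of `TM ⊕ ℝ`. -/
def incl (p : M) : TangentSpace I p →L[ℝ] ExtFibre I M p :=
  ContinuousLinearMap.inl ℝ (TangentSpace I p) ℝ

/-- The cocycle `Φ(v, s) = s`. -/
def cocycle (p : M) : ExtFibre I M p →L[ℝ] ℝ :=
  ContinuousLinearMap.snd ℝ (TangentSpace I p) ℝ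

variable (M)

/-- The extension `TM ⊕ ℝ` of `TM` relative to the anchor map:
`[(X, f), (Y, g)] = ([X, Y], X(g) - Y(f))`, and the anchor is the projection on `TM`. -/
def extOps : AlgebroidOps I (ExtFibre I M) where
  anchor := fun p => ContinuousLinearMap.fst ℝ (TangentSpace I p) ℝ
  bracket := fun X Y p => extMk I p
    (VectorField.mlieBracket I (fun q => (X q).1) (fun q => (Y q).1) p)
    (diff I (fun q => ((Y q).2 : ℝ)) p (X p).1 - diff I (fun q => ((X q).2 : ℝ)) p (Y p).1)

variable {M}

variable {I} in
/-- `Λ + I ∧ Γ` as a section of the second exterior power of `TM ⊕ ℝ`; the identity operator `I` is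
the section `(0, 1)`. -/
def BiOp.toExt (X : BiOp I M) : Bitensor (ExtFibre I M) := fun p =>
  pushBi (incl I p) (X.biv p) + wedge (extMk I p 0 1) (incl I p (X.vec p))

variable [IsManifold I 1 M]

/-- The tangent map at `v` of the inclusion of `TM` in `TM ⊕ ℝ` as the level `t` of the canonical
coordinate on `ℝ`, for `(v, t) = e`. -/
def levelMap (e : ExtSpace I M) :
    TangentSpace (tangentModel I) (⟨e.proj, e.2.1⟩ : TangentBundle I M)
      →L[ℝ] TangentSpace (extModel I) e :=
  mfderiv (tangentModel I) (extModel I)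
    (fun v : TangentBundle I M => (⟨v.proj, extMk I v.proj v.2 e.2.2⟩ : ExtSpace I M))
    (⟨e.proj, e.2.1⟩ : TangentBundle I M)

/-- A vector field on `TM` as a vector field on `TM ⊕ ℝ`. -/
def fromTM (Y : ∀ v : TangentBundle I M, TangentSpace (tangentModel I) v) (e : ExtSpace I M) :
    TangentSpace (extModel I) e :=
  levelMap I e (Y ⟨e.proj, e.2.1⟩)

/-- A bivector field on `TM` as a bivector field on `TM ⊕ ℝ`. -/
def fromTMBi (P : Bitensor (fun v : TangentBundle I M => TangentSpace (tangentModel I) v)) :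
    Bitensor (fun e : ExtSpace I M => TangentSpace (extModel I) e) :=
  fun e => pushBi (levelMap I e) (P ⟨e.proj, e.2.1⟩)

/-- The canonical coordinate `t` on `TM ⊕ ℝ`. -/
def coordT (e : ExtSpace I M) : ℝ := e.2.2

/-- The vector field `∂_t` on `TM ⊕ ℝ`. -/
def partialT (e : ExtSpace I M) : TangentSpace (extModel I) e :=
  (mfderiv 𝓘(ℝ, ℝ) (extModel I)
    (fun s : ℝ => (⟨e.proj, extMk I e.proj e.2.1 s⟩ : ExtSpace I M)) (coordT I e) :
      ℝ →L[ℝ] TangentSpace (extModel I) e) 1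

end Tangent

section Explicit

variable {E H : Type*} [NormedAddCommGroup E] [NormedSpace ℝ E] [TopologicalSpace H]
  {I : ModelWithCorners ℝ E H} {M : Type*} [TopologicalSpace M] [ChartedSpace H M]
  [IsManifold I ∞ M]

/-- The Jacobi lift of `X = Λ + I ∧ Γ`, with respect to the Lie algebroid `TM ⊕ ℝ` and the cocycle
`Φ(v, s) = s`. -/
def BiOp.lift (X : BiOp I M) : BiOp (extModel I) (ExtSpace I M) :=
  jacobiLift (E × ℝ) (extOps I M) (cocycle I) X.toExt

/-- `Λ^c + ∂_t ∧ Γ^c - t (Λ^v + ∂_t ∧ Γ^v) + I ∧ Γ^v`, where the superscripts denote the complete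
and the vertical lifts to `TM`. -/
def BiOp.explicitLift (X : BiOp I M) : BiOp (extModel I) (ExtSpace I M) where
  biv := fun e =>
    fromTMBi I ((completeLift E (tangentOps I M)).onBi X.biv) e
      + wedge (partialT I e) (fromTM I ((completeLift E (tangentOps I M)).onVec X.vec) e)
      - coordT I e • (fromTMBi I (vLiftBi I E X.biv) e
          + wedge (partialT I e) (fromTM I (vLift I E X.vec) e))
  vec := fromTM I (vLift I E X.vec)

end Explicit

end JacobiLift
end

open JacobiLift

open JacobiLift
open Filter Topology

set_option linter.unusedSectionVars false

noncomputable section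

/-! Pair functions `a`, `f` on `M` into `A(a, f) = a ∘ τ + ι_{df} + t (f ∘ τ)` on `TM ⊕ ℝ`. The lift
satisfies `{A(a, f), A(b, g)} = A({a, g} + {f, b}, {f, g})` (`BiOp.bracket_lift_affineFun`). Reading
`(a, f)` as `f + ε a` with `ε² = 0`, this is the given bracket extended to dual numbers, so it
inherits the Jacobi identity. The Liouville field acts by `∇ A(a, f) = A(0, f)`, and homogeneity on
these functions is then immediate.

Two facts pass from these functions to all functions. First, the Jacobiator and the homogeneity
defect of a skew first-order operator depend only on the 1-jets of their arguments: second
derivatives enter only through differences `Y Z f - Z Y f`, which vanish at critical points of `f`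
(`BiOp.jacobiator_eq_zero_of_jet`, `BiOp.homogeneityDefect_eq_zero_of_jet`). Second, every 1-jet on
`TM ⊕ ℝ` is that of some `A(a, f)` (`exists_affineFun_eq_jet`).

Complete lifts are controlled by their values on pull-backs `f ∘ τ` and on `ι_α` for a few closed
forms `α`, since these contain local coordinates (`HasCoordinatesIn`, `IsLiftOn`). On `TM` the forms
are the `df`, and the lift is built in coordinates and extended by Leibniz. On `TM ⊕ ℝ` one adds the
cocycle `Φ`, with `ι_Φ = t`, and puts `(Λ + I ∧ Γ)^c = Λ^c + ∂_t ∧ Γ^c`. Since `completeLift` is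
chosen abstractly, computations need uniqueness on smooth data (`IsCompleteLift.onVec_eq`,
`IsCompleteLift.onBi_eq`). The explicit formula then follows from the construction of `extLift` and
the splitting of vertical lifts. -/

namespace JacobiLift

/-! ### Differentials of real functions, and the Lie bracket in a chart -/

section Diff

variable {E H M : Type*} [NormedAddCommGroup E] [NormedSpace ℝ E] [TopologicalSpace H]
  {I : ModelWithCorners ℝ E H} [TopologicalSpace M] [ChartedSpace H M]

variable (I) in
/-- Smooth real functions. -/
abbrev SmoothFun (f : M → ℝ) : Prop := ContMDiff I 𝓘(ℝ, ℝ) ∞ f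

variable {f g : M → ℝ} {p : M}

theorem SmoothFun.mdiffAt (hf : SmoothFun I f) : MDifferentiableAt I 𝓘(ℝ, ℝ) f p :=
  hf.mdifferentiable (by simp) p

theorem diff_congr (h : f =ᶠ[𝓝 p] g) : diff I f p = diff I g p := by
  unfold diff
  have hp := h.self_of_nhds
  exact h.mfderiv_eq

theorem diff_const (c : ℝ) : diff I (fun _ : M => c) p = 0 :=
  mfderiv_const

theorem diff_add (hf : MDifferentiableAt I 𝓘(ℝ, ℝ) f p) (hg : MDifferentiableAt I 𝓘(ℝ, ℝ) g p) :
    diff I (fun q => f q + g q) p = diff I f p + diff I g p :=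
  mfderiv_add hf hg

theorem diff_mul (hf : MDifferentiableAt I 𝓘(ℝ, ℝ) f p) (hg : MDifferentiableAt I 𝓘(ℝ, ℝ) g p) :
    diff I (fun q => f q * g q) p = f p • diff I g p + g p • diff I f p :=
  mvfderiv_mul hf hg

theorem diff_neg : diff I (fun q => -f q) p = -diff I f p :=
  mfderiv_neg

theorem diff_sub (hf : MDifferentiableAt I 𝓘(ℝ, ℝ) f p) (hg : MDifferentiableAt I 𝓘(ℝ, ℝ) g p) :
    diff I (fun q => f q - g q) p = diff I f p - diff I g p :=
  mfderiv_sub hf hg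

theorem diff_const_mul (c : ℝ) (hf : MDifferentiableAt I 𝓘(ℝ, ℝ) f p) :
    diff I (fun q => c * f q) p = c • diff I f p := by
  rw [diff_mul mdifferentiableAt_const hf, diff_const, smul_zero, add_zero]

theorem mdiffAt_sum {ι : Type*} {s : Finset ι} {F : ι → M → ℝ}
    (h : ∀ i ∈ s, MDifferentiableAt I 𝓘(ℝ, ℝ) (F i) p) :
    MDifferentiableAt I 𝓘(ℝ, ℝ) (fun q => ∑ i ∈ s, F i q) p := by
  classical
  induction s using Finset.induction_on with
  | empty => simpa using mdifferentiableAt_const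
  | insert a s ha ih =>
    simp only [Finset.sum_insert ha]
    exact (h a (by simp)).add (ih fun i hi => h i (by simp [hi]))

theorem diff_sum {ι : Type*} {s : Finset ι} {F : ι → M → ℝ}
    (h : ∀ i ∈ s, MDifferentiableAt I 𝓘(ℝ, ℝ) (F i) p) :
    diff I (fun q => ∑ i ∈ s, F i q) p = ∑ i ∈ s, diff I (F i) p := by
  classical
  induction s using Finset.induction_on with
  | empty => simpa using diff_const 0
  | insert a s ha ih =>
    simp only [Finset.sum_insert ha]
    rw [diff_add (h a (by simp)) (mdiffAt_sum fun i hi => h i (by simp [hi])),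
      ih fun i hi => h i (by simp [hi])]

theorem diff_comp {E' H' M' : Type*} [NormedAddCommGroup E'] [NormedSpace ℝ E']
    [TopologicalSpace H'] {I' : ModelWithCorners ℝ E' H'} [TopologicalSpace M'] [ChartedSpace H' M']
    {φ : M' → M} {q : M'} (hf : MDifferentiableAt I 𝓘(ℝ, ℝ) f (φ q))
    (hφ : MDifferentiableAt I' I φ q) (w : TangentSpace I' q) :
    diff I' (fun x => f (φ x)) q w = diff I f (φ q) (mfderiv I' I φ q w) :=
  mfderiv_comp_apply q hf hφ w

theorem diff_apply_eq_fderiv [I.Boundaryless] (hf : MDifferentiableAt I 𝓘(ℝ, ℝ) f p)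
    (w : TangentSpace I p) :
    diff I f p w = fderiv ℝ (fun y => f ((extChartAt I p).symm y)) (extChartAt I p p) w := by
  have h1 : fderivWithin ℝ (writtenInExtChartAt I 𝓘(ℝ, ℝ) p f) (Set.range I) (extChartAt I p p) =
      fderiv ℝ (fun y => f ((extChartAt I p).symm y)) (extChartAt I p p) := by
    rw [I.range_eq_univ, fderivWithin_univ]
    rfl
  exact congrArg (fun T : E →L[ℝ] ℝ => T w) (hf.mfderiv.trans h1)

/-- On `TM` the function `ι_{df}` is the fibre component of the tangent map of `f`. -/
theorem smoothDual_diff [IsManifold I ∞ M] (hf : SmoothFun I f) : SmoothDual I E (diff I f) := by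
  have h : ContMDiff I.tangent 𝓘(ℝ, ℝ).tangent ∞ (tangentMap I 𝓘(ℝ, ℝ) f) :=
    hf.contMDiff_tangentMap (by simp)
  exact (contMDiff_snd_tangentBundle_modelSpace ℝ 𝓘(ℝ, ℝ)).comp h

theorem mdiffAt_symm [I.Boundaryless] [IsManifold I ∞ M] {y : E}
    (hy : y ∈ (extChartAt I p).target) :
    MDifferentiableAt 𝓘(ℝ, E) I (extChartAt I p).symm y :=
  (((contMDiffOn_extChartAt_symm (n := ∞) p).contMDiffAt
    ((isOpen_extChartAt_target p).mem_nhds hy))).mdifferentiableAt (by simp)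

/-- A vector field in the chart at `p`. -/
def chartField (I : ModelWithCorners ℝ E H) (p : M) (Z : ∀ q : M, TangentSpace I q) : E → E :=
  VectorField.mpullbackWithin 𝓘(ℝ, E) I (extChartAt I p).symm Z Set.univ

/-- The tangent space at `p` is identified with `E` through the preferred chart at `p`, whose
derivative at `p` is therefore the identity; the pull-back back to the manifold disappears. -/
theorem mlieBracket_eq_lieBracket_chartField [I.Boundaryless] [IsManifold I ∞ M]
    (X Y : ∀ q : M, TangentSpace I q) :
    VectorField.mlieBracket I X Y p =
      VectorField.lieBracket ℝ (chartField I p X) (chartField I p Y) (extChartAt I p p) := by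
  have h1 : (mfderiv I 𝓘(ℝ, E) (extChartAt I p) p : E →L[ℝ] E) = ContinuousLinearMap.id ℝ E :=
    mfderiv_extChartAt_self
  have h2 : ((mfderiv I 𝓘(ℝ, E) (extChartAt I p) p : E →L[ℝ] E)).inverse
      = ContinuousLinearMap.id ℝ E := by
    exact (congrArg (fun T : E →L[ℝ] E => T.inverse) h1).trans ContinuousLinearMap.inverse_id
  refine (congrArg (fun T : E →L[ℝ] E => T _) h2).trans ?_
  unfold chartField
  simp only [I.range_eq_univ, Set.preimage_univ, Set.inter_univ]
  exact congrFun VectorField.lieBracketWithin_univ _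

theorem chartField_self [I.Boundaryless] [IsManifold I ∞ M] (Z : ∀ q : M, TangentSpace I q) :
    chartField I p Z (extChartAt I p p) = Z p := by
  have h1 : (mfderiv 𝓘(ℝ, E) I (extChartAt I p).symm (extChartAt I p p) : E →L[ℝ] E)
      = ContinuousLinearMap.id ℝ E := by
    have := mfderivWithin_range_extChartAt_symm (I := I) (x := p)
    rwa [I.range_eq_univ, mfderivWithin_univ] at this
  have h2 : (mfderivWithin 𝓘(ℝ, E) I (extChartAt I p).symm Set.univ (extChartAt I p p)
      : E →L[ℝ] E).inverse = ContinuousLinearMap.id ℝ E := by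
    rw [mfderivWithin_univ]
    exact (congrArg (fun T : E →L[ℝ] E => T.inverse) h1).trans ContinuousLinearMap.inverse_id
  refine (congrArg (fun T : E →L[ℝ] E => T _) h2).trans ?_
  have : ∀ q, q = p → (Z q : E) = Z p := by rintro _ rfl; rfl
  exact this _ (extChartAt_to_inv p)

theorem differentiableAt_chartField [CompleteSpace E] [I.Boundaryless] [IsManifold I ∞ M]
    {Z : ∀ q : M, TangentSpace I q}
    (hZ : MDifferentiableAt I I.tangent (fun q => (⟨q, Z q⟩ : TangentBundle I M)) p) :
    DifferentiableAt ℝ (chartField I p Z) (extChartAt I p p) := by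
  have h := MDifferentiableWithinAt.differentiableWithinAt_mpullbackWithin_vectorField
    (hZ.mdifferentiableWithinAt (s := Set.univ))
  simp only [I.range_eq_univ, Set.preimage_univ, Set.inter_univ] at h
  exact differentiableWithinAt_univ.1 h

/-- The inverse chart sends the chart field to `Z`, so this is the chain rule. It is needed on a
neighbourhood because both sides get differentiated once more in `diff_mlieBracket`. -/
theorem eventually_fderiv_chartField [I.Boundaryless] [IsManifold I ∞ M]
    (hf : ∀ᶠ q in 𝓝 p, MDifferentiableAt I 𝓘(ℝ, ℝ) f q) (Z : ∀ q : M, TangentSpace I q) :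
    ∀ᶠ y in 𝓝 (extChartAt I p p),
      fderiv ℝ (fun y => f ((extChartAt I p).symm y)) y (chartField I p Z y) =
        diff I f ((extChartAt I p).symm y) (Z ((extChartAt I p).symm y)) := by
  have h2 : Tendsto (extChartAt I p).symm (𝓝 (extChartAt I p p)) (𝓝 p) := by
    have := continuousAt_extChartAt_symm (I := I) p
    rwa [ContinuousAt, extChartAt_to_inv] at this
  filter_upwards [h2.eventually hf,
    (isOpen_extChartAt_target p).mem_nhds (mem_extChartAt_target (I := I) p)] with y hy hy'
  have hinv := isInvertible_mfderivWithin_extChartAt_symm (I := I) hy'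
  rw [I.range_eq_univ, mfderivWithin_univ] at hinv
  obtain ⟨w, hw⟩ : ∃ w : E, w = chartField I p Z y := ⟨_, rfl⟩
  rw [← hw]
  have h := diff_comp (I := I) (I' := 𝓘(ℝ, E)) hy (mdiffAt_symm hy') w
  have h3 : mfderiv 𝓘(ℝ, E) I (extChartAt I p).symm y w
      = Z ((extChartAt I p).symm y) := by
    rw [hw]
    unfold chartField
    rw [VectorField.mpullbackWithin_apply, mfderivWithin_univ]
    exact hinv.self_apply_inverse _
  rw [h3] at h
  have h4 : mfderiv 𝓘(ℝ, E) 𝓘(ℝ, ℝ) (fun y => f ((extChartAt I p).symm y)) y =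
      fderiv ℝ (fun y => f ((extChartAt I p).symm y)) y := mfderiv_eq_fderiv
  exact (congrArg (fun T : E →L[ℝ] ℝ => T w) h4).symm.trans h

/-- The derivative along a Lie bracket is the commutator of the derivatives. -/
theorem diff_mlieBracket [FiniteDimensional ℝ E] [I.Boundaryless] [IsManifold I ∞ M]
    (hf : SmoothFun I f) {X Y : ∀ q : M, TangentSpace I q}
    (hX : MDifferentiableAt I I.tangent (fun q => (⟨q, X q⟩ : TangentBundle I M)) p)
    (hY : MDifferentiableAt I I.tangent (fun q => (⟨q, Y q⟩ : TangentBundle I M)) p)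
    (hXf : MDifferentiableAt I 𝓘(ℝ, ℝ) (fun q => diff I f q (X q)) p)
    (hYf : MDifferentiableAt I 𝓘(ℝ, ℝ) (fun q => diff I f q (Y q)) p) :
    diff I f p (VectorField.mlieBracket I X Y p) =
      diff I (fun q => diff I f q (Y q)) p (X p) - diff I (fun q => diff I f q (X q)) p (Y p) := by
  have : CompleteSpace E := FiniteDimensional.complete ℝ E
  have key : ∀ Z : ∀ q : M, TangentSpace I q,
      (fun y => fderiv ℝ (fun y => f ((extChartAt I p).symm y)) y (chartField I p Z y))
        =ᶠ[𝓝 (extChartAt I p p)]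
        fun y => diff I f ((extChartAt I p).symm y) (Z ((extChartAt I p).symm y)) :=
    eventually_fderiv_chartField (Eventually.of_forall fun q => hf.mdiffAt)
  have hff : ContDiffAt ℝ ∞ (fun y => f ((extChartAt I p).symm y)) (extChartAt I p p) := by
    have h1 : ContMDiffAt 𝓘(ℝ, E) I ∞ (extChartAt I p).symm (extChartAt I p p) :=
      (contMDiffOn_extChartAt_symm (n := ∞) p).contMDiffAt
        ((isOpen_extChartAt_target p).mem_nhds (mem_extChartAt_target p))
    exact ((hf _).comp _ h1).contDiffAt
  rw [diff_apply_eq_fderiv hf.mdiffAt, diff_apply_eq_fderiv hXf, diff_apply_eq_fderiv hYf,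
    mlieBracket_eq_lieBracket_chartField]
  refine (VectorField.fderiv_apply_lieBracket hff
    (by simpa using (mod_cast le_top : ((2 : ℕ∞) : ℕ∞ω) ≤ ∞)) (differentiableAt_chartField hY)
    (differentiableAt_chartField hX)).trans ?_
  rw [(key X).fderiv_eq, (key Y).fderiv_eq, chartField_self, chartField_self]

end Diff

/-! ### Local frames whose dual coframes are globally smooth -/

section DualFrames

variable {E H M : Type*} [NormedAddCommGroup E] [NormedSpace ℝ E] [TopologicalSpace H]
  {I : ModelWithCorners ℝ E H} [TopologicalSpace M] [ChartedSpace H M]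
  {F : Type*} [NormedAddCommGroup F] [NormedSpace ℝ F]
  {V : M → Type*} [TopologicalSpace (TotalSpace F V)]
  [∀ p, TopologicalSpace (V p)] [∀ p, AddCommGroup (V p)] [∀ p, Module ℝ (V p)]
  [FiberBundle F V] {κ : Type*} [Fintype κ] [DecidableEq κ]

variable (I F) in
/-- Smoothness of a section at a point. -/
abbrev SmoothSectionAt (X : ∀ q, V q) (p : M) : Prop :=
  ContMDiffAt I (I.prod 𝓘(ℝ, F)) ∞ (fun q => TotalSpace.mk' F q (X q)) p

theorem SmoothDual.apply_at {μ : ∀ q, V q →L[ℝ] ℝ} (hμ : SmoothDual I F μ) {X : ∀ q, V q} {p : M}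
    (hX : SmoothSectionAt I F X p) : ContMDiffAt I 𝓘(ℝ, ℝ) ∞ (fun q => μ q (X q)) p :=
  ContMDiffAt.comp p (hμ _) hX

theorem SmoothDual.apply {μ : ∀ q, V q →L[ℝ] ℝ} (hμ : SmoothDual I F μ) {X : ∀ q, V q}
    (hX : SmoothSection I F X) : SmoothFun I (fun q => μ q (X q)) :=
  fun p => hμ.apply_at (hX p)

variable (I F) in
/-- A frame `s` with dual coframe `θ` near the point `p`. -/
structure DualFrame (p : M) (s : κ → ∀ q, V q) (θ : κ → ∀ q, V q →L[ℝ] ℝ) : Prop where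
  smoothAt : ∀ k, SmoothSectionAt I F (s k) p
  smooth_dual : ∀ k, SmoothDual I F (θ k)
  dual : ∀ᶠ q in 𝓝 p, (∀ v : V q, ∑ k, θ k q v • s k q = v) ∧
    ∀ k l, θ k q (s l q) = if k = l then 1 else 0

namespace DualFrame

variable {p : M} {s : κ → ∀ q, V q} {θ : κ → ∀ q, V q →L[ℝ] ℝ}

theorem sum_smul (h : DualFrame I F p s θ) (v : V p) : ∑ k, θ k p v • s k p = v :=
  h.dual.self_of_nhds.1 v

theorem apply_self (h : DualFrame I F p s θ) (k l : κ) :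
    θ k p (s l p) = if k = l then 1 else 0 :=
  h.dual.self_of_nhds.2 k l

theorem ext_vec (h : DualFrame I F p s θ) {v w : V p} (hvw : ∀ k, θ k p v = θ k p w) : v = w := by
  rw [← h.sum_smul v, ← h.sum_smul w]
  simp_rw [hvw]

theorem eventually_dual (h : DualFrame I F p s θ) :
    ∀ᶠ q in 𝓝 p, ∀ μ : V q →L[ℝ] ℝ, μ = ∑ k, μ (s k q) • θ k q := by
  filter_upwards [h.dual] with q hq μ
  ext v
  conv_lhs => rw [← hq.1 v]
  simp [mul_comm]

theorem dual_eq (h : DualFrame I F p s θ) (μ : V p →L[ℝ] ℝ) : μ = ∑ k, μ (s k p) • θ k p :=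
  h.eventually_dual.self_of_nhds μ

theorem bi_apply {W : Type*} [TopologicalSpace W] [AddCommGroup W] [Module ℝ W]
    (B : (W →L[ℝ] ℝ) →ₗ[ℝ] (W →L[ℝ] ℝ) →ₗ[ℝ] ℝ) (a b : κ → ℝ) (μ ν : κ → W →L[ℝ] ℝ) :
    B (∑ k, a k • μ k) (∑ k, b k • ν k) = ∑ k, ∑ l, a k * b l * B (μ k) (ν l) := by
  simp only [map_sum, map_smul, LinearMap.sum_apply, LinearMap.smul_apply, smul_eq_mul,
    Finset.mul_sum]
  rw [Finset.sum_comm]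
  exact Finset.sum_congr rfl fun k _ => Finset.sum_congr rfl fun l _ => by ring

theorem ext_bi (h : DualFrame I F p s θ) {B C : (V p →L[ℝ] ℝ) →ₗ[ℝ] (V p →L[ℝ] ℝ) →ₗ[ℝ] ℝ}
    (hBC : ∀ k l, B (θ k p) (θ l p) = C (θ k p) (θ l p)) : B = C := by
  ext μ ν
  rw [h.dual_eq μ, h.dual_eq ν, bi_apply, bi_apply]
  simp_rw [hBC]

theorem eventually_bi (h : DualFrame I F p s θ) (P : Bitensor V) :
    ∀ᶠ q in 𝓝 p, ∀ μ ν, P q μ ν = ∑ k, ∑ l, μ (s k q) * ν (s l q) * P q (θ k q) (θ l q) := by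
  filter_upwards [h.eventually_dual] with q hq μ ν
  conv_lhs => rw [hq μ, hq ν, bi_apply]

theorem exists_vec (h : DualFrame I F p s θ) (c : κ → ℝ) : ∃ v : V p, ∀ k, θ k p v = c k := by
  refine ⟨∑ l, c l • s l p, fun k => ?_⟩
  simp [h.apply_self]

theorem exists_bi (h : DualFrame I F p s θ) (c : κ → κ → ℝ) :
    ∃ B : (V p →L[ℝ] ℝ) →ₗ[ℝ] (V p →L[ℝ] ℝ) →ₗ[ℝ] ℝ, ∀ k l, B (θ k p) (θ l p) = c k l := by
  refine ⟨LinearMap.mk₂ ℝ (fun μ ν => ∑ k, ∑ l, c k l * (μ (s k p) * ν (s l p)))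
    ?_ ?_ ?_ ?_, fun k l => ?_⟩
  · intro μ μ' ν
    simp only [_root_.add_apply, ← Finset.sum_add_distrib]
    exact Finset.sum_congr rfl fun k _ => Finset.sum_congr rfl fun l _ => by ring
  · intro a μ ν
    simp only [_root_.smul_apply, smul_eq_mul, Finset.mul_sum]
    exact Finset.sum_congr rfl fun k _ => Finset.sum_congr rfl fun l _ => by ring
  · intro μ ν ν'
    simp only [_root_.add_apply, ← Finset.sum_add_distrib]
    exact Finset.sum_congr rfl fun k _ => Finset.sum_congr rfl fun l _ => by ring
  · intro a μ ν
    simp only [_root_.smul_apply, smul_eq_mul, Finset.mul_sum]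
    exact Finset.sum_congr rfl fun k _ => Finset.sum_congr rfl fun l _ => by ring
  · simp [h.apply_self]

theorem smoothFunAt_bi (h : DualFrame I F p s θ) {P : Bitensor V}
    (hP : ∀ k l, ContMDiffAt I 𝓘(ℝ, ℝ) ∞ (fun q => P q (θ k q) (θ l q)) p)
    {μ ν : ∀ q, V q →L[ℝ] ℝ} (hμ : SmoothDual I F μ) (hν : SmoothDual I F ν) :
    ContMDiffAt I 𝓘(ℝ, ℝ) ∞ (fun q => P q (μ q) (ν q)) p := by
  have h1 : (fun q => P q (μ q) (ν q)) =ᶠ[𝓝 p]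
      fun q => ∑ k, ∑ l, μ q (s k q) * ν q (s l q) * P q (θ k q) (θ l q) := by
    filter_upwards [h.eventually_bi P] with q hq using hq _ _
  refine ContMDiffAt.congr_of_eventuallyEq ?_ h1
  exact ContMDiffAt.sum fun k _ => ContMDiffAt.sum fun l _ =>
    ((hμ.apply_at (h.smoothAt k)).mul (hν.apply_at (h.smoothAt l))).mul (hP k l)

variable [VectorBundle ℝ F V]

theorem smoothSectionAt (h : DualFrame I F p s θ) {X : ∀ q, V q}
    (hX : ∀ k, ContMDiffAt I 𝓘(ℝ, ℝ) ∞ (fun q => θ k q (X q)) p) :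
    SmoothSectionAt I F X p := by
  have h1 : (fun q => TotalSpace.mk' F q (X q)) =ᶠ[𝓝 p]
      fun q => TotalSpace.mk' F q (∑ k, θ k q (X q) • s k q) := by
    filter_upwards [h.dual] with q hq
    rw [hq.1]
  refine ContMDiffAt.congr_of_eventuallyEq ?_ h1
  exact ContMDiffAt.sum_section fun k _ => (hX k).smul_section (h.smoothAt k)

end DualFrame

variable [VectorBundle ℝ F V] [ContMDiffVectorBundle ∞ F V I]

theorem dualFrame_of_trivialization (p : M) (b : Module.Basis κ ℝ F)
    {θ : κ → ∀ q, V q →L[ℝ] ℝ} (hθ : ∀ k, SmoothDual I F (θ k))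
    (h : ∀ᶠ q in 𝓝 p, ∀ k v, θ k q v =
      b.coord k ((trivializationAt F V p).continuousLinearMapAt ℝ q v)) :
    DualFrame I F p ((trivializationAt F V p).localFrame b) θ where
  smoothAt k := contMDiffAt_localFrame_of_mem ∞ _ b k (mem_baseSet_trivializationAt F V p)
  smooth_dual := hθ
  dual := by
    filter_upwards [h, (trivializationAt F V p).open_baseSet.mem_nhds
      (mem_baseSet_trivializationAt F V p)] with q hq hqb
    have h2 : ∀ k v, θ k q v = ((trivializationAt F V p).basisAt b hqb).repr v k := by
      intro k v
      rw [hq]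
      simp [Trivialization.basisAt, Trivialization.continuousLinearMapAt_apply, hqb]
    constructor
    · intro v
      simp_rw [h2, Trivialization.localFrame_apply_of_mem_baseSet _ _ hqb]
      exact Module.Basis.sum_repr _ v
    · intro k l
      rw [h2, Trivialization.localFrame_apply_of_mem_baseSet _ _ hqb, Module.Basis.repr_self,
        Finsupp.single_apply]
      simp [eq_comm]

/-- The trivialization of the tangent bundle at `p` is the derivative of the chart at `p`, and a
linear form is its own derivative. -/
theorem eventually_diff_of_eq_extChartAt [IsManifold I ∞ M] {p : M} {f : M → ℝ} (c : E →L[ℝ] ℝ)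
    (h : f =ᶠ[𝓝 p] fun q => c (extChartAt I p q)) :
    ∀ᶠ q in 𝓝 p, ∀ w : TangentSpace I q, diff I f q w =
      c ((trivializationAt E (fun q : M => TangentSpace I q) p).continuousLinearMapAt ℝ q w) := by
  filter_upwards [h.eventuallyEq_nhds, chart_source_mem_nhds H p] with q hq hqs w
  rw [diff_congr hq, TangentBundle.continuousLinearMapAt_trivializationAt hqs]
  have h1 : MDifferentiableAt I 𝓘(ℝ, E) (extChartAt I p) q := mdifferentiableAt_extChartAt hqs
  have h2 := diff_comp (I := 𝓘(ℝ, E)) (I' := I) (f := c) c.mdifferentiableAt h1 w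
  refine h2.trans ?_
  have h3 : mfderiv 𝓘(ℝ, E) 𝓘(ℝ, ℝ) c (extChartAt I p q) = c := c.mfderiv_eq
  exact congrArg (fun T : E →L[ℝ] ℝ => T _) h3

theorem continuousLinearMapAt_eq_snd (t : Trivialization F (TotalSpace.proj : TotalSpace F V → M))
    [t.IsLinear ℝ] {q : M} (hq : q ∈ t.baseSet) (v : V q) :
    t.continuousLinearMapAt ℝ q v = (t ⟨q, v⟩).2 := by
  rw [Trivialization.continuousLinearMapAt_apply, Trivialization.linearMapAt_apply, if_pos hq]

theorem extChartAt_totalSpace_apply (e q : TotalSpace F V) :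
    extChartAt (I.prod 𝓘(ℝ, F)) e q = (extChartAt I e.proj (trivializationAt F V e.proj q).1,
      (trivializationAt F V e.proj q).2) := by
  rw [FiberBundle.extChartAt]
  rfl

section TotalSpaceFrames

variable [IsManifold I ∞ M] {κ' : Type*} [Fintype κ'] [DecidableEq κ']

/-- The chart of the total space at `e` is the base chart together with the fibre component of the
trivialization. Near `e` its coordinates are thus the functions `x k ∘ τ` and `ι_{θ k}`, and their
differentials are dual to the coordinate frame. -/
theorem exists_dualFrame_totalSpace (e : TotalSpace F V) (b : Module.Basis κ ℝ E)
    (b' : Module.Basis κ' ℝ F) {x : κ → M → ℝ} (hx : ∀ k, SmoothFun I (x k))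
    (hx' : ∀ᶠ q in 𝓝 e.proj, ∀ k, x k q = b.coord k (extChartAt I e.proj q))
    {θ : κ' → ∀ q, V q →L[ℝ] ℝ} (hθ : ∀ k, SmoothDual I F (θ k))
    (hθ' : ∀ᶠ q in 𝓝 e.proj, ∀ k v, θ k q v =
      b'.coord k ((trivializationAt F V e.proj).continuousLinearMapAt ℝ q v))
    [FiniteDimensional ℝ E] [FiniteDimensional ℝ F] :
    ∃ D : κ ⊕ κ' → ∀ e : TotalSpace F V, TangentSpace (I.prod 𝓘(ℝ, F)) e,
      DualFrame (I.prod 𝓘(ℝ, F)) (E × F) e D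
        (fun k => diff (I.prod 𝓘(ℝ, F)) (Sum.elim (fun k (e : TotalSpace F V) => x k e.proj)
          (fun k => linFun F (θ k)) k)) := by
  have hc : ContinuousAt (fun e : TotalSpace F V => e.proj) e :=
    (FiberBundle.continuous_proj F V).continuousAt
  refine ⟨_, dualFrame_of_trivialization e (b.prod b') ?_ ?_⟩
  · rintro (k | k)
    · exact smoothDual_diff ((hx k).comp (contMDiff_proj V))
    · exact smoothDual_diff (hθ k)
  · rw [eventually_all]
    have key : ∀ k, Sum.elim (fun k (e : TotalSpace F V) => x k e.proj)
          (fun k => linFun F (θ k)) k =ᶠ[𝓝 e] fun q =>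
          ((b.prod b').coord k).toContinuousLinearMap (extChartAt (I.prod 𝓘(ℝ, F)) e q) := by
      rintro (k | k)
      · filter_upwards [hc.eventually hx', hc.eventually_mem
          ((trivializationAt F V e.proj).open_baseSet.mem_nhds
          (mem_baseSet_trivializationAt F V e.proj))] with q hq hqb
        rw [extChartAt_totalSpace_apply, Trivialization.coe_fst' _ hqb]
        simp [hq]
      · filter_upwards [hc.eventually hθ', hc.eventually_mem
          ((trivializationAt F V e.proj).open_baseSet.mem_nhds
          (mem_baseSet_trivializationAt F V e.proj))] with q hq hqb
        rw [extChartAt_totalSpace_apply, Sum.elim_inr, linFun, hq, continuousLinearMapAt_eq_snd _ hqb]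
        simp
    intro k
    exact eventually_diff_of_eq_extChartAt _ (key k)

end TotalSpaceFrames

variable [T2Space M] [FiniteDimensional ℝ E] [IsManifold I ∞ M]

/-- Bump functions use finite dimension and the Hausdorff property; the latter makes supports that
are compact in a chart closed in `M`, so that extension by zero is smooth. -/
theorem exists_cutoff (p : M) {u : Set M} (hu : u ∈ 𝓝 p) :
    ∃ χ : M → ℝ, SmoothFun I χ ∧ χ =ᶠ[𝓝 p] 1 ∧ tsupport χ ⊆ u := by
  obtain ⟨χ, -, hχ⟩ := (SmoothBumpFunction.nhds_basis_tsupport (I := I) p).mem_iff.1 hu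
  exact ⟨χ, χ.contMDiff, χ.eventuallyEq_one, hχ⟩

theorem exists_smoothFun_eventuallyEq {p : M} {u : Set M} (hu : IsOpen u) (hp : p ∈ u) {f : M → ℝ}
    (hf : ContMDiffOn I 𝓘(ℝ, ℝ) ∞ f u) : ∃ g, SmoothFun I g ∧ g =ᶠ[𝓝 p] f := by
  obtain ⟨χ, hχ, h1, hs⟩ := exists_cutoff (I := I) p (hu.mem_nhds hp)
  refine ⟨fun q => χ q * f q, contMDiff_of_tsupport fun q hq => ?_, ?_⟩
  · have hq' : q ∈ tsupport χ := tsupport_mul_subset_left hq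
    exact (hχ q).mul (hf.contMDiffAt (hu.mem_nhds (hs hq')))
  · filter_upwards [h1] with q hq
    simp [hq]

theorem exists_smooth_coordinates (p : M) (b : Module.Basis κ ℝ E) :
    ∃ x : κ → M → ℝ, (∀ k, SmoothFun I (x k)) ∧
      ∀ᶠ q in 𝓝 p, ∀ k, x k q = b.coord k (extChartAt I p q) := by
  have h : ∀ k, ∃ g, SmoothFun I g ∧ g =ᶠ[𝓝 p] fun q => b.coord k (extChartAt I p q) := by
    intro k
    refine exists_smoothFun_eventuallyEq (chartAt H p).open_source (mem_chart_source H p) ?_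
    exact ((b.coord k).toContinuousLinearMap.contMDiff).comp_contMDiffOn contMDiffOn_extChartAt
  choose x hx hx' using h
  exact ⟨x, hx, eventually_all.2 hx'⟩

variable [FiniteDimensional ℝ F]

theorem exists_smooth_coframe (p : M) (b : Module.Basis κ ℝ F) :
    ∃ θ : κ → ∀ q, V q →L[ℝ] ℝ, (∀ k, SmoothDual I F (θ k)) ∧
      ∀ᶠ q in 𝓝 p, ∀ k v, θ k q v =
        b.coord k ((trivializationAt F V p).continuousLinearMapAt ℝ q v) := by
  set t := trivializationAt F V p with ht
  obtain ⟨χ, hχ, h1, hs⟩ := exists_cutoff (I := I) p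
    (t.open_baseSet.mem_nhds (mem_baseSet_trivializationAt F V p))
  refine ⟨fun k q => χ q • ((b.coord k).toContinuousLinearMap.comp
    (t.continuousLinearMapAt ℝ q)), fun k e => ?_, ?_⟩
  · have hc : ContinuousAt (fun e : TotalSpace F V => e.proj) e :=
      (FiberBundle.continuous_proj F V).continuousAt
    by_cases he : e.proj ∈ t.baseSet
    · have h2 : linFun F (fun q => χ q • ((b.coord k).toContinuousLinearMap.comp
          (t.continuousLinearMapAt ℝ q))) =ᶠ[𝓝 e] fun e' =>
          χ e'.proj * (b.coord k).toContinuousLinearMap (t e').2 := by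
        filter_upwards [hc.eventually_mem (t.open_baseSet.mem_nhds he)] with q hq
        simp only [linFun, _root_.smul_apply, ContinuousLinearMap.comp_apply,
          continuousLinearMapAt_eq_snd _ hq, smul_eq_mul]
      refine ContMDiffAt.congr_of_eventuallyEq ?_ h2
      have h3 : ContMDiffAt (I.prod 𝓘(ℝ, F)) (I.prod 𝓘(ℝ, F)) ∞ t e :=
        (Trivialization.contMDiffOn (n := ∞) (IB := I) t).contMDiffAt
          (t.open_source.mem_nhds (t.mem_source.2 he))
      exact ((hχ.comp (contMDiff_proj V)) e).mul
        ((b.coord k).toContinuousLinearMap.contMDiff.contMDiffAt.comp e h3.snd)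
    -- Outside the base set the cutoff is locally zero, because its closed support lies in the base
    -- set.
    · have h2 : linFun F (fun q => χ q • ((b.coord k).toContinuousLinearMap.comp
          (t.continuousLinearMapAt ℝ q))) =ᶠ[𝓝 e] fun _ => 0 := by
        have h4 := notMem_tsupport_iff_eventuallyEq.1 (fun h => he (hs h))
        filter_upwards [hc.eventually h4] with q hq
        simp only [Pi.zero_apply] at hq
        simp [linFun, hq]
      exact contMDiffAt_const.congr_of_eventuallyEq h2
  · filter_upwards [h1] with q hq k v
    simp [hq, ht]

theorem exists_smooth_dualFrame (p : M) (b : Module.Basis κ ℝ F)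
    {θ : κ → ∀ q, V q →L[ℝ] ℝ} (hθ : ∀ k, SmoothDual I F (θ k))
    (h : ∀ᶠ q in 𝓝 p, ∀ k v, θ k q v =
      b.coord k ((trivializationAt F V p).continuousLinearMapAt ℝ q v)) :
    ∃ s : κ → ∀ q, V q, (∀ k, SmoothSection I F (s k)) ∧ DualFrame I F p s θ := by
  have hf := dualFrame_of_trivialization p b hθ h
  set t := trivializationAt F V p with ht
  obtain ⟨χ, hχ, h1, hs⟩ := exists_cutoff (I := I) p
    (t.open_baseSet.mem_nhds (mem_baseSet_trivializationAt F V p))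
  have hsm : ∀ k, SmoothSection I F (χ • t.localFrame b k) := fun k =>
    hχ.contMDiffOn.smul_section_of_tsupport t.open_baseSet hs
      (t.contMDiffOn_localFrame_baseSet ∞ b k)
  refine ⟨fun k => χ • t.localFrame b k, hsm, fun k => hsm k p, hθ, ?_⟩
  filter_upwards [hf.dual, h1] with q hq hq1
  simpa [hq1] using hq

end DualFrames

/-! ### Contraction of bisections, and smoothness tested on covectors -/

section Contract

variable {E H M : Type*} [NormedAddCommGroup E] [NormedSpace ℝ E] [TopologicalSpace H]
  {I : ModelWithCorners ℝ E H} [TopologicalSpace M] [ChartedSpace H M]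
  {F : Type*} [NormedAddCommGroup F] [NormedSpace ℝ F]
  {V : M → Type*} [TopologicalSpace (TotalSpace F V)]
  [∀ p, TopologicalSpace (V p)] [∀ p, AddCommGroup (V p)] [∀ p, Module ℝ (V p)]
  [FiberBundle F V]

variable (I F V) in
/-- Every point has a neighbourhood with a frame whose dual coframe extends globally. -/
def HasDualFrames : Prop :=
  ∀ p : M, ∃ (κ : Type) (_ : Fintype κ) (_ : DecidableEq κ) (s : κ → ∀ q, V q)
    (θ : κ → ∀ q, V q →L[ℝ] ℝ), DualFrame I F p s θ

theorem SmoothBisection.skew {P : Bitensor V} (hP : SmoothBisection I F P) (p : M)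
    (μ ν : V p →L[ℝ] ℝ) : P p μ ν = -P p ν μ := by
  have h := hP.1 p (μ + ν)
  simp only [map_add, LinearMap.add_apply, hP.1] at h
  linarith

/-- `contract` is a choice of vector. A finite frame exhibits a suitable vector, so the choice has
the defining property. -/
theorem HasDualFrames.apply_contract (h : HasDualFrames I F V) {p : M} (μ : V p →L[ℝ] ℝ)
    (B : (V p →L[ℝ] ℝ) →ₗ[ℝ] (V p →L[ℝ] ℝ) →ₗ[ℝ] ℝ) (ν : V p →L[ℝ] ℝ) :
    ν (contract μ B) = B μ ν := by
  obtain ⟨κ, _, _, s, θ, hs⟩ := h p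
  refine Classical.epsilon_spec (p := fun v => ∀ ν : V p →L[ℝ] ℝ, ν v = B μ ν)
    ⟨∑ k, B μ (θ k p) • s k p, fun ν => ?_⟩ ν
  conv_rhs => rw [hs.dual_eq ν]
  simp [mul_comm]

theorem HasDualFrames.ext_vec (h : HasDualFrames I F V) {p : M} {v w : V p}
    (hvw : ∀ μ : V p →L[ℝ] ℝ, μ v = μ w) : v = w := by
  obtain ⟨κ, _, _, s, θ, hs⟩ := h p
  exact hs.ext_vec fun k => hvw _

variable [VectorBundle ℝ F V]

theorem SmoothBisection.smoothSection_contract (h : HasDualFrames I F V) {P : Bitensor V}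
    (hP : SmoothBisection I F P) {μ : ∀ p, V p →L[ℝ] ℝ} (hμ : SmoothDual I F μ) :
    SmoothSection I F (fun p => contract (μ p) (P p)) := by
  intro p
  obtain ⟨κ, _, _, s, θ, hs⟩ := h p
  refine hs.smoothSectionAt fun k => ?_
  simp_rw [h.apply_contract]
  exact hP.2 _ _ hμ (hs.smooth_dual k) p

theorem smoothSection_of_apply (h : HasDualFrames I F V) {X : ∀ p, V p}
    (hX : ∀ μ, SmoothDual I F μ → SmoothFun I (fun p => μ p (X p))) : SmoothSection I F X := by
  intro p
  obtain ⟨κ, _, _, s, θ, hs⟩ := h p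
  exact hs.smoothSectionAt fun k => hX _ (hs.smooth_dual k) p

end Contract

/-! ### Dependence of the Jacobiator and of the homogeneity defect on 1-jets -/

section Jets

variable {E H M : Type*} [NormedAddCommGroup E] [NormedSpace ℝ E] [TopologicalSpace H]
  {I : ModelWithCorners ℝ E H} [TopologicalSpace M] [ChartedSpace H M]

theorem BiOp.bracket_sub_left (X : BiOp I M) {f f' g : M → ℝ} (hf : SmoothFun I f)
    (hf' : SmoothFun I f') (p : M) : X.bracket (fun q => f q - f' q) g p =
      X.bracket f g p - X.bracket f' g p := by
  simp only [BiOp.bracket, diff_sub hf.mdiffAt hf'.mdiffAt, map_sub, LinearMap.sub_apply,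
    _root_.sub_apply]
  ring

theorem BiOp.bracket_neg_left (X : BiOp I M) (f g : M → ℝ) (p : M) :
    X.bracket (fun q => -f q) g p = -X.bracket f g p := by
  simp only [BiOp.bracket, diff_neg, map_neg, LinearMap.neg_apply, _root_.neg_apply]
  ring

theorem BiOp.bracket_add_left (X : BiOp I M) {f f' g : M → ℝ} (hf : SmoothFun I f)
    (hf' : SmoothFun I f') (p : M) : X.bracket (fun q => f q + f' q) g p =
      X.bracket f g p + X.bracket f' g p := by
  simp only [BiOp.bracket, diff_add hf.mdiffAt hf'.mdiffAt, map_add, LinearMap.add_apply,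
    _root_.add_apply]
  ring

/-- The Jacobiator of a bidifferential operator. -/
def BiOp.jacobiator (X : BiOp I M) (f g h : M → ℝ) (p : M) : ℝ :=
  X.bracket (X.bracket f g) h p + X.bracket (X.bracket g h) f p + X.bracket (X.bracket h f) g p

theorem BiOp.jacobiator_cycl (X : BiOp I M) (f g h : M → ℝ) (p : M) :
    X.jacobiator f g h p = X.jacobiator g h f p := by
  unfold BiOp.jacobiator
  ring

variable [IsManifold I ∞ M]

/-- The vector field `Z` such that `{f, g} = Z(f) + f Γ(g)` for all `f`. -/
def BiOp.hamiltonian (X : BiOp I M) (g : M → ℝ) (p : M) : TangentSpace I p :=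
  -contract (diff I g p) (X.biv p) - g p • X.vec p

/-- `∇{f, g} - {∇f, g} - {f, ∇g} + {f, g}`, where `∇` is the derivation along a vector field. -/
def BiOp.homogeneityDefect (X : BiOp I M) (W : ∀ p : M, TangentSpace I p) (f g : M → ℝ) (p : M) :
    ℝ :=
  diff I (X.bracket f g) p (W p) - X.bracket (fun q => diff I f q (W q)) g p
    - X.bracket f (fun q => diff I g q (W q)) p + X.bracket f g p

variable {X : BiOp I M} (hb : SmoothBisection I E X.biv) (hv : SmoothSection I E X.vec)
  (hM : HasDualFrames I E (fun p : M => TangentSpace I p))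
include hb

theorem BiOp.bracket_skew (f g : M → ℝ) (p : M) : X.bracket f g p = -X.bracket g f p := by
  simp only [BiOp.bracket]
  rw [hb.skew]
  ring

include hv in
theorem BiOp.smoothFun_bracket {f g : M → ℝ} (hf : SmoothFun I f) (hg : SmoothFun I g) :
    SmoothFun I (X.bracket f g) :=
  ((hb.2 _ _ (smoothDual_diff hf) (smoothDual_diff hg)).add
    (hf.mul ((smoothDual_diff hg).apply hv))).sub (hg.mul ((smoothDual_diff hf).apply hv))

include hM

theorem BiOp.bracket_eq_hamiltonian (f g : M → ℝ) (p : M) :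
    X.bracket f g p = diff I f p (X.hamiltonian g p) + f p * diff I g p (X.vec p) := by
  simp only [BiOp.bracket, BiOp.hamiltonian, map_sub, map_neg, map_smul, hM.apply_contract,
    smul_eq_mul]
  rw [hb.skew]
  ring

include hv

theorem BiOp.smoothSection_hamiltonian {g : M → ℝ} (hg : SmoothFun I g) :
    SmoothSection I E (X.hamiltonian g) := by
  refine smoothSection_of_apply hM fun μ hμ => ?_
  simp only [BiOp.hamiltonian, map_sub, map_neg, map_smul, smul_eq_mul]
  exact (hμ.apply (hb.smoothSection_contract hM (smoothDual_diff hg))).neg.sub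
    (hg.mul (hμ.apply hv))

theorem BiOp.bracket_eq_zero_of_jet {f : M → ℝ} {p : M} (h0 : f p = 0)
    (h1 : diff I f p = 0) (g : M → ℝ) : X.bracket f g p = 0 := by
  rw [BiOp.bracket_eq_hamiltonian hb hM, h0, h1]
  simp

/-- The summand `f Γ(g)` vanishes at `p` together with its differential, since `f` does. -/
theorem BiOp.diff_bracket_of_jet {f : M → ℝ} (hf : SmoothFun I f) {p : M} (h0 : f p = 0)
    (h1 : diff I f p = 0) {g : M → ℝ} (hg : SmoothFun I g) :
    diff I (X.bracket f g) p = diff I (fun q => diff I f q (X.hamiltonian g q)) p := by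
  have h2 : X.bracket f g =
      fun q => diff I f q (X.hamiltonian g q) + f q * diff I g q (X.vec q) := by
    funext q
    rw [BiOp.bracket_eq_hamiltonian hb hM]
  have hΓ : SmoothFun I (fun q => diff I g q (X.vec q)) := (smoothDual_diff hg).apply hv
  have hZ : SmoothFun I (fun q => diff I f q (X.hamiltonian g q)) :=
    (smoothDual_diff hf).apply (BiOp.smoothSection_hamiltonian hb hv hM hg)
  have hm : SmoothFun I (fun q => f q * diff I g q (X.vec q)) := hf.mul hΓ
  rw [h2, diff_add hZ.mdiffAt hm.mdiffAt, diff_mul hf.mdiffAt hΓ.mdiffAt, h0, h1]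
  simp

variable [FiniteDimensional ℝ E] [I.Boundaryless]

omit hb hv hM in
/-- At a critical point of a function, derivations along vector fields commute. -/
theorem diff_diff_comm_of_diff_eq_zero {f : M → ℝ} (hf : SmoothFun I f) {p : M}
    (h1 : diff I f p = 0) {Y Z : ∀ q : M, TangentSpace I q} (hY : SmoothSection I E Y)
    (hZ : SmoothSection I E Z) :
    diff I (fun q => diff I f q (Z q)) p (Y p) = diff I (fun q => diff I f q (Y q)) p (Z p) := by
  have h := diff_mlieBracket (p := p) hf ((hY p).mdifferentiableAt (by simp))
    ((hZ p).mdifferentiableAt (by simp))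
    (((smoothDual_diff hf).apply hY p).mdifferentiableAt (by simp))
    (((smoothDual_diff hf).apply hZ p).mdifferentiableAt (by simp))
  rw [h1] at h
  simp only [_root_.zero_apply] at h
  linarith

/-- Let `Z_g` be the hamiltonian field of `g`. At `p`, `{{f, g}, h}` reduces to `Z_h Z_g f`, `{{h,
f}, g}` to `-Z_g Z_h f`, and `{{g, h}, f}` to zero, being of first order in `f`. The commutator
`[Z_h, Z_g] f` vanishes because `df = 0` at `p`. -/
theorem BiOp.jacobiator_eq_zero_of_jet {f g h : M → ℝ} (hf : SmoothFun I f) (hg : SmoothFun I g)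
    (hh : SmoothFun I h) {p : M} (h0 : f p = 0) (h1 : diff I f p = 0) :
    X.jacobiator f g h p = 0 := by
  have e1 : X.bracket (X.bracket f g) h p =
      diff I (fun q => diff I f q (X.hamiltonian g q)) p (X.hamiltonian h p) := by
    rw [BiOp.bracket_eq_hamiltonian hb hM (X.bracket f g),
      BiOp.diff_bracket_of_jet hb hv hM hf h0 h1 hg,
      BiOp.bracket_eq_zero_of_jet hb hv hM h0 h1]
    ring
  have e2 : X.bracket (X.bracket g h) f p = 0 := by
    rw [BiOp.bracket_skew hb, BiOp.bracket_eq_zero_of_jet hb hv hM h0 h1, neg_zero]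
  have e3 : X.bracket (X.bracket h f) g p =
      -diff I (fun q => diff I f q (X.hamiltonian h q)) p (X.hamiltonian g p) := by
    have : X.bracket h f = fun q => -X.bracket f h q := by
      funext q
      rw [BiOp.bracket_skew hb]
    rw [this, BiOp.bracket_neg_left, BiOp.bracket_eq_hamiltonian hb hM (X.bracket f h),
      BiOp.diff_bracket_of_jet hb hv hM hf h0 h1 hh, BiOp.bracket_eq_zero_of_jet hb hv hM h0 h1]
    ring
  rw [BiOp.jacobiator, e1, e2, e3, diff_diff_comm_of_diff_eq_zero hf h1
    (BiOp.smoothSection_hamiltonian hb hv hM hh) (BiOp.smoothSection_hamiltonian hb hv hM hg)]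
  ring

theorem BiOp.jacobiator_congr_jet {f f' g h : M → ℝ} (hf : SmoothFun I f) (hf' : SmoothFun I f')
    (hg : SmoothFun I g) (hh : SmoothFun I h) {p : M} (h0 : f p = f' p)
    (h1 : diff I f p = diff I f' p) : X.jacobiator f g h p = X.jacobiator f' g h p := by
  have h2 := BiOp.jacobiator_eq_zero_of_jet hb hv hM (hf.sub hf') hg hh (p := p)
    (by simp [h0]) ((diff_sub hf.mdiffAt hf'.mdiffAt).trans (by simp [h1]))
  have h3 : X.jacobiator (fun q => f q - f' q) g h p =
      X.jacobiator f g h p - X.jacobiator f' g h p := by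
    unfold BiOp.jacobiator
    have e1 : X.bracket (fun q => f q - f' q) g = fun q => X.bracket f g q - X.bracket f' g q :=
      funext fun q => X.bracket_sub_left hf hf' q
    have e2 : ∀ k, SmoothFun I k →
        X.bracket k (fun q => f q - f' q) = fun q => X.bracket k f q - X.bracket k f' q := by
      intro k hk
      funext q
      rw [BiOp.bracket_skew hb, BiOp.bracket_skew hb k f, BiOp.bracket_skew hb k f',
        X.bracket_sub_left hf hf' q]
      ring
    have e3 := BiOp.smoothFun_bracket hb hv hg hh
    rw [e1, e2 _ e3, e2 _ hh, X.bracket_sub_left (BiOp.smoothFun_bracket hb hv hf hg)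
      (BiOp.smoothFun_bracket hb hv hf' hg), X.bracket_sub_left
      (BiOp.smoothFun_bracket hb hv hh hf) (BiOp.smoothFun_bracket hb hv hh hf')]
    ring
  linarith

/-- The Jacobi identity may be checked on a set of functions that contains all `1`-jets. -/
theorem BiOp.jacobiator_eq_zero_of_generators {S : Set (M → ℝ)} (hS : ∀ f ∈ S, SmoothFun I f)
    (hjet : ∀ f, SmoothFun I f → ∀ p, ∃ f' ∈ S, f p = f' p ∧ diff I f p = diff I f' p)
    (hj : ∀ f ∈ S, ∀ g ∈ S, ∀ h ∈ S, ∀ p, X.jacobiator f g h p = 0) {f g h : M → ℝ}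
    (hf : SmoothFun I f) (hg : SmoothFun I g) (hh : SmoothFun I h) (p : M) :
    X.jacobiator f g h p = 0 := by
  obtain ⟨f', hf', f0, f1⟩ := hjet f hf p
  obtain ⟨g', hg', g0, g1⟩ := hjet g hg p
  obtain ⟨h', hh', h0, h1⟩ := hjet h hh p
  -- Cyclic invariance brings each argument in turn to the first slot, where it is replaced by a
  -- function with the same jet.
  rw [BiOp.jacobiator_congr_jet hb hv hM hf (hS _ hf') hg hh f0 f1, BiOp.jacobiator_cycl,
    BiOp.jacobiator_congr_jet hb hv hM hg (hS _ hg') hh (hS _ hf') g0 g1, BiOp.jacobiator_cycl,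
    BiOp.jacobiator_congr_jet hb hv hM hh (hS _ hh') (hS _ hf') (hS _ hg') h0 h1]
  exact hj _ hh' _ hf' _ hg' p

variable {W : ∀ p : M, TangentSpace I p} (hW : SmoothSection I E W)
include hW

/-- Only `W Z_g f - Z_g W f` survives, with `Z_g` the hamiltonian field of `g`, and it vanishes at a
critical point of `f`. The zeroth-order part of `{W f, g}` is multiplied by `(W f)(p) = 0`. -/
theorem BiOp.homogeneityDefect_eq_zero_of_jet {f g : M → ℝ} (hf : SmoothFun I f)
    (hg : SmoothFun I g) {p : M} (h0 : f p = 0) (h1 : diff I f p = 0) :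
    X.homogeneityDefect W f g p = 0 := by
  rw [BiOp.homogeneityDefect, BiOp.diff_bracket_of_jet hb hv hM hf h0 h1 hg,
    BiOp.bracket_eq_zero_of_jet hb hv hM h0 h1, BiOp.bracket_eq_zero_of_jet hb hv hM h0 h1,
    BiOp.bracket_eq_hamiltonian hb hM, diff_diff_comm_of_diff_eq_zero hf h1 hW
      (BiOp.smoothSection_hamiltonian hb hv hM hg), h1]
  simp

omit hv hM hW in
theorem BiOp.homogeneityDefect_skew (f g : M → ℝ) (p : M) :
    X.homogeneityDefect W f g p = -X.homogeneityDefect W g f p := by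
  have : X.bracket f g = fun q => -X.bracket g f q := funext fun q => BiOp.bracket_skew hb f g q
  unfold BiOp.homogeneityDefect
  rw [this, diff_neg, BiOp.bracket_skew hb _ g, BiOp.bracket_skew hb f]
  simp only [_root_.neg_apply]
  ring

theorem BiOp.homogeneityDefect_congr_jet {f f' g : M → ℝ} (hf : SmoothFun I f)
    (hf' : SmoothFun I f') (hg : SmoothFun I g) {p : M} (h0 : f p = f' p)
    (h1 : diff I f p = diff I f' p) :
    X.homogeneityDefect W f g p = X.homogeneityDefect W f' g p := by
  have h2 := BiOp.homogeneityDefect_eq_zero_of_jet hb hv hM hW (hf.sub hf') hg (p := p)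
    (by simp [h0]) ((diff_sub hf.mdiffAt hf'.mdiffAt).trans (by simp [h1]))
  have h3 : X.homogeneityDefect W (fun q => f q - f' q) g p =
      X.homogeneityDefect W f g p - X.homogeneityDefect W f' g p := by
    unfold BiOp.homogeneityDefect
    have e1 : ∀ k, X.bracket (fun q => f q - f' q) k = fun q => X.bracket f k q - X.bracket f' k q :=
      fun k => funext fun q => X.bracket_sub_left hf hf' q
    have e2 : (fun q => diff I (fun q => f q - f' q) q (W q)) =
        fun q => diff I f q (W q) - diff I f' q (W q) := by
      funext q
      rw [diff_sub hf.mdiffAt hf'.mdiffAt]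
      rfl
    rw [e1, e1, e2, diff_sub (BiOp.smoothFun_bracket hb hv hf hg).mdiffAt
      (BiOp.smoothFun_bracket hb hv hf' hg).mdiffAt,
      X.bracket_sub_left ((smoothDual_diff hf).apply hW) ((smoothDual_diff hf').apply hW)]
    simp only [_root_.sub_apply]
    ring
  linarith

/-- Homogeneity may be checked on a set of functions that contains all `1`-jets. -/
theorem BiOp.homogeneityDefect_eq_zero_of_generators {S : Set (M → ℝ)}
    (hS : ∀ f ∈ S, SmoothFun I f)
    (hjet : ∀ f, SmoothFun I f → ∀ p, ∃ f' ∈ S, f p = f' p ∧ diff I f p = diff I f' p)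
    (hj : ∀ f ∈ S, ∀ g ∈ S, ∀ p, X.homogeneityDefect W f g p = 0) {f g : M → ℝ}
    (hf : SmoothFun I f) (hg : SmoothFun I g) (p : M) : X.homogeneityDefect W f g p = 0 := by
  obtain ⟨f', hf', f0, f1⟩ := hjet f hf p
  obtain ⟨g', hg', g0, g1⟩ := hjet g hg p
  rw [BiOp.homogeneityDefect_congr_jet hb hv hM hW hf (hS _ hf') hg f0 f1,
    BiOp.homogeneityDefect_skew hb,
    BiOp.homogeneityDefect_congr_jet hb hv hM hW hg (hS _ hg') (hS _ hf') g0 g1,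
    hj _ hg' _ hf' p, neg_zero]

end Jets

/-! ### Testing vector and bivector fields on a class of functions containing coordinates -/

section Coordinates

variable {E H M : Type*} [NormedAddCommGroup E] [NormedSpace ℝ E] [TopologicalSpace H]
  {I : ModelWithCorners ℝ E H} [TopologicalSpace M] [ChartedSpace H M] [IsManifold I ∞ M]

variable (I) in
/-- Near every point there are coordinates in the set `G` of functions. -/
def HasCoordinatesIn (G : Set (M → ℝ)) : Prop :=
  ∀ p : M, ∃ (κ : Type) (_ : Fintype κ) (_ : DecidableEq κ) (D : κ → ∀ q : M, TangentSpace I q)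
    (y : κ → M → ℝ), (∀ k, y k ∈ G) ∧ DualFrame I E p D (fun k => diff I (y k))

namespace HasCoordinatesIn

variable {G : Set (M → ℝ)}

theorem hasDualFrames (h : HasCoordinatesIn I G) :
    HasDualFrames I E (fun p : M => TangentSpace I p) := by
  intro p
  obtain ⟨κ, i, j, D, y, -, hD⟩ := h p
  exact ⟨κ, i, j, D, _, hD⟩

theorem ext_vec (h : HasCoordinatesIn I G) {p : M} {v w : TangentSpace I p}
    (hvw : ∀ y ∈ G, diff I y p v = diff I y p w) : v = w := by
  obtain ⟨κ, _, _, D, y, hy, hD⟩ := h p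
  exact hD.ext_vec fun k => hvw _ (hy k)

theorem ext_bi (h : HasCoordinatesIn I G) {p : M}
    {B C : (TangentSpace I p →L[ℝ] ℝ) →ₗ[ℝ] (TangentSpace I p →L[ℝ] ℝ) →ₗ[ℝ] ℝ}
    (hBC : ∀ y ∈ G, ∀ z ∈ G, B (diff I y p) (diff I z p) = C (diff I y p) (diff I z p)) :
    B = C := by
  obtain ⟨κ, _, _, D, y, hy, hD⟩ := h p
  exact hD.ext_bi fun k l => hBC _ (hy k) _ (hy l)

theorem smoothSection (h : HasCoordinatesIn I G) {X : ∀ p : M, TangentSpace I p}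
    (hX : ∀ y ∈ G, SmoothFun I (fun p => diff I y p (X p))) : SmoothSection I E X := by
  intro p
  obtain ⟨κ, _, _, D, y, hy, hD⟩ := h p
  exact hD.smoothSectionAt fun k => hX _ (hy k) p

theorem smoothBisection (h : HasCoordinatesIn I G)
    {P : Bitensor (fun p : M => TangentSpace I p)}
    (hs : ∀ y ∈ G, ∀ z ∈ G, ∀ p, P p (diff I y p) (diff I z p) = -P p (diff I z p) (diff I y p))
    (hP : ∀ y ∈ G, ∀ z ∈ G, SmoothFun I (fun p => P p (diff I y p) (diff I z p))) :
    SmoothBisection I E P := by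
  refine ⟨fun p μ => ?_, fun μ ν hμ hν p => ?_⟩
  -- Vanishing on the diagonal is not a bilinear condition, so it is obtained from skew-symmetry,
  -- which can be tested on a coframe.
  · have : P p = -(P p).flip := by
      refine h.ext_bi fun y hy z hz => ?_
      rw [hs y hy z hz]
      rfl
    have h1 := congrFun (congrArg DFunLike.coe (congrFun (congrArg DFunLike.coe this) μ)) μ
    simp only [LinearMap.neg_apply, LinearMap.flip_apply] at h1
    linarith
  · obtain ⟨κ, _, _, D, y, hy, hD⟩ := h p
    exact hD.smoothFunAt_bi (fun k l => hP _ (hy k) _ (hy l) p) hμ hν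

end HasCoordinatesIn

end Coordinates

/-! ### Derivatives along vertical vectors and along the Liouville field -/

section Vertical

variable {E H M : Type*} [NormedAddCommGroup E] [NormedSpace ℝ E] [TopologicalSpace H]
  {I : ModelWithCorners ℝ E H} [TopologicalSpace M] [ChartedSpace H M]
  {F : Type*} [NormedAddCommGroup F] [NormedSpace ℝ F]
  {V : M → Type*} [TopologicalSpace (TotalSpace F V)]
  [∀ p, TopologicalSpace (V p)] [∀ p, AddCommGroup (V p)] [∀ p, Module ℝ (V p)]
  [FiberBundle F V] [VectorBundle ℝ F V]

/-- In the trivialization at the base point the fibre coordinate of this map is a constant plus `y`.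
-/
theorem contMDiff_translation (e : TotalSpace F V) :
    ContMDiff 𝓘(ℝ, F) (I.prod 𝓘(ℝ, F)) ∞ (fun y : F => TotalSpace.mk' F e.proj
      (e.2 + (trivializationAt F V e.proj).symmL ℝ e.proj y)) := by
  intro y
  rw [contMDiffAt_totalSpace]
  refine ⟨contMDiffAt_const, ?_⟩
  have hb := mem_baseSet_trivializationAt F V e.proj
  have h : ∀ y : F, (trivializationAt F V e.proj (TotalSpace.mk' F e.proj
      (e.2 + (trivializationAt F V e.proj).symmL ℝ e.proj y))).2 =
      (trivializationAt F V e.proj).continuousLinearMapAt ℝ e.proj e.2 + y := by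
    intro y
    rw [← continuousLinearMapAt_eq_snd _ hb, map_add,
      Trivialization.continuousLinearMapAt_symmL _ hb]
  simp only [h]
  exact contMDiffAt_const.add contMDiffAt_id

theorem diff_vert {g : TotalSpace F V → ℝ} {e : TotalSpace F V}
    (hg : MDifferentiableAt (I.prod 𝓘(ℝ, F)) 𝓘(ℝ, ℝ) g e) (w : V e.proj) :
    diff (I.prod 𝓘(ℝ, F)) g e (vert I F e w) =
      fderiv ℝ (fun y : F => g (TotalSpace.mk' F e.proj
        (e.2 + (trivializationAt F V e.proj).symmL ℝ e.proj y))) 0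
        ((trivializationAt F V e.proj).continuousLinearMapAt ℝ e.proj w) := by
  have he : TotalSpace.mk' F e.proj
      (e.2 + (trivializationAt F V e.proj).symmL ℝ e.proj 0) = e := by
    rw [map_zero, add_zero]
  set γ : F → TotalSpace F V := fun y => TotalSpace.mk' F e.proj
    (e.2 + (trivializationAt F V e.proj).symmL ℝ e.proj y) with hγ
  have hd : MDifferentiableAt 𝓘(ℝ, F) (I.prod 𝓘(ℝ, F)) γ 0 :=
    (contMDiff_translation e 0).mdifferentiableAt (by simp)
  have hg' : MDifferentiableAt (I.prod 𝓘(ℝ, F)) 𝓘(ℝ, ℝ) g (γ 0) := by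
    rw [show γ 0 = e from he]
    exact hg
  have h1 := diff_comp (I := I.prod 𝓘(ℝ, F)) (I' := 𝓘(ℝ, F)) hg' hd
    ((trivializationAt F V e.proj).continuousLinearMapAt ℝ e.proj w)
  have h2 : ∀ q, q = e →
      (diff (I.prod 𝓘(ℝ, F)) g q : E × F →L[ℝ] ℝ) = diff (I.prod 𝓘(ℝ, F)) g e := by
    rintro _ rfl
    rfl
  have h3 : mfderiv 𝓘(ℝ, F) 𝓘(ℝ, ℝ) (fun y => g (γ y)) 0 = fderiv ℝ (fun y => g (γ y)) 0 :=
    mfderiv_eq_fderiv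
  have h4 := congrArg (fun T : F →L[ℝ] ℝ => T
    ((trivializationAt F V e.proj).continuousLinearMapAt ℝ e.proj w)) h3
  refine Eq.trans ?_ (h1.symm.trans h4)
  exact (congrArg (fun T : E × F →L[ℝ] ℝ => T _) (h2 (γ 0) he)).symm

theorem SmoothFun.comp_proj {f : M → ℝ} (hf : SmoothFun I f) :
    SmoothFun (I.prod 𝓘(ℝ, F)) (fun e : TotalSpace F V => f e.proj) :=
  hf.comp (contMDiff_proj V)

theorem diff_proj_vert {f : M → ℝ} (hf : SmoothFun I f) (e : TotalSpace F V) (w : V e.proj) :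
    diff (I.prod 𝓘(ℝ, F)) (fun e : TotalSpace F V => f e.proj) e (vert I F e w) = 0 := by
  rw [diff_vert hf.comp_proj.mdiffAt]
  simp

theorem diff_linFun_vert {μ : ∀ p, V p →L[ℝ] ℝ} (hμ : SmoothDual I F μ) (e : TotalSpace F V)
    (w : V e.proj) : diff (I.prod 𝓘(ℝ, F)) (linFun F μ) e (vert I F e w) = μ e.proj w := by
  rw [diff_vert (SmoothFun.mdiffAt hμ)]
  have h1 : (fun y : F => linFun F μ (TotalSpace.mk' F e.proj
      (e.2 + (trivializationAt F V e.proj).symmL ℝ e.proj y))) =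
      fun y => ((μ e.proj).comp ((trivializationAt F V e.proj).symmL ℝ e.proj)) y + μ e.proj e.2 := by
    funext y
    simp [linFun, add_comm]
  rw [h1, fderiv_add_const, ContinuousLinearMap.fderiv, ContinuousLinearMap.comp_apply,
    Trivialization.symmL_continuousLinearMapAt _ (mem_baseSet_trivializationAt F V e.proj)]

theorem diff_proj_liouville {f : M → ℝ} (hf : SmoothFun I f) (e : TotalSpace F V) :
    diff (I.prod 𝓘(ℝ, F)) (fun e : TotalSpace F V => f e.proj) e (liouville I F e) = 0 :=
  diff_proj_vert hf e _

theorem diff_linFun_liouville {μ : ∀ p, V p →L[ℝ] ℝ} (hμ : SmoothDual I F μ)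
    (e : TotalSpace F V) :
    diff (I.prod 𝓘(ℝ, F)) (linFun F μ) e (liouville I F e) = linFun F μ e :=
  diff_linFun_vert hμ e _

theorem diff_proj (f : M → ℝ) {e : TotalSpace F V}
    (hf : MDifferentiableAt I 𝓘(ℝ, ℝ) f e.proj) :
    diff (I.prod 𝓘(ℝ, F)) (fun e : TotalSpace F V => f e.proj) e =
      (diff I f e.proj).comp (mfderiv (I.prod 𝓘(ℝ, F)) I (fun e : TotalSpace F V => e.proj) e) := by
  ext w
  exact diff_comp hf ((contMDiff_proj (n := 1) (IB := I) V e).mdifferentiableAt (by simp)) w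

end Vertical

/-! ### Coordinates on `M` and the induced coordinates on `TM` -/

section TangentFrames

variable {E H : Type*} [NormedAddCommGroup E] [NormedSpace ℝ E] [FiniteDimensional ℝ E]
  [TopologicalSpace H] {I : ModelWithCorners ℝ E H} [I.Boundaryless]
  {M : Type*} [TopologicalSpace M] [T2Space M] [ChartedSpace H M] [IsManifold I ∞ M]

/-- Coordinates and their frame near a point of `M`. -/
structure CoordFrame {κ : Type} [Fintype κ] [DecidableEq κ] (I : ModelWithCorners ℝ E H)
    [IsManifold I ∞ M] (p : M) (x : κ → M → ℝ) (s : κ → ∀ q : M, TangentSpace I q) : Prop where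
  smooth : ∀ k, SmoothFun I (x k)
  smooth_frame : ∀ k, SmoothSection I E (s k)
  dual : DualFrame I E p s (fun k => diff I (x k))

/-- One family `x` must serve twice: as coordinates of `M` with a coordinate frame, and through `x k
∘ τ`, `ι_{d(x k)}` as coordinates of `TM`. The trivialization of `TM` being the derivative of the
chart, the `d(x k)` qualify as the fibre coframe. -/
theorem exists_coordFrame_tangent (e : TangentBundle I M) :
    ∃ (κ : Type) (_ : Fintype κ) (_ : DecidableEq κ) (x : κ → M → ℝ)
      (s : κ → ∀ q : M, TangentSpace I q)
      (D : κ ⊕ κ → ∀ e : TangentBundle I M, TangentSpace (I.prod 𝓘(ℝ, E)) e),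
      CoordFrame I e.proj x s ∧ DualFrame (I.prod 𝓘(ℝ, E)) (E × E) e D
        (fun k => diff (I.prod 𝓘(ℝ, E)) (Sum.elim (fun k (e : TangentBundle I M) => x k e.proj)
          (fun k => linFun E (diff I (x k))) k)) := by
  let b := Module.finBasis ℝ E
  obtain ⟨x, hx, hx'⟩ := exists_smooth_coordinates (I := I) e.proj b
  have h1 : ∀ᶠ q in 𝓝 e.proj, ∀ k, ∀ v : TangentSpace I q, diff I (x k) q v = b.coord k
      ((trivializationAt E (fun q : M => TangentSpace I q) e.proj).continuousLinearMapAt ℝ q v) := by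
    rw [eventually_all] at hx' ⊢
    exact fun k => eventually_diff_of_eq_extChartAt (b.coord k).toContinuousLinearMap (hx' k)
  have h2 : ∀ k, SmoothDual I E (diff I (x k)) := fun k => smoothDual_diff (hx k)
  obtain ⟨s, hs, hd⟩ := exists_smooth_dualFrame e.proj b h2 h1
  obtain ⟨D, hD⟩ := exists_dualFrame_totalSpace e b b hx hx' h2 h1
  exact ⟨_, _, _, x, s, D, ⟨hx, hs, hd⟩, hD⟩

theorem exists_coordFrame (p : M) :
    ∃ (κ : Type) (_ : Fintype κ) (_ : DecidableEq κ) (x : κ → M → ℝ)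
      (s : κ → ∀ q : M, TangentSpace I q), CoordFrame I p x s := by
  obtain ⟨κ, i, j, x, s, D, h, -⟩ := exists_coordFrame_tangent (⟨p, 0⟩ : TangentBundle I M)
  exact ⟨κ, i, j, x, s, h⟩

end TangentFrames

/-! ### Sums, multiples and wedge products of smooth bisections -/

section Bisections

variable {E H M : Type*} [NormedAddCommGroup E] [NormedSpace ℝ E] [TopologicalSpace H]
  {I : ModelWithCorners ℝ E H} [TopologicalSpace M] [ChartedSpace H M]
  {F : Type*} [NormedAddCommGroup F] [NormedSpace ℝ F]
  {V : M → Type*} [TopologicalSpace (TotalSpace F V)]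
  [∀ p, TopologicalSpace (V p)] [∀ p, AddCommGroup (V p)] [∀ p, Module ℝ (V p)]
  [FiberBundle F V]

theorem wedge_apply {W : Type*} [TopologicalSpace W] [AddCommGroup W] [Module ℝ W] (x y : W)
    (μ ν : W →L[ℝ] ℝ) : wedge x y μ ν = μ x * ν y - ν x * μ y := rfl

theorem pushBi_apply {W W' : Type*} [TopologicalSpace W] [AddCommGroup W] [Module ℝ W]
    [TopologicalSpace W'] [AddCommGroup W'] [Module ℝ W'] (φ : W →L[ℝ] W')
    (P : (W →L[ℝ] ℝ) →ₗ[ℝ] (W →L[ℝ] ℝ) →ₗ[ℝ] ℝ) (μ ν : W' →L[ℝ] ℝ) :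
    pushBi φ P μ ν = P (μ.comp φ) (ν.comp φ) := rfl

theorem SmoothBisection.add {P Q : Bitensor V} (hP : SmoothBisection I F P)
    (hQ : SmoothBisection I F Q) : SmoothBisection I F (P + Q) := by
  refine ⟨fun p μ => ?_, fun μ ν hμ hν => (hP.2 μ ν hμ hν).add (hQ.2 μ ν hμ hν)⟩
  simp [hP.1, hQ.1]

theorem SmoothBisection.smul {f : M → ℝ} (hf : SmoothFun I f) {P : Bitensor V}
    (hP : SmoothBisection I F P) : SmoothBisection I F (fun p => f p • P p) := by
  refine ⟨fun p μ => ?_, fun μ ν hμ hν => hf.mul (hP.2 μ ν hμ hν)⟩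
  simp [hP.1]

theorem smoothBisection_wedge {X Y : ∀ p, V p} (hX : SmoothSection I F X)
    (hY : SmoothSection I F Y) : SmoothBisection I F (fun p => wedge (X p) (Y p)) := by
  refine ⟨fun p μ => ?_, fun μ ν hμ hν =>
    ((hμ.apply hX).mul (hν.apply hY)).sub ((hν.apply hX).mul (hμ.apply hY))⟩
  rw [wedge_apply]
  ring

end Bisections

/-! ### Coordinate expansions of differentials on `TM` -/

section TangentLift

variable {E H : Type*} [NormedAddCommGroup E] [NormedSpace ℝ E] [FiniteDimensional ℝ E]
  [TopologicalSpace H] {I : ModelWithCorners ℝ E H} [I.Boundaryless]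
  {M : Type*} [TopologicalSpace M] [ChartedSpace H M] [IsManifold I ∞ M]

theorem SmoothFun.derivation {f : M → ℝ} (hf : SmoothFun I f) {X : ∀ q : M, TangentSpace I q}
    (hX : SmoothSection I E X) : SmoothFun I (fun q => diff I f q (X q)) :=
  (smoothDual_diff hf).apply hX

theorem diff_mlieBracket_of_smooth {f : M → ℝ} (hf : SmoothFun I f)
    {X Y : ∀ q : M, TangentSpace I q} (hX : SmoothSection I E X) (hY : SmoothSection I E Y) (p : M) :
    diff I f p (VectorField.mlieBracket I X Y p) =
      diff I (fun q => diff I f q (Y q)) p (X p) - diff I (fun q => diff I f q (X q)) p (Y p) :=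
  diff_mlieBracket hf ((hX p).mdifferentiableAt (by simp)) ((hY p).mdifferentiableAt (by simp))
    (hf.derivation hX).mdiffAt (hf.derivation hY).mdiffAt

section Frame

variable {κ : Type} [Fintype κ] [DecidableEq κ] {p : M} {x : κ → M → ℝ}
  {s : κ → ∀ q : M, TangentSpace I q} {f : M → ℝ}

namespace CoordFrame

/-- The derivatives `s i (x j)` are constant near `p`, so the bracket annihilates every coordinate.
-/
theorem mlieBracket_eq_zero (h : CoordFrame I p x s) (k l : κ) :
    VectorField.mlieBracket I (s k) (s l) p = 0 := by
  refine h.dual.ext_vec fun j => ?_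
  have hc : ∀ i, diff I (fun q => diff I (x j) q (s i q)) p = 0 := by
    intro i
    have : (fun q => diff I (x j) q (s i q)) =ᶠ[𝓝 p] fun _ => if j = i then 1 else 0 := by
      filter_upwards [h.dual.dual] with q hq using hq.2 j i
    rw [diff_congr this, diff_const]
  rw [diff_mlieBracket_of_smooth (h.smooth j) (h.smooth_frame k) (h.smooth_frame l), hc, hc]
  simp

theorem partial_comm (h : CoordFrame I p x s) (hf : SmoothFun I f) (k l : κ) :
    diff I (fun q => diff I f q (s l q)) p (s k p) =
      diff I (fun q => diff I f q (s k q)) p (s l p) := by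
  have h1 := diff_mlieBracket_of_smooth hf (h.smooth_frame k) (h.smooth_frame l) p
  rw [h.mlieBracket_eq_zero, map_zero] at h1
  linarith

theorem diff_comp_proj {e : TangentBundle I M} (h : CoordFrame I e.proj x s) (hf : SmoothFun I f) :
    diff (I.prod 𝓘(ℝ, E)) (fun e : TangentBundle I M => f e.proj) e =
      ∑ k, diff I f e.proj (s k e.proj) •
        diff (I.prod 𝓘(ℝ, E)) (fun e : TangentBundle I M => x k e.proj) e := by
  rw [diff_proj f hf.mdiffAt]
  simp_rw [fun k => diff_proj (F := E) (V := fun q : M => TangentSpace I q) (x k) (e := e)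
    (h.smooth k).mdiffAt]
  ext w
  conv_lhs => rw [h.dual.dual_eq (diff I f e.proj)]
  simp

/-- Leibniz rule for the local expansion `ι_μ = ∑ k, (μ (s k) ∘ τ) ι_{d(x k)}`. -/
theorem diff_linFun {e : TangentBundle I M} (h : CoordFrame I e.proj x s)
    {μ : ∀ q, TangentSpace I q →L[ℝ] ℝ} (hμ : SmoothDual I E (V := fun q : M => TangentSpace I q) μ) :
    diff (I.prod 𝓘(ℝ, E)) (linFun E μ) e =
      ∑ k, (μ e.proj (s k e.proj) • diff (I.prod 𝓘(ℝ, E)) (linFun E (diff I (x k))) e +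
        diff I (x k) e.proj e.2 • diff (I.prod 𝓘(ℝ, E))
          (fun e : TangentBundle I M => μ e.proj (s k e.proj)) e) := by
  have hc : ContinuousAt (fun e : TangentBundle I M => e.proj) e :=
    (FiberBundle.continuous_proj E (fun q : M => TangentSpace I q)).continuousAt
  have h1 : linFun E μ =ᶠ[𝓝 e] fun e' : TangentBundle I M =>
      ∑ k, μ e'.proj (s k e'.proj) * linFun E (diff I (x k)) e' := by
    filter_upwards [hc.eventually h.dual.eventually_dual] with q hq
    simpa [linFun] using congrArg (fun T => T q.2) (hq (μ q.proj))
  have ha : ∀ k, SmoothFun (I.prod 𝓘(ℝ, E)) (fun e : TangentBundle I M => μ e.proj (s k e.proj)) :=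
    fun k => SmoothFun.comp_proj (hμ.apply (h.smooth_frame k))
  have hl : ∀ k, SmoothFun (I.prod 𝓘(ℝ, E)) (linFun E (diff I (x k))) :=
    fun k => smoothDual_diff (h.smooth k)
  have hm : ∀ k, SmoothFun (I.prod 𝓘(ℝ, E)) (fun e : TangentBundle I M =>
      μ e.proj (s k e.proj) * linFun E (diff I (x k)) e) := fun k => (ha k).mul (hl k)
  rw [diff_congr h1, diff_sum fun k _ => (hm k).mdiffAt]
  exact Finset.sum_congr rfl fun k _ => diff_mul (ha k).mdiffAt (hl k).mdiffAt

theorem diff_linFun_diff {e : TangentBundle I M} (h : CoordFrame I e.proj x s)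
    (hf : SmoothFun I f) :
    diff (I.prod 𝓘(ℝ, E)) (linFun E (diff I f)) e =
      (∑ k, diff I (fun q => diff I f q (s k q)) e.proj e.2 •
        diff (I.prod 𝓘(ℝ, E)) (fun e : TangentBundle I M => x k e.proj) e) +
      ∑ k, diff I f e.proj (s k e.proj) •
        diff (I.prod 𝓘(ℝ, E)) (linFun E (diff I (x k))) e := by
  rw [h.diff_linFun (smoothDual_diff hf), Finset.sum_add_distrib, add_comm]
  congr 1
  simp_rw [fun k => h.diff_comp_proj (hf.derivation (h.smooth_frame k)), Finset.smul_sum]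
  rw [Finset.sum_comm]
  refine Finset.sum_congr rfl fun l _ => ?_
  conv_rhs => rw [← h.dual.sum_smul e.2]
  simp only [map_sum, map_smul, Finset.sum_smul, smul_eq_mul, mul_smul]
  refine Finset.sum_congr rfl fun k _ => ?_
  -- Symmetry of second derivatives: the coefficient of `d(x l ∘ τ)` becomes the derivative of the
  -- single function `s l (f)` along `e.2`.
  rw [h.partial_comm hf]

theorem diff_bi (h : CoordFrame I p x s) {P : Bitensor (fun q : M => TangentSpace I q)}
    (hP : SmoothBisection I E P) {f g : M → ℝ} (hf : SmoothFun I f) (hg : SmoothFun I g)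
    (v : TangentSpace I p) :
    diff I (fun q => P q (diff I f q) (diff I g q)) p v =
      ∑ k, ∑ l, (diff I f p (s k p) * diff I g p (s l p) *
        diff I (fun q => P q (diff I (x k) q) (diff I (x l) q)) p v +
        (diff I (fun q => diff I f q (s k q)) p v * diff I g p (s l p) +
          diff I f p (s k p) * diff I (fun q => diff I g q (s l q)) p v) *
          P p (diff I (x k) p) (diff I (x l) p)) := by
  have h1 : (fun q => P q (diff I f q) (diff I g q)) =ᶠ[𝓝 p] fun q =>
      ∑ k, ∑ l, diff I f q (s k q) * diff I g q (s l q) *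
        P q (diff I (x k) q) (diff I (x l) q) := by
    filter_upwards [h.dual.eventually_bi P] with q hq using hq _ _
  have hfk : ∀ k, SmoothFun I (fun q => diff I f q (s k q)) :=
    fun k => hf.derivation (h.smooth_frame k)
  have hgk : ∀ k, SmoothFun I (fun q => diff I g q (s k q)) :=
    fun k => hg.derivation (h.smooth_frame k)
  have hPk : ∀ k l, SmoothFun I (fun q => P q (diff I (x k) q) (diff I (x l) q)) :=
    fun k l => hP.2 _ _ (smoothDual_diff (h.smooth k)) (smoothDual_diff (h.smooth l))
  have hfg : ∀ k l, SmoothFun I (fun q => diff I f q (s k q) * diff I g q (s l q)) :=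
    fun k l => (hfk k).mul (hgk l)
  have hm : ∀ k l, SmoothFun I (fun q => diff I f q (s k q) * diff I g q (s l q) *
      P q (diff I (x k) q) (diff I (x l) q)) := fun k l => (hfg k l).mul (hPk k l)
  rw [diff_congr h1, diff_sum fun k _ => mdiffAt_sum fun l _ => (hm k l).mdiffAt]
  simp_rw [fun k => diff_sum (I := I) (p := p) (s := Finset.univ) fun l _ => (hm k l).mdiffAt,
    fun k l => diff_mul (p := p) (hfg k l).mdiffAt (hPk k l).mdiffAt,
    fun k l => diff_mul (p := p) (hfk k).mdiffAt (hgk l).mdiffAt]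
  simp only [_root_.sum_apply, _root_.add_apply, _root_.smul_apply, smul_eq_mul]
  refine Finset.sum_congr rfl fun k _ => Finset.sum_congr rfl fun l _ => ?_
  ring

end CoordFrame

end Frame

end TangentLift

/-! ### Pointwise existence of complete lifts to `TM` -/

section TangentLift

variable {E H : Type*} [NormedAddCommGroup E] [NormedSpace ℝ E]
  [TopologicalSpace H] {I : ModelWithCorners ℝ E H}
  {M : Type*} [TopologicalSpace M] [ChartedSpace H M] [IsManifold I ∞ M]

/-- `w` is the value at `e` of the complete lift of the vector field `X`. -/
def IsVecLiftAt (X : ∀ q : M, TangentSpace I q) (e : TangentBundle I M)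
    (w : TangentSpace (I.prod 𝓘(ℝ, E)) e) : Prop :=
  ∀ f : M → ℝ, SmoothFun I f →
    diff (I.prod 𝓘(ℝ, E)) (fun e : TangentBundle I M => f e.proj) e w
      = diff I f e.proj (X e.proj) ∧
    diff (I.prod 𝓘(ℝ, E)) (linFun E (diff I f)) e w
      = diff I (fun q => diff I f q (X q)) e.proj e.2

/-- `B` is the value at `e` of the complete lift of the bivector field `P`. -/
def IsBiLiftAt (P : Bitensor (fun q : M => TangentSpace I q)) (e : TangentBundle I M)
    (B : (TangentSpace (I.prod 𝓘(ℝ, E)) e →L[ℝ] ℝ) →ₗ[ℝ]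
      (TangentSpace (I.prod 𝓘(ℝ, E)) e →L[ℝ] ℝ) →ₗ[ℝ] ℝ) : Prop :=
  ∀ f g : M → ℝ, SmoothFun I f → SmoothFun I g →
    B (diff (I.prod 𝓘(ℝ, E)) (fun e : TangentBundle I M => f e.proj) e)
      (diff (I.prod 𝓘(ℝ, E)) (fun e : TangentBundle I M => g e.proj) e) = 0 ∧
    B (diff (I.prod 𝓘(ℝ, E)) (fun e : TangentBundle I M => f e.proj) e)
      (diff (I.prod 𝓘(ℝ, E)) (linFun E (diff I g)) e) =
        P e.proj (diff I f e.proj) (diff I g e.proj) ∧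
    B (diff (I.prod 𝓘(ℝ, E)) (linFun E (diff I f)) e)
      (diff (I.prod 𝓘(ℝ, E)) (fun e : TangentBundle I M => g e.proj) e) =
        P e.proj (diff I f e.proj) (diff I g e.proj) ∧
    B (diff (I.prod 𝓘(ℝ, E)) (linFun E (diff I f)) e)
      (diff (I.prod 𝓘(ℝ, E)) (linFun E (diff I g)) e) =
        diff I (fun q => P q (diff I f q) (diff I g q)) e.proj e.2

variable (I M) in
/-- The complete lift to the tangent bundle. -/
def tangentLift : LiftMaps E I (fun p : M => TangentSpace I p) where
  onVec X e := Classical.epsilon (IsVecLiftAt X e)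
  onBi P e := Classical.epsilon (IsBiLiftAt P e)

variable [FiniteDimensional ℝ E] [I.Boundaryless] [T2Space M]

/-- The prescribed values on the coordinates `x k ∘ τ`, `ι_{d(x k)}` determine a vector. The
conditions for every other `f` follow because both sides expand in the same way: the left by the
chain rule on `TM`, the right by Leibniz applied to `X(f) = ∑ k, s k (f) X(x k)`. -/
theorem isVecLiftAt_tangentLift {X : ∀ q : M, TangentSpace I q} (hX : SmoothSection I E X)
    (e : TangentBundle I M) : IsVecLiftAt X e ((tangentLift I M).onVec X e) := by
  refine Classical.epsilon_spec (p := IsVecLiftAt X e) ?_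
  obtain ⟨κ, _, _, x, s, D, h, hD⟩ := exists_coordFrame_tangent e
  obtain ⟨w, hw⟩ := hD.exists_vec (Sum.elim (fun k => diff I (x k) e.proj (X e.proj))
    (fun k => diff I (fun q => diff I (x k) q (X q)) e.proj e.2))
  have hl : ∀ k, diff (I.prod 𝓘(ℝ, E)) (fun e : TangentBundle I M => x k e.proj) e w =
    diff I (x k) e.proj (X e.proj) := fun k => hw (Sum.inl k)
  have hr : ∀ k, diff (I.prod 𝓘(ℝ, E)) (linFun E (diff I (x k))) e w =
    diff I (fun q => diff I (x k) q (X q)) e.proj e.2 := fun k => hw (Sum.inr k)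
  refine ⟨w, fun f hf => ⟨?_, ?_⟩⟩
  · rw [h.diff_comp_proj hf]
    conv_rhs => rw [h.dual.dual_eq (diff I f e.proj)]
    simp only [_root_.sum_apply, _root_.smul_apply, hl]
  · have h1 : (fun q => diff I f q (X q)) =ᶠ[𝓝 e.proj] fun q =>
        ∑ k, diff I f q (s k q) * diff I (x k) q (X q) := by
      filter_upwards [h.dual.eventually_dual] with q hq
      simpa using congrArg (fun T => T (X q)) (hq (diff I f q))
    have hfk : ∀ k, SmoothFun I (fun q => diff I f q (s k q)) :=
      fun k => hf.derivation (h.smooth_frame k)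
    have hxk : ∀ k, SmoothFun I (fun q => diff I (x k) q (X q)) :=
      fun k => (h.smooth k).derivation hX
    have hm : ∀ k, SmoothFun I (fun q => diff I f q (s k q) * diff I (x k) q (X q)) :=
      fun k => (hfk k).mul (hxk k)
    rw [h.diff_linFun_diff hf, diff_congr h1, diff_sum fun k _ => (hm k).mdiffAt]
    simp_rw [fun k => diff_mul (p := e.proj) (hfk k).mdiffAt (hxk k).mdiffAt]
    simp only [_root_.add_apply, _root_.sum_apply, _root_.smul_apply, hl, hr, smul_eq_mul,
      ← Finset.sum_add_distrib]
    exact Finset.sum_congr rfl fun k _ => by ring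

theorem isBiLiftAt_tangentLift {P : Bitensor (fun q : M => TangentSpace I q)}
    (hP : SmoothBisection I E P) (e : TangentBundle I M) :
    IsBiLiftAt P e ((tangentLift I M).onBi P e) := by
  refine Classical.epsilon_spec (p := IsBiLiftAt P e) ?_
  obtain ⟨κ, _, _, x, s, D, h, hD⟩ := exists_coordFrame_tangent e
  -- In the coordinates `(x ∘ τ, ι_{dx})` the matrix of the lift has blocks `0`, `P`, `P` and the
  -- derivative of `P` along the fibre vector.
  obtain ⟨B, hB⟩ := hD.exists_bi (Sum.elim
    (fun k => Sum.elim (fun _ => 0) (fun l => P e.proj (diff I (x k) e.proj) (diff I (x l) e.proj)))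
    (fun k => Sum.elim (fun l => P e.proj (diff I (x k) e.proj) (diff I (x l) e.proj))
      (fun l => diff I (fun q => P q (diff I (x k) q) (diff I (x l) q)) e.proj e.2)))
  have h1 : ∀ k l, B (diff (I.prod 𝓘(ℝ, E)) (fun e : TangentBundle I M => x k e.proj) e)
      (diff (I.prod 𝓘(ℝ, E)) (fun e : TangentBundle I M => x l e.proj) e) = 0 := fun k l =>
    hB (Sum.inl k) (Sum.inl l)
  have h2 : ∀ k l, B (diff (I.prod 𝓘(ℝ, E)) (fun e : TangentBundle I M => x k e.proj) e)
      (diff (I.prod 𝓘(ℝ, E)) (linFun E (diff I (x l))) e) =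
        P e.proj (diff I (x k) e.proj) (diff I (x l) e.proj) :=
    fun k l => hB (Sum.inl k) (Sum.inr l)
  have h3 : ∀ k l, B (diff (I.prod 𝓘(ℝ, E)) (linFun E (diff I (x k))) e)
      (diff (I.prod 𝓘(ℝ, E)) (fun e : TangentBundle I M => x l e.proj) e) =
        P e.proj (diff I (x k) e.proj) (diff I (x l) e.proj) :=
    fun k l => hB (Sum.inr k) (Sum.inl l)
  have h4 : ∀ k l, B (diff (I.prod 𝓘(ℝ, E)) (linFun E (diff I (x k))) e)
      (diff (I.prod 𝓘(ℝ, E)) (linFun E (diff I (x l))) e) =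
      diff I (fun q => P q (diff I (x k) q) (diff I (x l) q)) e.proj e.2 :=
    fun k l => hB (Sum.inr k) (Sum.inr l)
  have hPe := h.dual.eventually_bi P |>.self_of_nhds
  refine ⟨B, fun f g hf hg => ⟨?_, ?_, ?_, ?_⟩⟩
  · rw [h.diff_comp_proj hf, h.diff_comp_proj hg, DualFrame.bi_apply]
    simp [h1]
  · rw [h.diff_comp_proj hf, h.diff_linFun_diff hg, map_add, DualFrame.bi_apply,
      DualFrame.bi_apply, hPe]
    simp [h1, h2]
  · rw [h.diff_linFun_diff hf, h.diff_comp_proj hg, map_add, LinearMap.add_apply,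
      DualFrame.bi_apply, DualFrame.bi_apply, hPe]
    simp [h1, h3]
  · rw [h.diff_linFun_diff hf, h.diff_linFun_diff hg, h.diff_bi hP hf hg]
    simp only [map_add, LinearMap.add_apply, DualFrame.bi_apply]
    simp only [h1, h2, h3, h4, ← Finset.sum_add_distrib]
    exact Finset.sum_congr rfl fun k _ => Finset.sum_congr rfl fun l _ => by ring

end TangentLift

/-! ### Properties of complete lifts deduced from values on generating functions -/

section LiftsOnGenerators

variable {E H M : Type*} [NormedAddCommGroup E] [NormedSpace ℝ E]
  [TopologicalSpace H] {I : ModelWithCorners ℝ E H} [TopologicalSpace M]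
  [ChartedSpace H M] [IsManifold I ∞ M]
  {F : Type*} [NormedAddCommGroup F] [NormedSpace ℝ F]
  {V : M → Type*} [TopologicalSpace (TotalSpace F V)]
  [∀ p, TopologicalSpace (V p)] [∀ p, AddCommGroup (V p)] [∀ p, Module ℝ (V p)]
  [FiberBundle F V] [VectorBundle ℝ F V] [ContMDiffVectorBundle ∞ F V I]

theorem AlgebroidOps.d_mul (A : AlgebroidOps I V) {f g : M → ℝ} (hf : SmoothFun I f)
    (hg : SmoothFun I g) (p : M) : A.d (fun q => f q * g q) p = f p • A.d g p + g p • A.d f p := by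
  simp only [AlgebroidOps.d, diff_mul hf.mdiffAt hg.mdiffAt]
  rfl

theorem AlgebroidOps.d_add (A : AlgebroidOps I V) {f g : M → ℝ} (hf : SmoothFun I f)
    (hg : SmoothFun I g) (p : M) : A.d (fun q => f q + g q) p = A.d f p + A.d g p := by
  simp only [AlgebroidOps.d, diff_add hf.mdiffAt hg.mdiffAt]
  rfl

theorem AlgebroidOps.d_sub (A : AlgebroidOps I V) {f g : M → ℝ} (hf : SmoothFun I f)
    (hg : SmoothFun I g) (p : M) : A.d (fun q => f q - g q) p = A.d f p - A.d g p := by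
  simp only [AlgebroidOps.d, diff_sub hf.mdiffAt hg.mdiffAt]
  rfl

theorem AlgebroidOps.d_neg (A : AlgebroidOps I V) (f : M → ℝ) (p : M) :
    A.d (fun q => -f q) p = -A.d f p := by
  simp only [AlgebroidOps.d, diff_neg]
  rfl

/-- The functions `f ∘ τ` and `ι_α`, for `α` in the set `C`. -/
def liftGenerators (I : ModelWithCorners ℝ E H) (F : Type*) [NormedAddCommGroup F]
    [NormedSpace ℝ F] {V : M → Type*} [TopologicalSpace (TotalSpace F V)]
    [∀ p, TopologicalSpace (V p)] [∀ p, AddCommGroup (V p)] [∀ p, Module ℝ (V p)]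
    (C : Set (∀ p, V p →L[ℝ] ℝ)) : Set (TotalSpace F V → ℝ) :=
  {y | (∃ f : M → ℝ, SmoothFun I f ∧ y = fun e => f e.proj) ∨ ∃ α ∈ C, y = linFun F α}

/-- The values of complete lifts on the functions `f ∘ τ` and on the linear functions `ι_α`, for
`α` in a set `C` of closed forms. -/
structure IsLiftOn (A : AlgebroidOps I V) (C : Set (∀ p, V p →L[ℝ] ℝ)) (c : LiftMaps F I V) :
    Prop where
  smooth : ∀ α ∈ C, SmoothDual I F α
  smooth_d : ∀ f, SmoothFun I f → SmoothDual I F (A.d f)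
  coordinates : HasCoordinatesIn (I.prod 𝓘(ℝ, F)) (liftGenerators I F C)
  vec_proj : ∀ X, SmoothSection I F X → ∀ f, SmoothFun I f → ∀ e : TotalSpace F V,
    diff (I.prod 𝓘(ℝ, F)) (fun e : TotalSpace F V => f e.proj) e (c.onVec X e) =
      A.d f e.proj (X e.proj)
  vec_linFun : ∀ X, SmoothSection I F X → ∀ α ∈ C, ∀ e : TotalSpace F V,
    diff (I.prod 𝓘(ℝ, F)) (linFun F α) e (c.onVec X e) =
      linFun F (A.d fun q => α q (X q)) e
  bi_proj_proj : ∀ P, SmoothBisection I F P → ∀ f g, SmoothFun I f → SmoothFun I g →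
    ∀ e : TotalSpace F V,
      c.onBi P e (diff (I.prod 𝓘(ℝ, F)) (fun e : TotalSpace F V => f e.proj) e)
        (diff (I.prod 𝓘(ℝ, F)) (fun e : TotalSpace F V => g e.proj) e) = 0
  bi_proj_linFun : ∀ P, SmoothBisection I F P → ∀ f, SmoothFun I f → ∀ α ∈ C,
    ∀ e : TotalSpace F V,
      c.onBi P e (diff (I.prod 𝓘(ℝ, F)) (fun e : TotalSpace F V => f e.proj) e)
        (diff (I.prod 𝓘(ℝ, F)) (linFun F α) e) = P e.proj (A.d f e.proj) (α e.proj)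
  bi_linFun_proj : ∀ P, SmoothBisection I F P → ∀ α ∈ C, ∀ f, SmoothFun I f →
    ∀ e : TotalSpace F V,
      c.onBi P e (diff (I.prod 𝓘(ℝ, F)) (linFun F α) e)
        (diff (I.prod 𝓘(ℝ, F)) (fun e : TotalSpace F V => f e.proj) e) =
          P e.proj (α e.proj) (A.d f e.proj)
  bi_linFun_linFun : ∀ P, SmoothBisection I F P → ∀ α ∈ C, ∀ β ∈ C, ∀ e : TotalSpace F V,
    c.onBi P e (diff (I.prod 𝓘(ℝ, F)) (linFun F α) e) (diff (I.prod 𝓘(ℝ, F)) (linFun F β) e) =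
      linFun F (A.d fun q => P q (α q) (β q)) e

theorem diff_proj_comp_vert {f : M → ℝ} (hf : SmoothFun I f) (e : TotalSpace F V) :
    (diff (I.prod 𝓘(ℝ, F)) (fun e : TotalSpace F V => f e.proj) e).comp (vert I F e) = 0 :=
  ContinuousLinearMap.ext fun w => diff_proj_vert hf e w

theorem diff_linFun_comp_vert {α : ∀ p, V p →L[ℝ] ℝ} (hα : SmoothDual I F α)
    (e : TotalSpace F V) :
    (diff (I.prod 𝓘(ℝ, F)) (linFun F α) e).comp (vert I F e) = α e.proj :=
  ContinuousLinearMap.ext fun w => diff_linFun_vert hα e w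

namespace IsLiftOn

variable {A : AlgebroidOps I V} {C : Set (∀ p, V p →L[ℝ] ℝ)} {c : LiftMaps F I V}

/-- The generators contain coordinates, so the four families of values determine the lifted
bivector. Additivity and both product rules are obtained by checking these values on their
right-hand sides. -/
theorem onBi_eq (h : IsLiftOn A C c) {P : Bitensor V} (hP : SmoothBisection I F P)
    {e : TotalSpace F V}
    {B : (TangentSpace (I.prod 𝓘(ℝ, F)) e →L[ℝ] ℝ) →ₗ[ℝ]
      (TangentSpace (I.prod 𝓘(ℝ, F)) e →L[ℝ] ℝ) →ₗ[ℝ] ℝ}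
    (h1 : ∀ f g, SmoothFun I f → SmoothFun I g →
      B (diff (I.prod 𝓘(ℝ, F)) (fun e : TotalSpace F V => f e.proj) e)
        (diff (I.prod 𝓘(ℝ, F)) (fun e : TotalSpace F V => g e.proj) e) = 0)
    (h2 : ∀ f, SmoothFun I f → ∀ α ∈ C,
      B (diff (I.prod 𝓘(ℝ, F)) (fun e : TotalSpace F V => f e.proj) e)
        (diff (I.prod 𝓘(ℝ, F)) (linFun F α) e) = P e.proj (A.d f e.proj) (α e.proj))
    (h3 : ∀ α ∈ C, ∀ f, SmoothFun I f →
      B (diff (I.prod 𝓘(ℝ, F)) (linFun F α) e)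
        (diff (I.prod 𝓘(ℝ, F)) (fun e : TotalSpace F V => f e.proj) e) =
          P e.proj (α e.proj) (A.d f e.proj))
    (h4 : ∀ α ∈ C, ∀ β ∈ C,
      B (diff (I.prod 𝓘(ℝ, F)) (linFun F α) e) (diff (I.prod 𝓘(ℝ, F)) (linFun F β) e) =
        linFun F (A.d fun q => P q (α q) (β q)) e) : c.onBi P e = B := by
  refine h.coordinates.ext_bi ?_
  rintro y (⟨f, hf, rfl⟩ | ⟨α, hα, rfl⟩) z (⟨g, hg, rfl⟩ | ⟨β, hβ, rfl⟩)
  · rw [h.bi_proj_proj P hP f g hf hg, h1 f g hf hg]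
  · rw [h.bi_proj_linFun P hP f hf β hβ, h2 f hf β hβ]
  · rw [h.bi_linFun_proj P hP α hα g hg, h3 α hα g hg]
  · rw [h.bi_linFun_linFun P hP α hα β hβ, h4 α hα β hβ]

theorem smooth_vec (h : IsLiftOn A C c) {X : ∀ p, V p} (hX : SmoothSection I F X) :
    SmoothSection (I.prod 𝓘(ℝ, F)) (E × F) (c.onVec X) := by
  refine h.coordinates.smoothSection ?_
  rintro y (⟨f, hf, rfl⟩ | ⟨α, hα, rfl⟩)
  · simp only [h.vec_proj X hX f hf]
    exact SmoothFun.comp_proj ((h.smooth_d f hf).apply hX)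
  · simp only [h.vec_linFun X hX α hα]
    exact h.smooth_d _ ((h.smooth α hα).apply hX)

theorem smooth_bi (h : IsLiftOn A C c) {P : Bitensor V} (hP : SmoothBisection I F P) :
    SmoothBisection (I.prod 𝓘(ℝ, F)) (E × F) (c.onBi P) := by
  refine h.coordinates.smoothBisection ?_ ?_
  · rintro y (⟨f, hf, rfl⟩ | ⟨α, hα, rfl⟩) z (⟨g, hg, rfl⟩ | ⟨β, hβ, rfl⟩) e
    · rw [h.bi_proj_proj P hP f g hf hg, h.bi_proj_proj P hP g f hg hf, neg_zero]
    · rw [h.bi_proj_linFun P hP f hf β hβ, h.bi_linFun_proj P hP β hβ f hf, hP.skew]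
    · rw [h.bi_linFun_proj P hP α hα g hg, h.bi_proj_linFun P hP g hg α hα, hP.skew]
    · have hs : (fun q => P q (α q) (β q)) = fun q => -P q (β q) (α q) :=
        funext fun q => hP.skew q _ _
      rw [h.bi_linFun_linFun P hP α hα β hβ, h.bi_linFun_linFun P hP β hβ α hα, hs, linFun,
        A.d_neg]
      rfl
  · rintro y (⟨f, hf, rfl⟩ | ⟨α, hα, rfl⟩) z (⟨g, hg, rfl⟩ | ⟨β, hβ, rfl⟩)
    · simp only [h.bi_proj_proj P hP f g hf hg]
      exact contMDiff_const
    · simp only [h.bi_proj_linFun P hP f hf β hβ]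
      exact SmoothFun.comp_proj (hP.2 _ _ (h.smooth_d f hf) (h.smooth β hβ))
    · simp only [h.bi_linFun_proj P hP α hα g hg]
      exact SmoothFun.comp_proj (hP.2 _ _ (h.smooth α hα) (h.smooth_d g hg))
    · simp only [h.bi_linFun_linFun P hP α hα β hβ]
      exact h.smooth_d _ (hP.2 _ _ (h.smooth α hα) (h.smooth β hβ))

theorem add (h : IsLiftOn A C c) {P Q : Bitensor V} (hP : SmoothBisection I F P)
    (hQ : SmoothBisection I F Q) : c.onBi (P + Q) = c.onBi P + c.onBi Q := by
  funext e
  refine h.onBi_eq (hP.add hQ) (fun f g hf hg => ?_) (fun f hf α hα => ?_) (fun α hα f hf => ?_)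
    (fun α hα β hβ => ?_)
  · simp only [Pi.add_apply, LinearMap.add_apply, h.bi_proj_proj P hP f g hf hg,
      h.bi_proj_proj Q hQ f g hf hg, add_zero]
  · simp only [Pi.add_apply, LinearMap.add_apply, h.bi_proj_linFun P hP f hf α hα,
      h.bi_proj_linFun Q hQ f hf α hα]
  · simp only [Pi.add_apply, LinearMap.add_apply, h.bi_linFun_proj P hP α hα f hf,
      h.bi_linFun_proj Q hQ α hα f hf]
  · simp only [Pi.add_apply, LinearMap.add_apply, h.bi_linFun_linFun P hP α hα β hβ,
      h.bi_linFun_linFun Q hQ α hα β hβ, linFun]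
    rw [A.d_add (hP.2 _ _ (h.smooth α hα) (h.smooth β hβ))
      (hQ.2 _ _ (h.smooth α hα) (h.smooth β hβ))]
    rfl

theorem smul (h : IsLiftOn A C c) {f : M → ℝ} (hf : SmoothFun I f) {P : Bitensor V}
    (hP : SmoothBisection I F P) (e : TotalSpace F V) : c.onBi (fun p => f p • P p) e =
      linFun F (A.d f) e • vLiftBi I F P e + f e.proj • c.onBi P e := by
  refine h.onBi_eq (hP.smul hf) (fun g k hg hk => ?_) (fun g hg α hα => ?_) (fun α hα g hg => ?_)
    (fun α hα β hβ => ?_)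
  · simp only [LinearMap.add_apply, LinearMap.smul_apply, h.bi_proj_proj P hP g k hg hk, vLiftBi,
      pushBi_apply, diff_proj_comp_vert hg, map_zero, LinearMap.zero_apply, smul_zero, add_zero]
  · simp only [LinearMap.add_apply, LinearMap.smul_apply, h.bi_proj_linFun P hP g hg α hα, vLiftBi,
      pushBi_apply, diff_proj_comp_vert hg, map_zero, LinearMap.zero_apply, smul_zero, zero_add]
  · simp only [LinearMap.add_apply, LinearMap.smul_apply, h.bi_linFun_proj P hP α hα g hg, vLiftBi,
      pushBi_apply, diff_proj_comp_vert hg, map_zero, smul_zero, zero_add]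
  · simp only [LinearMap.add_apply, LinearMap.smul_apply, h.bi_linFun_linFun P hP α hα β hβ,
      vLiftBi, pushBi_apply, diff_linFun_comp_vert (h.smooth α hα),
      diff_linFun_comp_vert (h.smooth β hβ), linFun, smul_eq_mul]
    rw [A.d_mul hf (hP.2 _ _ (h.smooth α hα) (h.smooth β hβ))]
    simp only [_root_.add_apply, _root_.smul_apply, smul_eq_mul]
    ring

theorem wedge (h : IsLiftOn A C c) {X Y : ∀ p, V p} (hX : SmoothSection I F X)
    (hY : SmoothSection I F Y) (e : TotalSpace F V) :
    c.onBi (fun p => JacobiLift.wedge (X p) (Y p)) e =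
      JacobiLift.wedge (c.onVec X e) (vLift I F Y e) +
        JacobiLift.wedge (vLift I F X e) (c.onVec Y e) := by
  refine h.onBi_eq (smoothBisection_wedge hX hY) (fun f g hf hg => ?_) (fun f hf α hα => ?_)
    (fun α hα f hf => ?_) (fun α hα β hβ => ?_)
  · simp only [LinearMap.add_apply, wedge_apply, vLift, diff_proj_vert hf, diff_proj_vert hg]
    ring
  · simp only [LinearMap.add_apply, wedge_apply, vLift, diff_proj_vert hf,
      diff_linFun_vert (h.smooth α hα), h.vec_proj X hX f hf, h.vec_proj Y hY f hf]
    ring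
  · simp only [LinearMap.add_apply, wedge_apply, vLift, diff_proj_vert hf,
      diff_linFun_vert (h.smooth α hα), h.vec_proj X hX f hf, h.vec_proj Y hY f hf]
    ring
  · simp only [LinearMap.add_apply, wedge_apply, vLift, diff_linFun_vert (h.smooth α hα),
      diff_linFun_vert (h.smooth β hβ), h.vec_linFun X hX α hα, h.vec_linFun Y hY α hα,
      h.vec_linFun X hX β hβ, h.vec_linFun Y hY β hβ]
    have hαX := (h.smooth α hα).apply hX
    have hαY := (h.smooth α hα).apply hY
    have hβX := (h.smooth β hβ).apply hX
    have hβY := (h.smooth β hβ).apply hY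
    have m1 : SmoothFun I (fun q => α q (X q) * β q (Y q)) := hαX.mul hβY
    have m2 : SmoothFun I (fun q => β q (X q) * α q (Y q)) := hβX.mul hαY
    simp only [linFun]
    rw [A.d_sub m1 m2, A.d_mul hαX hβY, A.d_mul hβX hαY]
    simp only [_root_.add_apply, _root_.sub_apply, _root_.smul_apply, smul_eq_mul]
    ring

/-- The rule for `X^c(ι_μ)` stays a hypothesis: it concerns every `μ`, whereas the values on
generators cover only the forms in `C`. -/
theorem isCompleteLift (h : IsLiftOn A C c)
    (hl : ∀ X, SmoothSection I F X → ∀ μ, SmoothDual I F μ → ∀ Y, SmoothSection I F Y → ∀ p : M,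
      diff (I.prod 𝓘(ℝ, F)) (linFun F μ) ⟨p, Y p⟩ (c.onVec X ⟨p, Y p⟩) = A.lieDeriv X μ Y p) :
    IsCompleteLift F A c where
  smooth_vec _ := h.smooth_vec
  smooth_bi _ := h.smooth_bi
  pullback X hX f hf := h.vec_proj X hX f hf
  linear := hl
  add _ _ := h.add
  smul _ hf _ := h.smul hf
  wedge _ _ := h.wedge

end IsLiftOn

end LiftsOnGenerators

/-! ### The complete lift of the algebroid `TM` -/

section TangentLift

variable {E H : Type*} [NormedAddCommGroup E] [NormedSpace ℝ E]
  [TopologicalSpace H] {I : ModelWithCorners ℝ E H}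
  {M : Type*} [TopologicalSpace M] [ChartedSpace H M] [IsManifold I ∞ M]

variable [FiniteDimensional ℝ E] [I.Boundaryless] [T2Space M]

theorem smoothSection_smul {F : Type*} [NormedAddCommGroup F] [NormedSpace ℝ F]
    {V : M → Type*} [TopologicalSpace (TotalSpace F V)]
    [∀ p, TopologicalSpace (V p)] [∀ p, AddCommGroup (V p)] [∀ p, Module ℝ (V p)]
    [FiberBundle F V] [VectorBundle ℝ F V] {f : M → ℝ} (hf : SmoothFun I f) {X : ∀ q, V q}
    (hX : SmoothSection I F X) : SmoothSection I F (fun p => f p • X p) :=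
  ContMDiff.smul_section hf hX

theorem tangentOps_d (f : M → ℝ) : (tangentOps I M).d f = diff I f := by
  funext p
  exact ContinuousLinearMap.comp_id _

variable (I M) in
/-- The forms `df`. -/
def exactForms : Set (∀ p : M, TangentSpace I p →L[ℝ] ℝ) := {α | ∃ f, SmoothFun I f ∧ α = diff I f}

theorem isLiftOn_tangentLift :
    IsLiftOn (F := E) (tangentOps I M) (exactForms I M) (tangentLift I M) where
  smooth := by
    rintro _ ⟨f, hf, rfl⟩
    exact smoothDual_diff hf
  smooth_d f hf := by
    rw [tangentOps_d]
    exact smoothDual_diff hf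
  coordinates e := by
    obtain ⟨κ, i, j, x, s, D, h, hD⟩ := exists_coordFrame_tangent e
    refine ⟨κ ⊕ κ, inferInstance, inferInstance, D, _, ?_, hD⟩
    rintro (k | k)
    · exact Or.inl ⟨x k, h.smooth k, rfl⟩
    · exact Or.inr ⟨_, ⟨x k, h.smooth k, rfl⟩, rfl⟩
  vec_proj X hX f hf e := by
    rw [tangentOps_d]
    exact (isVecLiftAt_tangentLift hX e f hf).1
  vec_linFun := by
    rintro X hX _ ⟨f, hf, rfl⟩ e
    rw [tangentOps_d]
    exact (isVecLiftAt_tangentLift hX e f hf).2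
  bi_proj_proj P hP f g hf hg e := (isBiLiftAt_tangentLift hP e f g hf hg).1
  bi_proj_linFun := by
    rintro P hP f hf _ ⟨g, hg, rfl⟩ e
    rw [tangentOps_d]
    exact (isBiLiftAt_tangentLift hP e f g hf hg).2.1
  bi_linFun_proj := by
    rintro P hP _ ⟨f, hf, rfl⟩ g hg e
    rw [tangentOps_d]
    exact (isBiLiftAt_tangentLift hP e f g hf hg).2.2.1
  bi_linFun_linFun := by
    rintro P hP _ ⟨f, hf, rfl⟩ _ ⟨g, hg, rfl⟩ e
    rw [tangentOps_d]
    exact (isBiLiftAt_tangentLift hP e f g hf hg).2.2.2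

/-- To pass from exact forms to any `μ`, write `μ = ∑ k, μ (s k) d(x k)` locally and use Leibniz.
The bracket in the Lie derivative is evaluated on the `d(x k)`, where it is a commutator of
derivations. -/
theorem isCompleteLift_tangentLift :
    IsCompleteLift E (tangentOps I M) (tangentLift I M) := by
  refine isLiftOn_tangentLift.isCompleteLift fun X hX μ hμ Y hY p => ?_
  obtain ⟨κ, _, _, x, s, h⟩ := exists_coordFrame (I := I) p
  have hw := isVecLiftAt_tangentLift hX (⟨p, Y p⟩ : TangentBundle I M)
  have hμk : ∀ k, SmoothFun I (fun q => μ q (s k q)) := fun k => hμ.apply (h.smooth_frame k)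
  have hYk : ∀ k, SmoothFun I (fun q => diff I (x k) q (Y q)) := fun k =>
    (h.smooth k).derivation hY
  have h1 : (fun q => μ q (Y q)) =ᶠ[𝓝 p] fun q =>
      ∑ k, μ q (s k q) * diff I (x k) q (Y q) := by
    filter_upwards [h.dual.eventually_dual] with q hq
    simpa using congrArg (fun T => T (Y q)) (hq (μ q))
  have hm : ∀ k, SmoothFun I (fun q => μ q (s k q) * diff I (x k) q (Y q)) :=
    fun k => (hμk k).mul (hYk k)
  have h2 : μ p (VectorField.mlieBracket I X Y p) = ∑ k, μ p (s k p) *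
      (diff I (fun q => diff I (x k) q (Y q)) p (X p) -
        diff I (fun q => diff I (x k) q (X q)) p (Y p)) := by
    simp only [← diff_mlieBracket_of_smooth (h.smooth _) hX hY]
    simpa using congrArg (fun T => T (VectorField.mlieBracket I X Y p)) (h.dual.dual_eq (μ p))
  have h3 : (tangentOps I M).lieDeriv X μ Y p =
      diff I (fun q => μ q (Y q)) p (X p) - μ p (VectorField.mlieBracket I X Y p) := rfl
  rw [CoordFrame.diff_linFun (e := (⟨p, Y p⟩ : TangentBundle I M)) h hμ, h3, h2,
    diff_congr h1, diff_sum fun k _ => (hm k).mdiffAt]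
  simp_rw [fun k => diff_mul (p := p) (hμk k).mdiffAt (hYk k).mdiffAt]
  simp only [_root_.add_apply, _root_.sum_apply, _root_.smul_apply, smul_eq_mul,
    fun k => (hw _ (h.smooth k)).2, fun k => (hw _ (hμk k)).1, ← Finset.sum_sub_distrib]
  exact Finset.sum_congr rfl fun k _ => by ring

end TangentLift

/-! ### Uniqueness of the complete lift on smooth sections and bisections -/

section Uniqueness

variable {E H M : Type*} [NormedAddCommGroup E] [NormedSpace ℝ E] [FiniteDimensional ℝ E]
  [TopologicalSpace H] {I : ModelWithCorners ℝ E H} [I.Boundaryless] [TopologicalSpace M]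
  [T2Space M] [ChartedSpace H M] [IsManifold I ∞ M]
  {F : Type*} [NormedAddCommGroup F] [NormedSpace ℝ F] [FiniteDimensional ℝ F]
  {V : M → Type*} [TopologicalSpace (TotalSpace F V)]
  [∀ p, TopologicalSpace (V p)] [∀ p, AddCommGroup (V p)] [∀ p, Module ℝ (V p)]
  [FiberBundle F V] [VectorBundle ℝ F V] [ContMDiffVectorBundle ∞ F V I]

variable (I F V) in
/-- The functions `f ∘ τ` and `ι_μ` on the total space of a vector bundle. -/
def totalSpaceGenerators : Set (TotalSpace F V → ℝ) :=
  {g | (∃ f : M → ℝ, SmoothFun I f ∧ g = fun e => f e.proj) ∨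
    ∃ μ : ∀ p, V p →L[ℝ] ℝ, SmoothDual I F μ ∧ g = linFun F μ}

theorem hasCoordinatesIn_totalSpace :
    HasCoordinatesIn (I.prod 𝓘(ℝ, F)) (totalSpaceGenerators I F V) := by
  intro e
  obtain ⟨x, hx, hx'⟩ := exists_smooth_coordinates (I := I) e.proj (Module.finBasis ℝ E)
  obtain ⟨θ, hθ, hθ'⟩ := exists_smooth_coframe (I := I) (F := F) (V := V) e.proj
    (Module.finBasis ℝ F)
  obtain ⟨D, hD⟩ := exists_dualFrame_totalSpace e _ _ hx hx' hθ hθ'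
  refine ⟨_, inferInstance, inferInstance, D, _, ?_, hD⟩
  rintro (k | k)
  · exact Or.inl ⟨x k, hx k, rfl⟩
  · exact Or.inr ⟨θ k, hθ k, rfl⟩

omit [FiniteDimensional ℝ F] in
theorem smoothSection_sum {ι : Type*} (t : Finset ι) {X : ι → ∀ q, V q}
    (hX : ∀ i, SmoothSection I F (X i)) : SmoothSection I F (fun p => ∑ i ∈ t, X i p) :=
  ContMDiff.sum_section fun i _ => hX i

theorem exists_smooth_frame (p : M) :
    ∃ (κ : Type) (_ : Fintype κ) (_ : DecidableEq κ) (s : κ → ∀ q, V q)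
      (θ : κ → ∀ q, V q →L[ℝ] ℝ), (∀ k, SmoothSection I F (s k)) ∧ DualFrame I F p s θ := by
  obtain ⟨θ, hθ, hθ'⟩ := exists_smooth_coframe (I := I) (F := F) (V := V) p
    (Module.finBasis ℝ F)
  obtain ⟨s, hs, h⟩ := exists_smooth_dualFrame p _ hθ hθ'
  exact ⟨_, inferInstance, inferInstance, s, θ, hs, h⟩

variable (I) in
-- The rule for `X^c(ι_μ)` is stated only at points of smooth sections; this makes it available at
-- every point of the total space.
theorem exists_smoothSection_through (e : TotalSpace F V) :
    ∃ Y : ∀ q, V q, SmoothSection I F Y ∧ Y e.proj = e.2 := by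
  obtain ⟨κ, _, _, s, θ, hs, h⟩ := exists_smooth_frame (I := I) (F := F) (V := V) e.proj
  exact ⟨fun q => ∑ k, θ k e.proj e.2 • s k q,
    smoothSection_sum _ fun k => smoothSection_smul contMDiff_const (hs k), h.sum_smul e.2⟩

theorem smoothBisection_zero : SmoothBisection I F (0 : Bitensor V) :=
  ⟨fun _ _ => rfl, fun _ _ _ _ => contMDiff_const⟩

theorem smoothBisection_sum {ι : Type*} (t : Finset ι) {P : ι → Bitensor V}
    (hP : ∀ i, SmoothBisection I F (P i)) : SmoothBisection I F (∑ i ∈ t, P i) := by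
  classical
  induction t using Finset.induction_on with
  | empty => exact smoothBisection_zero
  | insert a t ha ih => rw [Finset.sum_insert ha]; exact (hP a).add ih

namespace IsCompleteLift

variable {A : AlgebroidOps I V} {c c' : LiftMaps F I V}

theorem onVec_eq (hc : IsCompleteLift F A c) (hc' : IsCompleteLift F A c') {X : ∀ q, V q}
    (hX : SmoothSection I F X) : c.onVec X = c'.onVec X := by
  funext e
  refine hasCoordinatesIn_totalSpace.ext_vec ?_
  rintro y (⟨f, hf, rfl⟩ | ⟨μ, hμ, rfl⟩)
  · rw [hc.pullback X hX f hf, hc'.pullback X hX f hf]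
  · obtain ⟨Y, hY, hYe⟩ := exists_smoothSection_through I e
    obtain ⟨p, v⟩ := e
    obtain rfl : Y p = v := hYe
    rw [hc.linear X hX μ hμ Y hY, hc'.linear X hX μ hμ Y hY]

theorem onBi_zero (hc : IsCompleteLift F A c) : c.onBi 0 = 0 := by
  have := hc.add 0 0 smoothBisection_zero smoothBisection_zero
  rw [zero_add] at this
  funext e
  ext μ ν
  have h2 := congrArg (fun B => B e μ ν) this
  exact left_eq_add.1 h2

theorem onBi_sum (hc : IsCompleteLift F A c) {ι : Type*} (t : Finset ι) {P : ι → Bitensor V}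
    (hP : ∀ i, SmoothBisection I F (P i)) : c.onBi (∑ i ∈ t, P i) = ∑ i ∈ t, c.onBi (P i) := by
  classical
  induction t using Finset.induction_on with
  | empty => exact hc.onBi_zero
  | insert a t ha ih =>
    rw [Finset.sum_insert ha, Finset.sum_insert ha, hc.add _ _ (hP a) (smoothBisection_sum t hP), ih]

/-- Locality comes from the product rule. For a cutoff `χ` equal to `1` near the base point and
supported where `P = Q`, one has `(χ P)^c = P^c` at `e` because `dχ = 0` there; the same holds for
`Q`, and `χ P = χ Q` everywhere. -/
theorem onBi_congr (hc : IsCompleteLift F A c) {P Q : Bitensor V} (hP : SmoothBisection I F P)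
    (hQ : SmoothBisection I F Q) {e : TotalSpace F V} (h : ∀ᶠ q in 𝓝 e.proj, P q = Q q) :
    c.onBi P e = c.onBi Q e := by
  obtain ⟨χ, hχ, h1, hs⟩ := exists_cutoff (I := I) e.proj h
  have hd : linFun F (A.d χ) e = 0 := by
    have h2 : diff I χ e.proj = 0 := (diff_congr h1).trans (diff_const 1)
    have h3 : A.d χ e.proj = 0 := by
      rw [AlgebroidOps.d, h2, ContinuousLinearMap.zero_comp]
    rw [linFun, h3, _root_.zero_apply]
  have hχ1 : χ e.proj = 1 := h1.self_of_nhds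
  have hPQ : (fun q => χ q • P q) = fun q => χ q • Q q := by
    funext q
    by_cases hq : q ∈ tsupport χ
    · rw [hs hq]
    · rw [image_eq_zero_of_notMem_tsupport hq, zero_smul, zero_smul]
  have hP' := hc.smul χ hχ P hP e
  have hQ' := hc.smul χ hχ Q hQ e
  rw [hd, hχ1, zero_smul, zero_add, one_smul] at hP' hQ'
  rw [← hP', ← hQ', hPQ]

theorem onBi_eq (hc : IsCompleteLift F A c) (hc' : IsCompleteLift F A c') {P : Bitensor V}
    (hP : SmoothBisection I F P) : c.onBi P = c'.onBi P := by
  funext e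
  obtain ⟨κ, _, _, s, θ, hs, h⟩ := exists_smooth_frame (I := I) (F := F) (V := V) e.proj
  -- Locally `P = ½ ∑ P(θ k, θ l) s k ∧ s l`. The sum runs over ordered pairs, hence the half, and
  -- every summand is determined by the product rules and the lifts of the `s k`.
  have ha : ∀ i : κ × κ, SmoothFun I fun q => 2⁻¹ * P q (θ i.1 q) (θ i.2 q) := fun i =>
    contMDiff_const.mul (hP.2 _ _ (h.smooth_dual i.1) (h.smooth_dual i.2))
  have hw : ∀ i : κ × κ, SmoothBisection I F fun q => JacobiLift.wedge (s i.1 q) (s i.2 q) := fun i =>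
    smoothBisection_wedge (hs i.1) (hs i.2)
  have hQ := fun i => (hw i).smul (ha i)
  have hPQ : ∀ᶠ q in 𝓝 e.proj,
      P q = (∑ i : κ × κ, fun q => (2⁻¹ * P q (θ i.1 q) (θ i.2 q)) •
        JacobiLift.wedge (s i.1 q) (s i.2 q)) q := by
    filter_upwards [h.eventually_bi P] with q hq
    ext μ ν
    rw [Finset.sum_apply]
    simp only [LinearMap.sum_apply, LinearMap.smul_apply, smul_eq_mul, wedge_apply]
    have h2 : P q μ ν = 2⁻¹ * (P q μ ν - P q ν μ) := by
      rw [hP.skew q ν μ]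
      ring
    rw [h2, hq μ ν, hq ν μ, ← Finset.univ_product_univ, Finset.sum_product,
      ← Finset.sum_sub_distrib, Finset.mul_sum]
    refine Finset.sum_congr rfl fun k _ => ?_
    rw [← Finset.sum_sub_distrib, Finset.mul_sum]
    exact Finset.sum_congr rfl fun l _ => by ring
  rw [hc.onBi_congr hP (smoothBisection_sum _ hQ) hPQ,
    hc'.onBi_congr hP (smoothBisection_sum _ hQ) hPQ, hc.onBi_sum _ hQ, hc'.onBi_sum _ hQ,
    Finset.sum_apply, Finset.sum_apply]
  refine Finset.sum_congr rfl fun i _ => ?_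
  rw [hc.smul _ (ha i) _ (hw i), hc'.smul _ (ha i) _ (hw i),
    hc.wedge _ _ (hs i.1) (hs i.2), hc'.wedge _ _ (hs i.1) (hs i.2),
    hc.onVec_eq hc' (hs i.1), hc.onVec_eq hc' (hs i.2)]

/-- A single lift with the required properties suffices for the chosen one to have them. -/
theorem completeLift (hc : IsCompleteLift F A c) :
    IsCompleteLift F A (JacobiLift.completeLift F A) := by
  have : Nonempty (LiftMaps F I V) := ⟨⟨fun _ _ => 0, fun _ _ => 0⟩⟩
  exact Classical.epsilon_spec (p := IsCompleteLift F A) ⟨c, hc⟩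

end IsCompleteLift

end Uniqueness

/-! ### The manifold `TM ⊕ ℝ`: coordinates, levels of `t`, and `∂_t` -/

section Extension

variable {E H : Type*} [NormedAddCommGroup E] [NormedSpace ℝ E]
  [TopologicalSpace H] {I : ModelWithCorners ℝ E H}
  {M : Type*} [TopologicalSpace M] [ChartedSpace H M] [IsManifold I ∞ M]

theorem contMDiff_toTangent : ContMDiff (extModel I) (tangentModel I) ∞
    (fun e : ExtSpace I M => (⟨e.proj, e.2.1⟩ : TangentBundle I M)) := by
  intro e
  rw [contMDiffAt_totalSpace]
  have h := (contMDiffAt_totalSpace.1 (contMDiffAt_id (I := extModel I) (x := e) (n := ∞))).2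
  have hf : ContMDiff 𝓘(ℝ, E × ℝ) 𝓘(ℝ, E) ∞ Prod.fst := contDiff_fst.contMDiff
  exact ⟨contMDiff_proj _ _, hf.contMDiffAt.comp e h⟩

theorem smoothFun_coordT : SmoothFun (extModel I) (coordT I : ExtSpace I M → ℝ) := by
  intro e
  have h := (contMDiffAt_totalSpace.1 (contMDiffAt_id (I := extModel I) (x := e) (n := ∞))).2
  have hf : ContMDiff 𝓘(ℝ, E × ℝ) 𝓘(ℝ, ℝ) ∞ Prod.snd := contDiff_snd.contMDiff
  have hc := hf.contMDiffAt.comp e h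
  exact hc

theorem contMDiff_level (r : ℝ) : ContMDiff (tangentModel I) (extModel I) ∞
    (fun v : TangentBundle I M => (⟨v.proj, extMk I v.proj v.2 r⟩ : ExtSpace I M)) := by
  intro v
  rw [contMDiffAt_totalSpace]
  have h := (contMDiffAt_totalSpace.1 (contMDiffAt_id (I := tangentModel I) (x := v) (n := ∞))).2
  exact ⟨contMDiff_proj _ _, h.prodMk_space (contMDiffAt_const (c := r))⟩

theorem contMDiff_line (p : M) (v : TangentSpace I p) : ContMDiff 𝓘(ℝ, ℝ) (extModel I) ∞
    (fun s : ℝ => (⟨p, extMk I p v s⟩ : ExtSpace I M)) := by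
  intro s
  rw [contMDiffAt_totalSpace]
  refine ⟨contMDiffAt_const, ?_⟩
  have h : ContMDiffAt 𝓘(ℝ, ℝ) 𝓘(ℝ, E) ∞ (fun _ : ℝ =>
    (trivializationAt E (fun q : M => TangentSpace I q) p ⟨p, v⟩).2) s := contMDiffAt_const
  exact h.prodMk_space contMDiffAt_id

theorem SmoothDual.comp_fst {α : ∀ p : M, TangentSpace I p →L[ℝ] ℝ}
    (hα : SmoothDual I E (V := fun q : M => TangentSpace I q) α) :
    SmoothDual I (E × ℝ) (V := ExtFibre I M)
      (fun p => (α p).comp (ContinuousLinearMap.fst ℝ (TangentSpace I p) ℝ)) :=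
  ContMDiff.comp (g := linFun E α) hα contMDiff_toTangent

theorem smoothDual_cocycle : SmoothDual I (E × ℝ) (cocycle I : ∀ p : M, ExtFibre I M p →L[ℝ] ℝ) :=
  smoothFun_coordT

theorem SmoothDual.comp_incl {μ : ∀ p : M, ExtFibre I M p →L[ℝ] ℝ}
    (hμ : SmoothDual I (E × ℝ) μ) :
    SmoothDual I E (V := fun q : M => TangentSpace I q) (fun p => (μ p).comp (incl I p)) :=
  ContMDiff.comp (g := linFun (E × ℝ) μ) hμ (contMDiff_level 0)

theorem SmoothSection.fst {Y : ∀ p : M, ExtFibre I M p} (hY : SmoothSection I (E × ℝ) Y) :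
    SmoothSection I E (V := fun q : M => TangentSpace I q) (fun p => (Y p).1) :=
  contMDiff_toTangent.comp hY

theorem SmoothSection.snd {Y : ∀ p : M, ExtFibre I M p} (hY : SmoothSection I (E × ℝ) Y) :
    SmoothFun I (fun p => (Y p).2) :=
  smoothDual_cocycle.apply hY

theorem SmoothSection.incl {X : ∀ p : M, TangentSpace I p}
    (hX : SmoothSection I E (V := fun q : M => TangentSpace I q) X) :
    SmoothSection I (E × ℝ) (V := ExtFibre I M) (fun p => incl I p (X p)) :=
  (contMDiff_level 0).comp hX

theorem smoothSection_unit :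
    SmoothSection I (E × ℝ) (V := ExtFibre I M) (fun p => extMk I p 0 1) :=
  (contMDiff_level 1).comp
    (contMDiff_zeroSection ℝ (fun q : M => TangentSpace I q) : ContMDiff I (I.prod 𝓘(ℝ, E)) ∞ _)

/-- The forms `d_A f` on `TM ⊕ ℝ`, and the cocycle. -/
def extForms (I : ModelWithCorners ℝ E H) (M : Type*) [TopologicalSpace M] [ChartedSpace H M] :
    Set (∀ p : M, ExtFibre I M p →L[ℝ] ℝ) :=
  {α | (∃ f, SmoothFun I f ∧ α = (extOps I M).d f) ∨ α = cocycle I}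

theorem smoothDual_extOps_d {f : M → ℝ} (hf : SmoothFun I f) :
    SmoothDual I (E × ℝ) ((extOps I M).d f) :=
  (smoothDual_diff hf).comp_fst

/-- The forms `d_A (x k)` and the cocycle are the components of the product trivialization, so `x k
∘ τ`, `ι_{d_A (x k)}` and `t` are coordinates. -/
theorem hasCoordinatesIn_ext [FiniteDimensional ℝ E] [I.Boundaryless] [T2Space M] :
    HasCoordinatesIn (extModel I) (liftGenerators I (E × ℝ) (extForms I M)) := by
  intro e
  let b := Module.finBasis ℝ E
  let b' := b.prod (Module.Basis.singleton Unit ℝ)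
  obtain ⟨x, hx, hx'⟩ := exists_smooth_coordinates (I := I) e.proj b
  have h1 : ∀ k, ∀ᶠ q in 𝓝 e.proj, ∀ v : TangentSpace I q, diff I (x k) q v = b.coord k
      ((trivializationAt E (fun q : M => TangentSpace I q) e.proj).continuousLinearMapAt ℝ q v) := by
    rw [eventually_all] at hx'
    exact fun k => eventually_diff_of_eq_extChartAt (b.coord k).toContinuousLinearMap (hx' k)
  let θ : (Fin (Module.finrank ℝ E) ⊕ Unit) → ∀ q : M, ExtFibre I M q →L[ℝ] ℝ :=
    Sum.elim (fun k => (extOps I M).d (x k)) fun _ => cocycle I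
  have hθ : ∀ k, SmoothDual I (E × ℝ) (θ k) := by
    rintro (k | k)
    · exact smoothDual_extOps_d (hx k)
    · exact smoothDual_cocycle
  have hθ' : ∀ᶠ q in 𝓝 e.proj, ∀ k v, θ k q v = b'.coord k
      ((trivializationAt (E × ℝ) (ExtFibre I M) e.proj).continuousLinearMapAt ℝ q v) := by
    filter_upwards [eventually_all.2 h1,
      (trivializationAt (E × ℝ) (ExtFibre I M) e.proj).open_baseSet.mem_nhds
        (mem_baseSet_trivializationAt (E × ℝ) (ExtFibre I M) e.proj),
      (trivializationAt E (fun q : M => TangentSpace I q) e.proj).open_baseSet.mem_nhds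
        (mem_baseSet_trivializationAt E (fun q : M => TangentSpace I q) e.proj)] with q hq hb hb1 k v
    rw [continuousLinearMapAt_eq_snd _ hb]
    rcases k with k | k
    · have := hq k v.1
      rw [continuousLinearMapAt_eq_snd _ hb1] at this
      have h3 : b'.coord (Sum.inl k)
        ((trivializationAt (E × ℝ) (ExtFibre I M) e.proj) ⟨q, v⟩).2 =
        b.coord k ((trivializationAt (E × ℝ) (ExtFibre I M) e.proj) ⟨q, v⟩).2.1 := by simp [b']
      rw [h3]
      exact this
    · have h3 : b'.coord (Sum.inr k)
        ((trivializationAt (E × ℝ) (ExtFibre I M) e.proj) ⟨q, v⟩).2 =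
        ((trivializationAt (E × ℝ) (ExtFibre I M) e.proj) ⟨q, v⟩).2.2 := by simp [b']
      rw [h3]
      rfl
  obtain ⟨D, hD⟩ := exists_dualFrame_totalSpace e b b' hx hx' hθ hθ'
  refine ⟨_, inferInstance, inferInstance, D, _, ?_, hD⟩
  rintro (k | k | k)
  · exact Or.inl ⟨x k, hx k, rfl⟩
  · exact Or.inr ⟨_, Or.inl ⟨x k, hx k, rfl⟩, rfl⟩
  · exact Or.inr ⟨_, Or.inr rfl, rfl⟩

theorem diff_comp_levelMap {g : ExtSpace I M → ℝ} (hg : SmoothFun (extModel I) g)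
    (e : ExtSpace I M) : (diff (extModel I) g e).comp (levelMap I e) =
      diff (tangentModel I) (fun v : TangentBundle I M =>
        g ⟨v.proj, extMk I v.proj v.2 e.2.2⟩) (⟨e.proj, e.2.1⟩ : TangentBundle I M) := by
  ext w
  exact (diff_comp (f := g) (φ := fun v : TangentBundle I M =>
    (⟨v.proj, extMk I v.proj v.2 e.2.2⟩ : ExtSpace I M)) (q := ⟨e.proj, e.2.1⟩) hg.mdiffAt
    ((contMDiff_level e.2.2).mdifferentiable (by simp) _) w).symm

theorem diff_partialT {g : ExtSpace I M → ℝ} (hg : SmoothFun (extModel I) g)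
    (e : ExtSpace I M) : diff (extModel I) g e (partialT I e) =
      deriv (fun s : ℝ => g ⟨e.proj, extMk I e.proj e.2.1 s⟩) e.2.2 := by
  have h := diff_comp (f := g) (φ := fun s : ℝ =>
    (⟨e.proj, extMk I e.proj e.2.1 s⟩ : ExtSpace I M)) (q := e.2.2) (I' := 𝓘(ℝ, ℝ)) hg.mdiffAt
    ((contMDiff_line e.proj e.2.1).mdifferentiable (by simp) _) (1 : ℝ)
  have h2 : (diff 𝓘(ℝ, ℝ) (fun s : ℝ => g ⟨e.proj, extMk I e.proj e.2.1 s⟩) e.2.2 : ℝ →L[ℝ] ℝ) =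
      fderiv ℝ (fun s : ℝ => g ⟨e.proj, extMk I e.proj e.2.1 s⟩) e.2.2 := mfderiv_eq_fderiv
  exact h.symm.trans ((congrArg (fun T : ℝ →L[ℝ] ℝ => T 1) h2).trans fderiv_apply_one_eq_deriv)

theorem diff_proj_comp_levelMap {f : M → ℝ} (hf : SmoothFun I f) (e : ExtSpace I M) :
    (diff (extModel I) (fun e : ExtSpace I M => f e.proj) e).comp (levelMap I e) =
      diff (tangentModel I) (fun v : TangentBundle I M => f v.proj) ⟨e.proj, e.2.1⟩ :=
  diff_comp_levelMap hf.comp_proj e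

theorem diff_d_comp_levelMap {f : M → ℝ} (hf : SmoothFun I f) (e : ExtSpace I M) :
    (diff (extModel I) (linFun (E × ℝ) ((extOps I M).d f)) e).comp (levelMap I e) =
      diff (tangentModel I) (linFun E (diff I f)) (⟨e.proj, e.2.1⟩ : TangentBundle I M) :=
  diff_comp_levelMap (smoothDual_extOps_d hf) e

theorem diff_cocycle_comp_levelMap (e : ExtSpace I M) :
    (diff (extModel I) (linFun (E × ℝ) (cocycle I)) e).comp (levelMap I e) = 0 :=
  (diff_comp_levelMap smoothFun_coordT e).trans (diff_const e.2.2)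

theorem diff_proj_partialT {f : M → ℝ} (hf : SmoothFun I f) (e : ExtSpace I M) :
    diff (extModel I) (fun e : ExtSpace I M => f e.proj) e (partialT I e) = 0 :=
  (diff_partialT hf.comp_proj e).trans (deriv_const e.2.2 (f e.proj))

theorem diff_d_partialT {f : M → ℝ} (hf : SmoothFun I f) (e : ExtSpace I M) :
    diff (extModel I) (linFun (E × ℝ) ((extOps I M).d f)) e (partialT I e) = 0 :=
  (diff_partialT (smoothDual_extOps_d hf) e).trans (deriv_const e.2.2 (diff I f e.proj e.2.1))

theorem diff_cocycle_partialT (e : ExtSpace I M) :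
    diff (extModel I) (linFun (E × ℝ) (cocycle I)) e (partialT I e) = 1 :=
  (diff_partialT smoothFun_coordT e).trans (deriv_id _)

end Extension

/-! ### The complete lift of the algebroid `TM ⊕ ℝ` -/

section ExtensionLift

variable {E H : Type*} [NormedAddCommGroup E] [NormedSpace ℝ E]
  [TopologicalSpace H] {I : ModelWithCorners ℝ E H}
  {M : Type*} [TopologicalSpace M] [ChartedSpace H M]

/-- The bivector field `Λ` such that `P = Λ + I ∧ Γ`. -/
def tangentPart (P : Bitensor (ExtFibre I M)) : Bitensor (fun p : M => TangentSpace I p) :=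
  fun p => pushBi (ContinuousLinearMap.fst ℝ (TangentSpace I p) ℝ) (P p)

/-- The vector field `Γ` such that `P = Λ + I ∧ Γ`. -/
def vectorPart (P : Bitensor (ExtFibre I M)) (p : M) : TangentSpace I p :=
  (contract (cocycle I p) (P p)).1

variable [IsManifold I ∞ M]

variable (I M) in
/-- The complete lift of the algebroid `TM ⊕ ℝ`. -/
def extLift : LiftMaps (E × ℝ) I (ExtFibre I M) where
  onVec Y e := fromTM I ((tangentLift I M).onVec fun p => (Y p).1) e +
    linFun (E × ℝ) ((extOps I M).d fun p => (Y p).2) e • partialT I e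
  onBi P e := fromTMBi I ((tangentLift I M).onBi (tangentPart P)) e +
    wedge (partialT I e) (fromTM I ((tangentLift I M).onVec (vectorPart P)) e)

variable [FiniteDimensional ℝ E] [I.Boundaryless] [T2Space M]

theorem hasDualFrames_ext : HasDualFrames I (E × ℝ) (ExtFibre I M) := by
  intro p
  obtain ⟨κ, i, j, s, θ, -, h⟩ := exists_smooth_frame (I := I) (F := E × ℝ) (V := ExtFibre I M) p
  exact ⟨κ, i, j, s, θ, h⟩

theorem SmoothBisection.tangentPart {P : Bitensor (ExtFibre I M)}
    (hP : SmoothBisection I (E × ℝ) P) : SmoothBisection I E (tangentPart P) :=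
  ⟨fun _ _ => hP.1 _ _, fun _ _ hμ hν => hP.2 _ _ hμ.comp_fst hν.comp_fst⟩

theorem SmoothBisection.vectorPart {P : Bitensor (ExtFibre I M)}
    (hP : SmoothBisection I (E × ℝ) P) :
    SmoothSection I E (V := fun q : M => TangentSpace I q) (vectorPart P) :=
  (hP.smoothSection_contract hasDualFrames_ext smoothDual_cocycle).fst

theorem diff_vectorPart (P : Bitensor (ExtFibre I M)) (f : M → ℝ) (p : M) :
    diff I f p (vectorPart P p) = P p (cocycle I p) ((extOps I M).d f p) :=
  hasDualFrames_ext.apply_contract (cocycle I p) (P p) ((extOps I M).d f p)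

section Values

variable {Z : ∀ q : M, TangentSpace I q} {f : M → ℝ} (e : ExtSpace I M)

theorem diff_proj_fromTM_tangentLift (hZ : SmoothSection I E Z) (hf : SmoothFun I f) :
    diff (extModel I) (fun e : ExtSpace I M => f e.proj) e
      (fromTM I ((tangentLift I M).onVec Z) e) = diff I f e.proj (Z e.proj) :=
  (congrArg (fun T => T ((tangentLift I M).onVec Z ⟨e.proj, e.2.1⟩))
    (diff_proj_comp_levelMap hf e)).trans (isVecLiftAt_tangentLift hZ _ f hf).1

theorem diff_d_fromTM_tangentLift (hZ : SmoothSection I E Z) (hf : SmoothFun I f) :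
    diff (extModel I) (linFun (E × ℝ) ((extOps I M).d f)) e
      (fromTM I ((tangentLift I M).onVec Z) e) =
      linFun (E × ℝ) ((extOps I M).d fun q => diff I f q (Z q)) e :=
  (congrArg (fun T => T ((tangentLift I M).onVec Z ⟨e.proj, e.2.1⟩))
    (diff_d_comp_levelMap hf e)).trans (isVecLiftAt_tangentLift hZ _ f hf).2

theorem diff_cocycle_fromTM (Y : ∀ v : TangentBundle I M, TangentSpace (tangentModel I) v) :
    diff (extModel I) (linFun (E × ℝ) (cocycle I)) e (fromTM I Y e) = 0 :=
  congrArg (fun T => T (Y ⟨e.proj, e.2.1⟩)) (diff_cocycle_comp_levelMap e)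

end Values

/-- Fields lifted from `TM` annihilate `t` and act on `f ∘ τ`, `ι_{df}` as on `TM`, while `∂_t`
annihilates those and sends `t` to `1`. Hence pairings of exact forms see only `Λ^c`, and mixed
pairings with the cocycle see only `∂_t ∧ Γ^c`. -/
theorem isLiftOn_extLift :
    IsLiftOn (F := E × ℝ) (extOps I M) (extForms I M) (extLift I M) where
  smooth := by
    rintro _ (⟨f, hf, rfl⟩ | rfl)
    · exact smoothDual_extOps_d hf
    · exact smoothDual_cocycle
  smooth_d _ := smoothDual_extOps_d
  coordinates := hasCoordinatesIn_ext
  vec_proj X hX f hf e := by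
    simp only [extLift, map_add, map_smul, diff_proj_fromTM_tangentLift e hX.fst hf,
      diff_proj_partialT hf, smul_zero, add_zero]
    rfl
  vec_linFun := by
    rintro X hX _ (⟨f, hf, rfl⟩ | rfl) e
    · simp only [extLift, map_add, map_smul, diff_d_fromTM_tangentLift e hX.fst hf,
        diff_d_partialT hf, smul_zero, add_zero]
      rfl
    · simp only [extLift, map_add, map_smul, diff_cocycle_fromTM, diff_cocycle_partialT, zero_add,
        smul_eq_mul, mul_one]
      rfl
  bi_proj_proj P hP f g hf hg e := by
    simp only [extLift, fromTMBi, LinearMap.add_apply, pushBi_apply, wedge_apply,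
      diff_proj_comp_levelMap hf, diff_proj_comp_levelMap hg, diff_proj_partialT hf,
      diff_proj_partialT hg, zero_mul, sub_zero, add_zero]
    exact (isBiLiftAt_tangentLift hP.tangentPart _ f g hf hg).1
  bi_proj_linFun := by
    rintro P hP f hf _ (⟨g, hg, rfl⟩ | rfl) e
    · simp only [extLift, fromTMBi, LinearMap.add_apply, pushBi_apply, wedge_apply,
        diff_proj_comp_levelMap hf, diff_d_comp_levelMap hg, diff_proj_partialT hf,
        diff_d_partialT hg, zero_mul, sub_zero, add_zero]
      exact (isBiLiftAt_tangentLift hP.tangentPart _ f g hf hg).2.1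
    · simp only [extLift, fromTMBi, LinearMap.add_apply, pushBi_apply, wedge_apply,
        diff_cocycle_comp_levelMap, map_zero, diff_cocycle_partialT, diff_proj_partialT hf,
        diff_proj_fromTM_tangentLift e hP.vectorPart hf, diff_vectorPart, hP.skew _ (cocycle I _)]
      ring
  bi_linFun_proj := by
    rintro P hP _ (⟨g, hg, rfl⟩ | rfl) f hf e
    · simp only [extLift, fromTMBi, LinearMap.add_apply, pushBi_apply, wedge_apply,
        diff_proj_comp_levelMap hf, diff_d_comp_levelMap hg, diff_proj_partialT hf,
        diff_d_partialT hg, zero_mul, sub_zero, add_zero]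
      exact (isBiLiftAt_tangentLift hP.tangentPart _ g f hg hf).2.2.1
    · simp only [extLift, fromTMBi, LinearMap.add_apply, pushBi_apply, wedge_apply,
        diff_cocycle_comp_levelMap, map_zero, LinearMap.zero_apply, diff_cocycle_partialT,
        diff_proj_partialT hf, diff_proj_fromTM_tangentLift e hP.vectorPart hf, diff_vectorPart]
      ring
  bi_linFun_linFun := by
    rintro P hP _ (⟨f, hf, rfl⟩ | rfl) _ (⟨g, hg, rfl⟩ | rfl) e
    · simp only [extLift, fromTMBi, LinearMap.add_apply, pushBi_apply, wedge_apply,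
        diff_d_comp_levelMap hf, diff_d_comp_levelMap hg, diff_d_partialT hf,
        diff_d_partialT hg, zero_mul, sub_zero, add_zero]
      exact (isBiLiftAt_tangentLift hP.tangentPart _ f g hf hg).2.2.2
    · simp only [extLift, fromTMBi, LinearMap.add_apply, pushBi_apply, wedge_apply,
        diff_cocycle_comp_levelMap, map_zero, diff_cocycle_partialT, diff_d_partialT hf,
        diff_d_fromTM_tangentLift e hP.vectorPart hf, diff_vectorPart, diff_cocycle_fromTM]
      have hs : (fun q => P q ((extOps I M).d f q) (cocycle I q)) =
          fun q => -P q (cocycle I q) ((extOps I M).d f q) := funext fun q => hP.skew q _ _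
      rw [hs]
      simp only [linFun, AlgebroidOps.d_neg, _root_.neg_apply]
      ring
    · simp only [extLift, fromTMBi, LinearMap.add_apply, pushBi_apply, wedge_apply,
        diff_cocycle_comp_levelMap, map_zero, LinearMap.zero_apply, diff_cocycle_partialT,
        diff_d_partialT hg, diff_d_fromTM_tangentLift e hP.vectorPart hg, diff_vectorPart,
        diff_cocycle_fromTM]
      ring
    · simp only [extLift, fromTMBi, LinearMap.add_apply, pushBi_apply, wedge_apply,
        diff_cocycle_comp_levelMap, map_zero, diff_cocycle_fromTM, hP.1]
      simp [linFun, AlgebroidOps.d, diff_const]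

theorem isCompleteLift_extLift :
    IsCompleteLift (E × ℝ) (extOps I M) (extLift I M) := by
  refine isLiftOn_extLift.isCompleteLift fun X hX μ hμ Y hY p => ?_
  have hα := hμ.comp_incl
  have hg : SmoothFun I (fun q => μ q (extMk I q 0 1)) := hμ.apply smoothSection_unit
  -- Splitting `μ` as `α + g Φ`, with `α` the restriction to `TM` and `g = μ(0, 1)`, makes `ι_μ` the
  -- sum of a function independent of `t`, governed by the lift to `TM`, and of `(g ∘ τ) t`,
  -- governed by Leibniz.
  have hsplit : ∀ q (v : TangentSpace I q) (r : ℝ), μ q (extMk I q v r) =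
      (μ q).comp (incl I q) v + μ q (extMk I q 0 1) * r := by
    intro q v r
    have h1 : extMk I q v r = incl I q v + r • extMk I q 0 1 := by
      refine Prod.ext ?_ ?_
      · exact (by simp : v = v + r • (0 : TangentSpace I q))
      · exact (by simp : r = 0 + r • (1 : ℝ))
    rw [h1, map_add, map_smul, smul_eq_mul, mul_comm r]
    rfl
  have hlin : linFun (E × ℝ) μ = fun e : ExtSpace I M =>
      linFun (E × ℝ) (fun q => ((μ q).comp (incl I q)).comp
        (ContinuousLinearMap.fst ℝ (TangentSpace I q) ℝ)) e +
      μ e.proj (extMk I e.proj 0 1) * linFun (E × ℝ) (cocycle I) e :=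
    funext fun e => hsplit e.proj e.2.1 e.2.2
  set e : ExtSpace I M := ⟨p, Y p⟩ with he
  have hc : SmoothFun (extModel I) (linFun (E × ℝ) (cocycle I) : ExtSpace I M → ℝ) :=
    smoothFun_coordT
  have hm : SmoothFun (extModel I) (fun e : ExtSpace I M =>
      μ e.proj (extMk I e.proj 0 1) * linFun (E × ℝ) (cocycle I) e) :=
    (SmoothFun.comp_proj hg).mul smoothFun_coordT
  have h1 : diff (extModel I) (linFun (E × ℝ) (fun q => ((μ q).comp (incl I q)).comp
        (ContinuousLinearMap.fst ℝ (TangentSpace I q) ℝ))) e ((extLift I M).onVec X e) =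
      (tangentOps I M).lieDeriv (fun q => (X q).1) (fun q => (μ q).comp (incl I q))
        (fun q => (Y q).1) p := by
    rw [← isCompleteLift_tangentLift.linear _ hX.fst _ hα _ hY.fst]
    have hz : diff (extModel I) (linFun (E × ℝ) (fun q => ((μ q).comp (incl I q)).comp
        (ContinuousLinearMap.fst ℝ (TangentSpace I q) ℝ))) e (partialT I e) = 0 :=
      (diff_partialT hα.comp_fst e).trans (deriv_const e.2.2 (μ p (incl I p (Y p).1)))
    simp only [extLift, map_add, map_smul, hz, smul_zero, add_zero]
    exact congrArg (fun T => T ((tangentLift I M).onVec (fun q => (X q).1) ⟨p, (Y p).1⟩))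
      (diff_comp_levelMap hα.comp_fst e)
  have h2 := isLiftOn_extLift.vec_proj X hX _ hg e
  have h3 := isLiftOn_extLift.vec_linFun X hX _ (Or.inr rfl) e
  have h4 : (fun q => μ q (Y q)) = fun q => (μ q).comp (incl I q) (Y q).1 +
      μ q (extMk I q 0 1) * (Y q).2 := funext fun q => hsplit q (Y q).1 (Y q).2
  have m1 : SmoothFun I (fun q => (μ q).comp (incl I q) (Y q).1) := hα.apply hY.fst
  have m2 : SmoothFun I (fun q => μ q (extMk I q 0 1) * (Y q).2) := hg.mul hY.snd
  have h5 : μ p ((extOps I M).bracket X Y p) = (μ p).comp (incl I p)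
      (VectorField.mlieBracket I (fun q => (X q).1) (fun q => (Y q).1) p) +
      μ p (extMk I p 0 1) * (diff I (fun q => ((Y q).2 : ℝ)) p (X p).1 -
        diff I (fun q => ((X q).2 : ℝ)) p (Y p).1) := hsplit _ _ _
  rw [hlin, diff_add (SmoothFun.mdiffAt hα.comp_fst) hm.mdiffAt, diff_mul hg.comp_proj.mdiffAt
    hc.mdiffAt, AlgebroidOps.lieDeriv, h4, diff_add m1.mdiffAt m2.mdiffAt,
    diff_mul hg.mdiffAt hY.snd.mdiffAt, h5]
  simp only [_root_.add_apply, _root_.smul_apply, smul_eq_mul, h1, h2, h3]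
  have h6 : linFun (E × ℝ) (cocycle I) e = (Y p).2 := rfl
  have h7 : linFun (E × ℝ) ((extOps I M).d fun q => cocycle I q (X q)) e =
      diff I (fun q => ((X q).2 : ℝ)) p (Y p).1 := rfl
  have h8 : ∀ f : M → ℝ, (extOps I M).d f e.proj (X e.proj) = diff I f p (X p).1 := fun _ => rfl
  have h9 : (extOps I M).anchor p (X p) = (X p).1 := rfl
  have h10 : (tangentOps I M).lieDeriv (fun q => (X q).1) (fun q => (μ q).comp (incl I q))
      (fun q => (Y q).1) p = diff I (fun q => (μ q).comp (incl I q) (Y q).1) p (X p).1 -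
        (μ p).comp (incl I p)
          (VectorField.mlieBracket I (fun q => (X q).1) (fun q => (Y q).1) p) := rfl
  have h11 : μ e.proj (extMk I e.proj 0 1) = μ p (extMk I p 0 1) := rfl
  rw [h6, h7, h8, h9, h10, h11]
  ring

end ExtensionLift

/-! ### Smoothness of vertical lifts and of the Liouville field -/

section VerticalLift

variable {E H M : Type*} [NormedAddCommGroup E] [NormedSpace ℝ E]
  [TopologicalSpace H] {I : ModelWithCorners ℝ E H} [TopologicalSpace M]
  [ChartedSpace H M] [IsManifold I ∞ M]
  {F : Type*} [NormedAddCommGroup F] [NormedSpace ℝ F]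
  {V : M → Type*} [TopologicalSpace (TotalSpace F V)]
  [∀ p, TopologicalSpace (V p)] [∀ p, AddCommGroup (V p)] [∀ p, Module ℝ (V p)]
  [FiberBundle F V] [VectorBundle ℝ F V] [ContMDiffVectorBundle ∞ F V I]
  {C : Set (∀ p, V p →L[ℝ] ℝ)} (h : HasCoordinatesIn (I.prod 𝓘(ℝ, F)) (liftGenerators I F C))
  (hC : ∀ α ∈ C, SmoothDual I F α)

include h hC

theorem smoothSection_vLift {X : ∀ p, V p} (hX : SmoothSection I F X) :
    SmoothSection (I.prod 𝓘(ℝ, F)) (E × F) (vLift I F X) := by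
  refine h.smoothSection ?_
  rintro y (⟨f, hf, rfl⟩ | ⟨α, hα, rfl⟩)
  · simp only [vLift, diff_proj_vert hf]
    exact contMDiff_const
  · simp only [vLift, diff_linFun_vert (hC α hα)]
    exact SmoothFun.comp_proj ((hC α hα).apply hX)

theorem smoothSection_liouville :
    SmoothSection (I.prod 𝓘(ℝ, F)) (E × F)
      (liouville I F : ∀ e : TotalSpace F V, TangentSpace (I.prod 𝓘(ℝ, F)) e) := by
  refine h.smoothSection ?_
  rintro y (⟨f, hf, rfl⟩ | ⟨α, hα, rfl⟩)
  · simp only [diff_proj_liouville hf]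
    exact contMDiff_const
  · simp only [diff_linFun_liouville (hC α hα)]
    exact hC α hα

theorem smoothBisection_vLiftBi {P : Bitensor V} (hP : SmoothBisection I F P) :
    SmoothBisection (I.prod 𝓘(ℝ, F)) (E × F) (vLiftBi I F P) := by
  refine h.smoothBisection ?_ ?_
  · intro y _ z _ e
    exact hP.skew _ _ _
  · rintro y (⟨f, hf, rfl⟩ | ⟨α, hα, rfl⟩) z (⟨g, hg, rfl⟩ | ⟨β, hβ, rfl⟩)
    · simp only [vLiftBi, pushBi_apply, diff_proj_comp_vert hf, map_zero, LinearMap.zero_apply]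
      exact contMDiff_const
    · simp only [vLiftBi, pushBi_apply, diff_proj_comp_vert hf, map_zero, LinearMap.zero_apply]
      exact contMDiff_const
    · simp only [vLiftBi, pushBi_apply, diff_proj_comp_vert hg, map_zero]
      exact contMDiff_const
    · simp only [vLiftBi, pushBi_apply, diff_linFun_comp_vert (hC α hα),
        diff_linFun_comp_vert (hC β hβ)]
      exact SmoothFun.comp_proj (hP.2 _ _ (hC α hα) (hC β hβ))

end VerticalLift

/-! ### The explicit formula for the Jacobi lift, and its smoothness -/

section Lift

variable {E H : Type*} [NormedAddCommGroup E] [NormedSpace ℝ E]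
  [TopologicalSpace H] {I : ModelWithCorners ℝ E H}
  {M : Type*} [TopologicalSpace M] [ChartedSpace H M]

namespace BiOp

theorem toExt_apply (X : BiOp I M) (p : M) (μ ν : ExtFibre I M p →L[ℝ] ℝ) :
    X.toExt p μ ν = X.biv p (μ.comp (incl I p)) (ν.comp (incl I p)) +
      (μ (extMk I p 0 1) * ν (incl I p (X.vec p)) - ν (extMk I p 0 1) * μ (incl I p (X.vec p))) :=
  rfl

/-- `Φ` vanishes on `TM` and equals `1` on `I`, so contracting it with `Λ + I ∧ Γ` leaves `Γ`. -/
theorem toExt_cocycle (X : BiOp I M) (p : M) (ν : ExtFibre I M p →L[ℝ] ℝ) :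
    X.toExt p (cocycle I p) ν = ν (incl I p (X.vec p)) := by
  have h1 : (cocycle I p).comp (incl I p) = 0 := rfl
  have h2 : cocycle I p (extMk I p 0 1) = 1 := rfl
  have h3 : cocycle I p (incl I p (X.vec p)) = 0 := rfl
  rw [toExt_apply, h1, h2, h3, map_zero, LinearMap.zero_apply]
  ring

theorem tangentPart_toExt (X : BiOp I M) : tangentPart X.toExt = X.biv := by
  funext p
  ext μ ν
  have h : ∀ μ : TangentSpace I p →L[ℝ] ℝ,
      μ.comp (ContinuousLinearMap.fst ℝ (TangentSpace I p) ℝ) (extMk I p 0 1) = 0 :=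
    fun μ => map_zero μ
  refine (toExt_apply X p _ _).trans ?_
  rw [h, h, zero_mul, zero_mul, sub_zero, add_zero]
  rfl

variable [IsManifold I ∞ M]

theorem smoothBisection_toExt {X : BiOp I M} (hb : SmoothBisection I E X.biv)
    (hv : SmoothSection I E X.vec) : SmoothBisection I (E × ℝ) X.toExt := by
  have h1 : SmoothBisection I (E × ℝ) (V := ExtFibre I M)
      (fun p => pushBi (JacobiLift.incl I p) (X.biv p)) :=
    ⟨fun p μ => hb.1 _ _, fun μ ν hμ hν => hb.2 _ _ hμ.comp_incl hν.comp_incl⟩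
  exact h1.add (smoothBisection_wedge smoothSection_unit hv.incl)

variable [FiniteDimensional ℝ E] [I.Boundaryless] [T2Space M]

theorem contract_toExt (X : BiOp I M) (p : M) :
    contract (cocycle I p) (X.toExt p) = JacobiLift.incl I p (X.vec p) :=
  hasDualFrames_ext.ext_vec fun ν => by
    rw [hasDualFrames_ext.apply_contract, toExt_cocycle]

theorem vectorPart_toExt (X : BiOp I M) : vectorPart X.toExt = X.vec :=
  funext fun p => congrArg Prod.fst (X.contract_toExt p)

end BiOp

variable [IsManifold I ∞ M]

variable [FiniteDimensional ℝ E] [I.Boundaryless] [T2Space M]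

/-- Both sides kill pull-backs and `t` and send `ι_{df}` to `df(w)`; these functions contain
coordinates. -/
theorem vert_incl (e : ExtSpace I M) (w : TangentSpace I e.proj) :
    vert I (E × ℝ) e (incl I e.proj w) =
      levelMap I e (vert I E (⟨e.proj, e.2.1⟩ : TangentBundle I M) w) := by
  refine hasCoordinatesIn_ext.ext_vec ?_
  rintro y (⟨f, hf, rfl⟩ | ⟨_, ⟨f, hf, rfl⟩ | rfl, rfl⟩)
  · rw [diff_proj_vert hf]
    exact ((congrArg (fun T => T (vert I E (⟨e.proj, e.2.1⟩ : TangentBundle I M) w))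
      (diff_proj_comp_levelMap hf e)).trans (diff_proj_vert (F := E)
        (V := fun q : M => TangentSpace I q) hf ⟨e.proj, e.2.1⟩ w)).symm
  · rw [diff_linFun_vert (smoothDual_extOps_d hf)]
    exact ((congrArg (fun T => T (vert I E (⟨e.proj, e.2.1⟩ : TangentBundle I M) w))
      (diff_d_comp_levelMap hf e)).trans (diff_linFun_vert (smoothDual_diff hf) _ w)).symm
  · rw [diff_linFun_vert smoothDual_cocycle]
    exact (congrArg (fun T => T (vert I E (⟨e.proj, e.2.1⟩ : TangentBundle I M) w))
      (diff_cocycle_comp_levelMap e)).symm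

theorem vert_unit (e : ExtSpace I M) :
    vert I (E × ℝ) e (extMk I e.proj 0 1) = partialT I e := by
  refine hasCoordinatesIn_ext.ext_vec ?_
  rintro y (⟨f, hf, rfl⟩ | ⟨_, ⟨f, hf, rfl⟩ | rfl, rfl⟩)
  · rw [diff_proj_vert hf, diff_proj_partialT hf]
  · rw [diff_linFun_vert (smoothDual_extOps_d hf), diff_d_partialT hf]
    exact map_zero (diff I f e.proj)
  · rw [diff_linFun_vert smoothDual_cocycle, diff_cocycle_partialT]
    rfl

theorem BiOp.vLiftBi_toExt (X : BiOp I M) (e : ExtSpace I M) :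
    vLiftBi I (E × ℝ) X.toExt e = fromTMBi I (vLiftBi I E X.biv) e +
      wedge (partialT I e) (fromTM I (vLift I E X.vec) e) := by
  have h : (vert I (E × ℝ) e).comp (incl I e.proj) = (levelMap I e).comp
      (vert I E (⟨e.proj, e.2.1⟩ : TangentBundle I M)) :=
    ContinuousLinearMap.ext fun w => vert_incl e w
  ext μ ν
  refine (toExt_apply X e.proj _ _).trans ?_
  simp only [ContinuousLinearMap.comp_assoc, h]
  simp only [ContinuousLinearMap.comp_apply, vert_unit, vert_incl]
  rfl

/-- Uniqueness replaces the chosen complete lifts on both sides by the constructed ones, for which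
the formula is the definition of `extLift`; the vertical terms split according to `TM` and `ℝ`. -/
theorem BiOp.lift_eq_explicitLift {X : BiOp I M} (hb : SmoothBisection I E X.biv)
    (hv : SmoothSection I E X.vec) : X.lift = X.explicitLift := by
  have hP := smoothBisection_toExt hb hv
  refine BiOp.ext ?_ ?_
  · funext e
    simp only [BiOp.lift, BiOp.explicitLift, jacobiLift]
    rw [isCompleteLift_extLift.completeLift.onBi_eq isCompleteLift_extLift hP,
      isCompleteLift_tangentLift.completeLift.onBi_eq isCompleteLift_tangentLift hb,
      isCompleteLift_tangentLift.completeLift.onVec_eq isCompleteLift_tangentLift hv,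
      X.vLiftBi_toExt]
    simp only [extLift, X.tangentPart_toExt, X.vectorPart_toExt]
    rfl
  · funext e
    simp only [BiOp.lift, BiOp.explicitLift, jacobiLift, vLift, X.contract_toExt, vert_incl]
    rfl

theorem BiOp.lift_biv {X : BiOp I M} (hb : SmoothBisection I E X.biv)
    (hv : SmoothSection I E X.vec) (e : ExtSpace I M) : X.lift.biv e =
      (extLift I M).onBi X.toExt e -
        linFun (E × ℝ) (cocycle I) e • vLiftBi I (E × ℝ) X.toExt e := by
  rw [← isCompleteLift_extLift.completeLift.onBi_eq isCompleteLift_extLift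
    (smoothBisection_toExt hb hv)]
  rfl

theorem BiOp.lift_vec (X : BiOp I M) :
    X.lift.vec = vLift I (E × ℝ) (fun p => incl I p (X.vec p)) := by
  funext e
  simp only [BiOp.lift, jacobiLift, vLift, X.contract_toExt]

theorem BiOp.smoothBisection_lift_biv {X : BiOp I M} (hb : SmoothBisection I E X.biv)
    (hv : SmoothSection I E X.vec) :
    SmoothBisection (extModel I) (E × (E × ℝ)) X.lift.biv := by
  have hP := smoothBisection_toExt hb hv
  have h1 := isLiftOn_extLift.smooth_bi hP
  have h2 := (smoothBisection_vLiftBi hasCoordinatesIn_ext isLiftOn_extLift.smooth hP).smul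
    (smoothFun_coordT (I := I) (M := M)).neg
  have h3 : X.lift.biv = (extLift I M).onBi X.toExt +
      fun e => (-coordT I) e • vLiftBi I (E × ℝ) X.toExt e := by
    funext e
    rw [X.lift_biv hb hv]
    ext μ ν
    simp only [LinearMap.sub_apply, LinearMap.smul_apply, Pi.add_apply, LinearMap.add_apply,
      Pi.neg_apply, smul_eq_mul, neg_mul, ← sub_eq_add_neg]
    rfl
  rw [h3]
  exact h1.add h2

theorem BiOp.smoothSection_lift_vec {X : BiOp I M} (hv : SmoothSection I E X.vec) :
    SmoothSection (extModel I) (E × (E × ℝ)) X.lift.vec := by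
  rw [X.lift_vec]
  exact smoothSection_vLift hasCoordinatesIn_ext isLiftOn_extLift.smooth hv.incl

end Lift

/-! ### The bracket of the functions `a ∘ τ + ι_{df} + t (f ∘ τ)` -/

section AffineFunctions

variable {E H : Type*} [NormedAddCommGroup E] [NormedSpace ℝ E]
  [TopologicalSpace H] {I : ModelWithCorners ℝ E H}
  {M : Type*} [TopologicalSpace M] [ChartedSpace H M]

theorem BiOp.toExt_d_d (X : BiOp I M) (f g : M → ℝ) (p : M) :
    X.toExt p ((extOps I M).d f p) ((extOps I M).d g p) = X.biv p (diff I f p) (diff I g p) := by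
  have h : ∀ f, (extOps I M).d f p (extMk I p 0 1) = 0 := fun f => map_zero (diff I f p)
  rw [toExt_apply, h, h, zero_mul, zero_mul, sub_zero, add_zero]
  rfl

variable [IsManifold I ∞ M]

/-- The function `a ∘ τ + ι_{df} + t (f ∘ τ)` on `TM ⊕ ℝ`. -/
def affineFun (I : ModelWithCorners ℝ E H) (a f : M → ℝ) (e : ExtSpace I M) : ℝ :=
  a e.proj + (linFun (E × ℝ) ((extOps I M).d f) e + f e.proj * linFun (E × ℝ) (cocycle I) e)

theorem smoothFun_linFun_cocycle :
    SmoothFun (extModel I) (linFun (E × ℝ) (cocycle I) : ExtSpace I M → ℝ) :=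
  smoothFun_coordT

theorem smoothFun_affineFun {a f : M → ℝ} (ha : SmoothFun I a) (hf : SmoothFun I f) :
    SmoothFun (extModel I) (affineFun I a f) :=
  ha.comp_proj.add (ContMDiff.add (smoothDual_extOps_d hf)
    (hf.comp_proj.mul smoothFun_linFun_cocycle))

theorem diff_affineFun {a f : M → ℝ} (ha : SmoothFun I a) (hf : SmoothFun I f)
    (e : ExtSpace I M) : diff (extModel I) (affineFun I a f) e =
      diff (extModel I) (fun e : ExtSpace I M => a e.proj) e +
      (diff (extModel I) (linFun (E × ℝ) ((extOps I M).d f)) e +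
        (f e.proj • diff (extModel I) (linFun (E × ℝ) (cocycle I)) e +
          linFun (E × ℝ) (cocycle I) e • diff (extModel I) (fun e : ExtSpace I M => f e.proj) e)) := by
  have h1 : SmoothFun (extModel I) (fun e : ExtSpace I M =>
      f e.proj * linFun (E × ℝ) (cocycle I) e) := hf.comp_proj.mul smoothFun_linFun_cocycle
  have h2 : SmoothFun (extModel I) (fun e : ExtSpace I M =>
      linFun (E × ℝ) ((extOps I M).d f) e + f e.proj * linFun (E × ℝ) (cocycle I) e) :=
    ContMDiff.add (smoothDual_extOps_d hf) h1
  rw [← diff_mul hf.comp_proj.mdiffAt smoothFun_linFun_cocycle.mdiffAt,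
    ← diff_add (SmoothFun.mdiffAt (smoothDual_extOps_d hf)) h1.mdiffAt,
    ← diff_add ha.comp_proj.mdiffAt h2.mdiffAt]
  rfl

theorem affineFun_add {a b f g : M → ℝ} (hf : SmoothFun I f) (hg : SmoothFun I g)
    (e : ExtSpace I M) :
    affineFun I (fun q => a q + b q) (fun q => f q + g q) e =
      affineFun I a f e + affineFun I b g e := by
  simp only [affineFun, linFun, (extOps I M).d_add hf hg, _root_.add_apply]
  ring

theorem affineFun_const_zero (a : M → ℝ) (e : ExtSpace I M) (c : ℝ) :
    affineFun I a (fun _ => c) e = a e.proj + c * linFun (E × ℝ) (cocycle I) e := by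
  simp [affineFun, linFun, AlgebroidOps.d, diff_const]

/-- On each fibre `a ∘ τ` is constant, while `ι_{df}` and `t (f ∘ τ)` are linear. -/
theorem diff_affineFun_liouville {a f : M → ℝ} (ha : SmoothFun I a) (hf : SmoothFun I f)
    (e : ExtSpace I M) :
    diff (extModel I) (affineFun I a f) e (liouville I (E × ℝ) e) =
      affineFun I (fun _ => 0) f e := by
  rw [diff_affineFun ha hf]
  simp only [_root_.add_apply, _root_.smul_apply, smul_eq_mul, diff_proj_liouville ha,
    diff_proj_liouville hf, diff_linFun_liouville (smoothDual_extOps_d hf),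
    diff_linFun_liouville smoothDual_cocycle, affineFun]
  ring

variable [FiniteDimensional ℝ E] [I.Boundaryless] [T2Space M]

section Bracket

variable {X : BiOp I M} (hb : SmoothBisection I E X.biv) (hv : SmoothSection I E X.vec)
include hb hv

/-- The lift intertwines the bracket of the functions `a ∘ τ + ι_{df} + t (f ∘ τ)` with the
bracket of the pairs `(a, f)`. -/
theorem BiOp.bracket_lift_affineFun {a f b g : M → ℝ} (ha : SmoothFun I a) (hf : SmoothFun I f)
    (hb' : SmoothFun I b) (hg : SmoothFun I g) :
    X.lift.bracket (affineFun I a f) (affineFun I b g) =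
      affineFun I (fun q => X.bracket a g q + X.bracket f b q) (X.bracket f g) := by
  funext e
  have hP := smoothBisection_toExt hb hv
  have hΦ : cocycle I ∈ extForms I M := Or.inr rfl
  have hd : ∀ {k}, SmoothFun I k → (extOps I M).d k ∈ extForms I M := fun hk =>
    Or.inl ⟨_, hk, rfl⟩
  have hL := isLiftOn_extLift (I := I) (M := M)
  have hsk := hP.skew
  have hcd : ∀ k p, X.toExt p (cocycle I p) ((extOps I M).d k p) = diff I k p (X.vec p) :=
    fun k p => X.toExt_cocycle p _
  have hdc : ∀ k p, X.toExt p ((extOps I M).d k p) (cocycle I p) = -diff I k p (X.vec p) := by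
    intro k p
    rw [hsk, hcd]
  have v1 : ∀ {k}, SmoothFun I k → diff (extModel I) (fun e : ExtSpace I M => k e.proj) e
      (X.lift.vec e) = 0 := fun hk => by rw [X.lift_vec, vLift, diff_proj_vert hk]
  have v2 : ∀ {k}, SmoothFun I k → diff (extModel I) (linFun (E × ℝ) ((extOps I M).d k)) e
      (X.lift.vec e) = diff I k e.proj (X.vec e.proj) := fun hk => by
    rw [X.lift_vec, vLift, diff_linFun_vert (smoothDual_extOps_d hk)]
    rfl
  have v3 : diff (extModel I) (linFun (E × ℝ) (cocycle I)) e (X.lift.vec e) = 0 := by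
    rw [X.lift_vec, vLift, diff_linFun_vert smoothDual_cocycle]
    rfl
  have hbiv : X.lift.biv e = _ := X.lift_biv hb hv e
  simp only [BiOp.bracket, diff_affineFun ha hf, diff_affineFun hb' hg, hbiv, map_add, map_smul,
    LinearMap.add_apply, LinearMap.smul_apply, LinearMap.sub_apply, smul_eq_mul,
    _root_.add_apply, _root_.smul_apply, v1 ha, v1 hf, v1 hb', v1 hg, v2 hf, v2 hg, v3,
    vLiftBi, pushBi_apply, diff_proj_comp_vert ha, diff_proj_comp_vert hf, diff_proj_comp_vert hb',
    diff_proj_comp_vert hg, diff_linFun_comp_vert (smoothDual_extOps_d hf),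
    diff_linFun_comp_vert (smoothDual_extOps_d hg), diff_linFun_comp_vert smoothDual_cocycle,
    map_zero, LinearMap.zero_apply, hP.1, hcd, hdc, X.toExt_d_d,
    hL.bi_proj_proj _ hP _ _ ha hb', hL.bi_proj_proj _ hP _ _ ha hg,
    hL.bi_proj_proj _ hP _ _ hf hb', hL.bi_proj_proj _ hP _ _ hf hg,
    hL.bi_proj_linFun _ hP _ ha _ (hd hg), hL.bi_proj_linFun _ hP _ hf _ (hd hg),
    hL.bi_proj_linFun _ hP _ ha _ hΦ, hL.bi_proj_linFun _ hP _ hf _ hΦ,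
    hL.bi_linFun_proj _ hP _ (hd hf) _ hb', hL.bi_linFun_proj _ hP _ (hd hf) _ hg,
    hL.bi_linFun_proj _ hP _ hΦ _ hb', hL.bi_linFun_proj _ hP _ hΦ _ hg,
    hL.bi_linFun_linFun _ hP _ (hd hf) _ (hd hg), hL.bi_linFun_linFun _ hP _ (hd hf) _ hΦ,
    hL.bi_linFun_linFun _ hP _ hΦ _ (hd hg), hL.bi_linFun_linFun _ hP _ hΦ _ hΦ]
  have m1 : SmoothFun I (fun q => X.biv q (diff I f q) (diff I g q)) :=
    hb.2 _ _ (smoothDual_diff hf) (smoothDual_diff hg)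
  have m2 : SmoothFun I (fun q => f q * diff I g q (X.vec q)) := hf.mul (hg.derivation hv)
  have m3 : SmoothFun I (fun q => g q * diff I f q (X.vec q)) := hg.mul (hf.derivation hv)
  have m4 : SmoothFun I (fun q => X.biv q (diff I f q) (diff I g q) +
      f q * diff I g q (X.vec q)) := m1.add m2
  -- Leibniz for `d{f, g}`: the terms containing `d(Γ(g))` and `d(Γ(f))` will match `∂_t ∧ Γ^c`, and
  -- those with undifferentiated `Γ(g)`, `Γ(f)` will match `I ∧ Γ^v`.
  have hB : (extOps I M).d (X.bracket f g) e.proj =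
      (extOps I M).d (fun q => X.biv q (diff I f q) (diff I g q)) e.proj +
      (f e.proj • (extOps I M).d (fun q => diff I g q (X.vec q)) e.proj +
        diff I g e.proj (X.vec e.proj) • (extOps I M).d f e.proj) -
      (g e.proj • (extOps I M).d (fun q => diff I f q (X.vec q)) e.proj +
        diff I f e.proj (X.vec e.proj) • (extOps I M).d g e.proj) := by
    rw [← AlgebroidOps.d_mul _ hf (hg.derivation hv), ← AlgebroidOps.d_mul _ hg (hf.derivation hv),
      ← AlgebroidOps.d_add _ m1 m2, ← AlgebroidOps.d_sub _ m4 m3]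
    rfl
  simp only [affineFun, linFun, hB, AlgebroidOps.d_neg, _root_.add_apply, _root_.sub_apply,
    _root_.smul_apply, _root_.neg_apply, smul_eq_mul]
  have hz : (extOps I M).d (fun _ => (0 : ℝ)) e.proj = 0 := by
    rw [AlgebroidOps.d, diff_const, ContinuousLinearMap.zero_comp]
  simp only [hz, _root_.zero_apply, BiOp.bracket]
  -- In the coefficient of `t`, the complete lift contributes `2 Λ(df, dg) + f Γ(g) - g Γ(f)` and `I
  -- ∧ Γ^v` contributes `f Γ(g) - g Γ(f)`. The correction `-ι_Φ X^v` removes one copy of `{f, g}`,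
  -- leaving exactly `{f, g}`.
  ring

end Bracket

end AffineFunctions

/-! ### Jacobi identity and homogeneity of the lift -/

section HomogeneousJacobi

variable {E H : Type*} [NormedAddCommGroup E] [NormedSpace ℝ E] [FiniteDimensional ℝ E]
  [TopologicalSpace H] {I : ModelWithCorners ℝ E H} [I.Boundaryless]
  {M : Type*} [TopologicalSpace M] [T2Space M] [ChartedSpace H M] [IsManifold I ∞ M]

/-- The functions `a ∘ τ + ι_{df} + t (f ∘ τ)` realize all `1`-jets. -/
theorem exists_affineFun_eq_jet {F : ExtSpace I M → ℝ} (e : ExtSpace I M) :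
    ∃ a f : M → ℝ, SmoothFun I a ∧ SmoothFun I f ∧ F e = affineFun I a f e ∧
      diff (extModel I) F e = diff (extModel I) (affineFun I a f) e := by
  -- The attained differentials at `e` form a subspace, so it suffices that it contains the
  -- differentials of coordinate functions.
  let S : Submodule ℝ (TangentSpace (extModel I) e →L[ℝ] ℝ) :=
    { carrier := {μ | ∃ a f : M → ℝ, SmoothFun I a ∧ SmoothFun I f ∧
        μ = diff (extModel I) (affineFun I a f) e}
      add_mem' := by
        rintro _ _ ⟨a, f, ha, hf, rfl⟩ ⟨b, g, hb, hg, rfl⟩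
        refine ⟨fun q => a q + b q, fun q => f q + g q, ha.add hb, hf.add hg, ?_⟩
        rw [← diff_add (smoothFun_affineFun ha hf).mdiffAt (smoothFun_affineFun hb hg).mdiffAt]
        exact congrArg (fun y => diff (extModel I) y e)
          (funext fun e => (affineFun_add hf hg e).symm)
      zero_mem' := by
        refine ⟨fun _ => 0, fun _ => 0, contMDiff_const, contMDiff_const, ?_⟩
        rw [← diff_const (I := extModel I) (p := e) 0]
        refine congrArg (fun y => diff (extModel I) y e) (funext fun e => ?_)
        rw [affineFun_const_zero]
        ring
      smul_mem' := by
        rintro c _ ⟨a, f, ha, hf, rfl⟩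
        have hca : SmoothFun I (fun q => c * a q) := contMDiff_const.mul ha
        have hcf : SmoothFun I (fun q => c * f q) := contMDiff_const.mul hf
        refine ⟨fun q => c * a q, fun q => c * f q, hca, hcf, ?_⟩
        rw [← diff_const_mul c (smoothFun_affineFun ha hf).mdiffAt]
        refine congrArg (fun y => diff (extModel I) y e) (funext fun e => ?_)
        simp only [affineFun, linFun, AlgebroidOps.d, diff_const_mul c hf.mdiffAt,
          ContinuousLinearMap.smul_comp, _root_.smul_apply, smul_eq_mul]
        ring }
  have hS : ∀ y ∈ liftGenerators I (E × ℝ) (extForms I M), diff (extModel I) y e ∈ S := by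
    rintro y (⟨a, ha, rfl⟩ | ⟨_, ⟨f, hf, rfl⟩ | rfl, rfl⟩)
    · refine ⟨a, fun _ => 0, ha, contMDiff_const, ?_⟩
      refine congrArg (fun y => diff (extModel I) y e) (funext fun e => ?_)
      rw [affineFun_const_zero]
      ring
    · set t := linFun (E × ℝ) (cocycle I) e with ht
      -- To isolate `d(ι_{df})` at `e`: replacing `f` by `f - f(τ(e))` kills the `dt` term there,
      -- and `a = -t f`, with `t` frozen at its value at `e`, cancels the remaining `t d(f ∘ τ)`.
      have h1 : SmoothFun I (fun q => -t * f q) := contMDiff_const.mul hf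
      have h2 : SmoothFun I (fun q => f q - f e.proj) := hf.sub contMDiff_const
      have h3 : (extOps I M).d (fun q => f q - f e.proj) = (extOps I M).d f := by
        funext p
        rw [AlgebroidOps.d, diff_sub hf.mdiffAt mdifferentiableAt_const, diff_const, sub_zero]
        rfl
      refine ⟨_, _, h1, h2, ?_⟩
      rw [diff_affineFun h1 h2, h3, diff_const_mul _ hf.comp_proj.mdiffAt,
        diff_sub hf.comp_proj.mdiffAt mdifferentiableAt_const, diff_const, ← ht, sub_self,
        zero_smul, sub_zero]
      ext w
      simp only [_root_.add_apply, _root_.smul_apply, _root_.zero_apply, smul_eq_mul]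
      ring
    · refine ⟨fun _ => 0, fun _ => 1, contMDiff_const, contMDiff_const, ?_⟩
      refine congrArg (fun y => diff (extModel I) y e) (funext fun e => ?_)
      rw [affineFun_const_zero]
      ring
  obtain ⟨κ, _, _, D, y, hy, hD⟩ := hasCoordinatesIn_ext e
  have hF : diff (extModel I) F e ∈ S := by
    rw [hD.dual_eq (diff (extModel I) F e)]
    exact S.sum_mem fun k _ => S.smul_mem _ (hS _ (hy k))
  obtain ⟨a, f, ha, hf, h⟩ := hF
  -- Adding a constant to `a` corrects the value at `e` without changing the differential.
  set c := F e - affineFun I a f e with hc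
  have hac : SmoothFun I (fun q => a q + c) := ha.add contMDiff_const
  have h1 : affineFun I (fun q => a q + c) f = fun e => affineFun I a f e + c := by
    funext e
    simp only [affineFun]
    ring
  refine ⟨fun q => a q + c, f, hac, hf, ?_, ?_⟩
  · rw [h1, hc]
    ring
  · rw [h1, diff_add (smoothFun_affineFun ha hf).mdiffAt mdifferentiableAt_const, diff_const,
      add_zero, h]

theorem affineFun_add_add_eq_zero {a b c f g h : M → ℝ} (hf : SmoothFun I f) (hg : SmoothFun I g)
    (hh : SmoothFun I h) (h1 : ∀ p, a p + b p + c p = 0) (h2 : ∀ p, f p + g p + h p = 0)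
    (e : ExtSpace I M) : affineFun I a f e + affineFun I b g e + affineFun I c h e = 0 := by
  have hfg : SmoothFun I (fun q => f q + g q) := hf.add hg
  rw [← affineFun_add hf hg, ← affineFun_add hfg hh]
  simp only [h1, h2]
  rw [affineFun_const_zero]
  ring

variable {X : BiOp I M}

theorem BiOp.IsJacobi.smoothFun_bracket (hX : X.IsJacobi) {f g : M → ℝ} (hf : SmoothFun I f)
    (hg : SmoothFun I g) : SmoothFun I (X.bracket f g) :=
  BiOp.smoothFun_bracket hX.smooth_biv hX.smooth_vec hf hg

/-- The first component is the coefficient of `ε` in `{{f + ε a, g + ε b}, h + ε c}`. -/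
theorem BiOp.IsJacobi.bracket_lift_bracket_lift (hX : X.IsJacobi) {a f b g c h : M → ℝ}
    (ha : SmoothFun I a) (hf : SmoothFun I f) (hb : SmoothFun I b) (hg : SmoothFun I g)
    (hc : SmoothFun I c) (hh : SmoothFun I h) :
    X.lift.bracket (X.lift.bracket (affineFun I a f) (affineFun I b g)) (affineFun I c h) =
      affineFun I (fun q => X.bracket (X.bracket a g) h q + X.bracket (X.bracket f b) h q +
        X.bracket (X.bracket f g) c q) (X.bracket (X.bracket f g) h) := by
  have hs := @BiOp.IsJacobi.smoothFun_bracket _ _ _ _ _ _ I _ M _ _ _ _ X hX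
  have h1 : SmoothFun I (fun q => X.bracket a g q + X.bracket f b q) := (hs ha hg).add (hs hf hb)
  rw [BiOp.bracket_lift_affineFun hX.smooth_biv hX.smooth_vec ha hf hb hg,
    BiOp.bracket_lift_affineFun hX.smooth_biv hX.smooth_vec h1 (hs hf hg) hc hh]
  congr 1
  funext q
  rw [BiOp.bracket_add_left _ (hs ha hg) (hs hf hb)]

variable (I M) in
/-- The set of the functions `a ∘ τ + ι_{df} + t (f ∘ τ)`. -/
def affineFuns : Set (ExtSpace I M → ℝ) :=
  {y | ∃ a f : M → ℝ, SmoothFun I a ∧ SmoothFun I f ∧ y = affineFun I a f}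

theorem smoothFun_of_mem_affineFuns : ∀ y ∈ affineFuns I M, SmoothFun (extModel I) y := by
  rintro _ ⟨a, f, ha, hf, rfl⟩
  exact smoothFun_affineFun ha hf

theorem exists_mem_affineFuns_eq_jet (F : ExtSpace I M → ℝ) (_ : SmoothFun (extModel I) F)
    (e : ExtSpace I M) :
    ∃ y ∈ affineFuns I M, F e = y e ∧ diff (extModel I) F e = diff (extModel I) y e := by
  obtain ⟨a, f, ha, hf, h⟩ := exists_affineFun_eq_jet (F := F) e
  exact ⟨_, ⟨a, f, ha, hf, rfl⟩, h⟩

theorem BiOp.IsJacobi.lift (hX : X.IsJacobi) : X.lift.IsJacobi where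
  smooth_biv := BiOp.smoothBisection_lift_biv hX.smooth_biv hX.smooth_vec
  smooth_vec := BiOp.smoothSection_lift_vec hX.smooth_vec
  jacobi F G K hF hG hK e := by
    refine BiOp.jacobiator_eq_zero_of_generators
      (BiOp.smoothBisection_lift_biv hX.smooth_biv hX.smooth_vec)
      (BiOp.smoothSection_lift_vec hX.smooth_vec) hasCoordinatesIn_ext.hasDualFrames
      smoothFun_of_mem_affineFuns exists_mem_affineFuns_eq_jet ?_ hF hG hK e
    rintro _ ⟨a, f, ha, hf, rfl⟩ _ ⟨b, g, hb, hg, rfl⟩ _ ⟨c, h, hc, hh, rfl⟩ e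
    have hs := @BiOp.IsJacobi.smoothFun_bracket _ _ _ _ _ _ I _ M _ _ _ _ X hX
    rw [BiOp.jacobiator, hX.bracket_lift_bracket_lift ha hf hb hg hc hh,
      hX.bracket_lift_bracket_lift hb hg hc hh ha hf,
      hX.bracket_lift_bracket_lift hc hh ha hf hb hg]
    refine affineFun_add_add_eq_zero (hs (hs hf hg) hh) (hs (hs hg hh) hf) (hs (hs hh hf) hg)
      (fun p => ?_) (fun p => hX.jacobi f g h hf hg hh p) e
    -- The coefficient of `ε` in the Jacobiator is a sum of three Jacobiators on `M`, each with one
    -- argument replaced by its `ε`-part.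
    have h1 := hX.jacobi a g h ha hg hh p
    have h2 := hX.jacobi f b h hf hb hh p
    have h3 := hX.jacobi f g c hf hg hc p
    linarith

theorem BiOp.IsJacobi.isHomogeneous_lift (hX : X.IsJacobi) :
    IsHomogeneous (E × ℝ) X.lift := by
  intro F G hF hG e
  have hs := @BiOp.IsJacobi.smoothFun_bracket _ _ _ _ _ _ I _ M _ _ _ _ X hX
  have key := BiOp.homogeneityDefect_eq_zero_of_generators
    (BiOp.smoothBisection_lift_biv hX.smooth_biv hX.smooth_vec)
    (BiOp.smoothSection_lift_vec hX.smooth_vec) hasCoordinatesIn_ext.hasDualFrames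
    (smoothSection_liouville hasCoordinatesIn_ext isLiftOn_extLift.smooth)
    smoothFun_of_mem_affineFuns exists_mem_affineFuns_eq_jet ?_ hF hG e
  · unfold BiOp.homogeneityDefect at key
    dsimp only
    linarith
  rintro _ ⟨a, f, ha, hf, rfl⟩ _ ⟨b, g, hb, hg, rfl⟩ e
  have h0 : SmoothFun I (fun _ : M => (0 : ℝ)) := contMDiff_const
  have hl := @BiOp.bracket_lift_affineFun _ _ _ _ _ I M _ _ _ _ _ _ X hX.smooth_biv hX.smooth_vec
  have h1 : SmoothFun I (fun q => X.bracket a g q + X.bracket f b q) := (hs ha hg).add (hs hf hb)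
  have hz : ∀ k p, X.bracket (fun _ => 0) k p = 0 := fun k p => by simp [BiOp.bracket, diff_const]
  have hz' : ∀ k p, X.bracket k (fun _ => 0) p = 0 := fun k p => by simp [BiOp.bracket, diff_const]
  rw [BiOp.homogeneityDefect]
  simp only [diff_affineFun_liouville ha hf, diff_affineFun_liouville hb hg]
  rw [hl ha hf hb hg, diff_affineFun_liouville h1 (hs hf hg)]
  -- With `∇ A(a, f) = A(0, f)`, the brackets `{∇F, G}` and `{F, ∇G}` are `A({f, b}, {f, g})` and
  -- `A({a, g}, {f, g})`, and `∇{F, G}` is `A(0, {f, g})`; the defect cancels.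
  have e1 := congrFun (hl h0 hf hb hg) e
  have e2 := congrFun (hl ha hf h0 hg) e
  simp only [hz, hz', zero_add, add_zero] at e1 e2
  refine (congrArg₂ (fun x y => _ - x - y + _) e1 e2).trans ?_
  simp only [affineFun]
  ring

end HomogeneousJacobi

end JacobiLift

end

theorem corollary1 {E : Type*} [NormedAddCommGroup E] [NormedSpace ℝ E] [FiniteDimensional ℝ E]
    {M : Type*} [TopologicalSpace M] [T2Space M] [ChartedSpace E M] [IsManifold 𝓘(ℝ, E) ∞ M] :
    IsCompleteLift E (tangentOps 𝓘(ℝ, E) M) (completeLift E (tangentOps 𝓘(ℝ, E) M)) ∧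
    IsCompleteLift (E × ℝ) (extOps 𝓘(ℝ, E) M) (completeLift (E × ℝ) (extOps 𝓘(ℝ, E) M)) ∧
    ∀ X : BiOp 𝓘(ℝ, E) M, X.IsJacobi →
      X.lift.IsJacobi ∧ IsHomogeneous (E × ℝ) X.lift ∧ X.lift = X.explicitLift :=
  ⟨isCompleteLift_tangentLift.completeLift, isCompleteLift_extLift.completeLift,
    fun _ hX => ⟨hX.lift, hX.isHomogeneous_lift,
      BiOp.lift_eq_explicitLift hX.smooth_biv hX.smooth_vec⟩⟩
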